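/- Let $L>0$ and let $k\in L^2((0,L)\times(0,L))$ be a real kernel. Consider the integral transport equation $$ \begin{cases} y_t(t,x)-y_x(t,x)=\displaystyle\int_0^L k(x,\xi)\,y(t,\xi)\,d\xi, & t\in(0,T),\ x\in(0,L),\\ y(t,L)=u(t), & t\in(0,T),\\ y(0,x)=y^0(x), & x\in(0,L), \end{cases} $$ with state $y(t,\cdot)$ in the real space $L^2(0,L)$ and control $u\in L^2(0,T)$ (real-valued). In abstract form it reads $y'=A_{\mathcal K}y+Bu$, where $$ A_{\mathcal K}y=y_x+\int_0^Lk(\cdot,\xi)y(\xi)\,d\xi,\qquad D(A_{\mathcal K})=\{y\in H^1(0,L):\ y(L)=0\}, $$ and $B$ is given by $\langle Bu,z\rangle=u\,z(L)$ for $z\in D(A_{\mathcal K}^*)\subset H^1(0,L)$, i.e. $B^*z=z(L)$. The solution is understood by transposition: $y\in C^0([0,T];L^2(0,L))$ and, for every $\tau\in[0,T]$ and every $z\in C^1([0,\tau];L^2(0,L))\cap C^0([0,\tau];D(A_{\mathcal K}^*))$ with $z'=-A_{\mathcal K}^*z$ on $[0,\tau]$, $$ \langle y(\tau),z(\tau)\rangle-\langle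 y^0,z(0)\rangle=\int_0^\tau u(t)\,B^*z(t)\,dt . $$ The equation is exactly controllable in time $T$ if for all $y^0,y^1\in L^2(0,L)$ there is $u\in L^2(0,T)$ such that the solution satisfies $y(T)=y^1$; it is approximately controllable in time $T$ if for every $\varepsilon>0$ and all $y^0,y^1\in L^2(0,L)$ there is $u\in L^2(0,T)$ such that the solution satisfies $\|y(T)-y^1\|_{L^2(0,L)}\le\varepsilon$. Then: (i) The equation is exactly controllable in time $T=L$ if and only if it is approximately controllable in time $T=L$. (ii) For every $T>L$, the equation is exactly controllable in time $T$ if and only if the Fattorini criterion $$ \ker(\lambda-A_{\mathcal K}^*)\cap\ker B^*=\{0\}\qquad\text{for all }\lambda\in\mathbb C $$ holds, where $A_{\mathcal K}$ and $B$ denote here the complexified operators, acting on $L^2(0,L;\mathbb C)$ (same formulas). In particular, the equation is exactly controllable in every time $T>L$ if and only if the Fattorini criterion holds. -/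

import Mathlib

open MeasureTheory Set
open scoped ContDiff LinearPMap

/-! ## Abstract controlled linear systems

A control system `y' = A y + B u` on a Hilbert space `H` with control space `U` is described by the
unbounded operator `A : H →ₗ.[𝕜] H` and by the adjoint `Bs : D(A*) → U` of the control operator
`B ∈ L(U, D(A*)')`, that is, `⟨B u, z⟩ = ⟨u, Bs z⟩` for `z ∈ D(A*)`. -/

section AbstractControl

variable {𝕜 H U : Type*} [RCLike 𝕜]
  [NormedAddCommGroup H] [InnerProductSpace 𝕜 H] [NormedSpace ℝ H] [CompleteSpace H]
  [NormedAddCommGroup U] [InnerProductSpace 𝕜 U]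

/-- `z` is a classical solution on `[0, τ]` of the backward adjoint equation `z' = -A* z`,
i.e. it lies in `C¹([0, τ]; H) ∩ C⁰([0, τ]; D(A*))` (equivalently,
`z t = S_A(τ - t)* z(τ)` with `z(τ) ∈ D(A*)`). -/
def IsAdjointSolution (A : H →ₗ.[𝕜] H) (τ : ℝ) (z : ℝ → A†.domain) : Prop :=
  (∀ t ∈ Icc 0 τ, HasDerivWithinAt (fun s => (z s : H)) (-(A† (z t))) (Icc 0 τ) t) ∧
    ContinuousOn (fun t => A† (z t)) (Icc 0 τ)

/-- `y ∈ C⁰([0, T]; H)` is the solution by transposition of `y' = A y + B u` on `(0, T)`,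
`y(0) = y₀`: for every `τ ∈ [0, T]` and every solution `z` of the backward adjoint equation on
`[0, τ]`, `⟨y(τ), z(τ)⟩ - ⟨y₀, z(0)⟩ = ∫₀^τ ⟨u(t), B* z(t)⟩ dt`.
(The Mathlib inner product is linear in its second argument.) -/
def IsTranspositionSolution (A : H →ₗ.[𝕜] H) (Bs : A†.domain → U) (T : ℝ) (y₀ : H)
    (u : ℝ → U) (y : ℝ → H) : Prop :=
  ContinuousOn y (Icc 0 T) ∧
    ∀ τ ∈ Icc 0 T, ∀ z : ℝ → A†.domain, IsAdjointSolution A τ z →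
      inner 𝕜 (z τ : H) (y τ) - inner 𝕜 (z 0 : H) y₀ = ∫ t in (0 : ℝ)..τ, inner 𝕜 (Bs (z t)) (u t)

/-- Exact controllability in time `T`, with controls in `L²(0, T; U)`. -/
def ExactlyControllable (A : H →ₗ.[𝕜] H) (Bs : A†.domain → U) (T : ℝ) : Prop :=
  ∀ y₀ y₁ : H, ∃ u : ℝ → U, MemLp u 2 (volume.restrict (Ioo 0 T)) ∧
    ∃ y : ℝ → H, IsTranspositionSolution A Bs T y₀ u y ∧ y T = y₁

/-- Approximate controllability in time `T`, with controls in `L²(0, T; U)`. -/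
def ApproximatelyControllable (A : H →ₗ.[𝕜] H) (Bs : A†.domain → U) (T : ℝ) : Prop :=
  ∀ ε : ℝ, 0 < ε → ∀ y₀ y₁ : H, ∃ u : ℝ → U, MemLp u 2 (volume.restrict (Ioo 0 T)) ∧
    ∃ y : ℝ → H, IsTranspositionSolution A Bs T y₀ u y ∧ ‖y T - y₁‖ ≤ ε

/-- The Fattorini criterion `ker (lam - A*) ∩ ker B* = {0}` for all scalars `lam`
(to be used over `ℂ`). -/
def FattoriniCriterion (A : H →ₗ.[𝕜] H) (Bs : A†.domain → U) : Prop :=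
  ∀ lam : 𝕜, ∀ z : A†.domain, A† z = lam • (z : H) → Bs z = 0 → z = 0

end AbstractControl

namespace IntegralTransport

noncomputable section

/-- Lebesgue measure on `(0, L)`. -/
abbrev μI (L : ℝ) : Measure ℝ := volume.restrict (Ioo 0 L)

/-- The space `L²(0, L; 𝕜)`. -/
abbrev L2 (𝕜 : Type*) [RCLike 𝕜] (L : ℝ) : Type _ := Lp 𝕜 2 (μI L)

variable {𝕜 : Type*} [RCLike 𝕜] {L : ℝ}

/-- `g ∈ L²(0, L)` is the weak derivative of `y ∈ L²(0, L)`. -/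
def HasWeakDeriv (y g : L2 𝕜 L) : Prop :=
  ∀ φ : ℝ → ℝ, ContDiff ℝ ∞ φ → HasCompactSupport φ → tsupport φ ⊆ Ioo 0 L →
    ∫ x in Ioo 0 L, deriv φ x • y x = -∫ x in Ioo 0 L, φ x • g x

/-- `y` has a representative that is continuous on `[0, L]` and takes the value `c` at `x`. -/
def HasTrace (y : L2 𝕜 L) (x : ℝ) (c : 𝕜) : Prop :=
  ∃ f : ℝ → 𝕜, ContinuousOn f (Icc 0 L) ∧ y =ᵐ[μI L] f ∧ f x = c

open Classical in
/-- The value at `x ∈ [0, L]` of the continuous representative of `y`, for instance for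
`y ∈ H¹(0, L)` (and `0` by convention if `y` has no continuous representative). -/
def trace (y : L2 𝕜 L) (x : ℝ) : 𝕜 :=
  if h : ∃ c, HasTrace y x c then h.choose else 0

theorem HasTrace.unique (hL : 0 < L) {y : L2 𝕜 L} {x : ℝ} (hx : x ∈ Icc 0 L) {c d : 𝕜}
    (hc : HasTrace y x c) (hd : HasTrace y x d) : c = d := by
  obtain ⟨f, hf, hyf, rfl⟩ := hc
  obtain ⟨g, hg, hyg, rfl⟩ := hd
  have hfg : f =ᵐ[volume.restrict (Ioo 0 L)] g := hyf.symm.trans hyg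
  have h1 : EqOn f g (Ioo 0 L) :=
    Measure.eqOn_open_of_ae_eq hfg isOpen_Ioo (hf.mono Ioo_subset_Icc_self)
      (hg.mono Ioo_subset_Icc_self)
  have h2 : EqOn f g (Icc 0 L) :=
    h1.of_subset_closure hf hg Ioo_subset_Icc_self (by rw [closure_Ioo hL.ne])
  exact h2 hx

theorem HasTrace.trace_eq (hL : 0 < L) {y : L2 𝕜 L} {x : ℝ} (hx : x ∈ Icc 0 L) {c : 𝕜}
    (hc : HasTrace y x c) : trace y x = c := by
  have h : ∃ c, HasTrace y x c := ⟨c, hc⟩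
  rw [trace, dif_pos h]
  exact h.choose_spec.unique hL hx hc

theorem HasTrace.zero (x : ℝ) : HasTrace (0 : L2 𝕜 L) x 0 :=
  ⟨fun _ => 0, continuousOn_const, Lp.coeFn_zero _ _ _, rfl⟩

theorem HasTrace.add {y z : L2 𝕜 L} {x : ℝ} {c d : 𝕜} (hy : HasTrace y x c)
    (hz : HasTrace z x d) : HasTrace (y + z) x (c + d) := by
  obtain ⟨f, hf, hyf, rfl⟩ := hy
  obtain ⟨g, hg, hzg, rfl⟩ := hz
  exact ⟨f + g, hf.add hg, (Lp.coeFn_add y z).trans (hyf.add hzg), rfl⟩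

theorem HasTrace.smul (a : 𝕜) {y : L2 𝕜 L} {x : ℝ} {c : 𝕜} (hy : HasTrace y x c) :
    HasTrace (a • y) x (a * c) := by
  obtain ⟨f, hf, hyf, rfl⟩ := hy
  exact ⟨a • f, hf.const_smul a, (Lp.coeFn_smul a y).trans (hyf.const_smul a), rfl⟩

theorem integrable_coe (y : L2 𝕜 L) : Integrable y (μI L) :=
  (Lp.memLp y).integrable (by norm_num)

theorem integrable_smul_coe (y : L2 𝕜 L) {φ : ℝ → ℝ} (h : Continuous φ)
    (hc : HasCompactSupport φ) : Integrable (fun x => φ x • y x) (μI L) := by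
  obtain ⟨C, hC⟩ := hc.exists_bound_of_continuous h
  exact (integrable_coe y).bdd_smul C h.aestronglyMeasurable (.of_forall hC)

theorem HasWeakDeriv.unique {y g₁ g₂ : L2 𝕜 L} (h₁ : HasWeakDeriv y g₁)
    (h₂ : HasWeakDeriv y g₂) : g₁ = g₂ := by
  rw [← sub_eq_zero]
  have key := isOpen_Ioo.ae_eq_zero_of_integral_contDiff_smul_eq_zero (U := Ioo 0 L)
    (μ := μI L) (f := (g₁ - g₂ : L2 𝕜 L))
    ((integrable_coe (g₁ - g₂)).locallyIntegrable.locallyIntegrableOn _) (by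
      intro φ hφ hc hs
      have e : ∫ x, φ x • (g₁ - g₂ : L2 𝕜 L) x ∂μI L = ∫ x, (φ x • g₁ x - φ x • g₂ x) ∂μI L := by
        refine integral_congr_ae ?_
        filter_upwards [Lp.coeFn_sub g₁ g₂] with x hx
        rw [hx, Pi.sub_apply, smul_sub]
      rw [e, integral_sub (integrable_smul_coe g₁ hφ.continuous hc)
        (integrable_smul_coe g₂ hφ.continuous hc), sub_eq_zero]
      exact neg_injective ((h₁ φ hφ hc hs).symm.trans (h₂ φ hφ hc hs)))
  rw [Lp.eq_zero_iff_ae_eq_zero]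
  filter_upwards [key, ae_restrict_mem measurableSet_Ioo] with x hx hm using hx hm

theorem HasWeakDeriv.zero : HasWeakDeriv (0 : L2 𝕜 L) 0 := by
  intro φ _ _ _
  have h0 : ((0 : L2 𝕜 L) : ℝ → 𝕜) =ᵐ[μI L] 0 := Lp.coeFn_zero _ _ _
  have h (ψ : ℝ → ℝ) : ∫ x, ψ x • (0 : L2 𝕜 L) x ∂μI L = 0 := by
    refine integral_eq_zero_of_ae ?_
    filter_upwards [h0] with x hx
    rw [hx, Pi.zero_apply, smul_zero]
  rw [h, h, neg_zero]

theorem HasWeakDeriv.add {y₁ y₂ g₁ g₂ : L2 𝕜 L} (h₁ : HasWeakDeriv y₁ g₁)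
    (h₂ : HasWeakDeriv y₂ g₂) : HasWeakDeriv (y₁ + y₂) (g₁ + g₂) := by
  intro φ hφ hc hs
  have h (ψ : ℝ → ℝ) (hψ : Continuous ψ) (hψc : HasCompactSupport ψ) (a b : L2 𝕜 L) :
      ∫ x, ψ x • (a + b : L2 𝕜 L) x ∂μI L
        = (∫ x, ψ x • a x ∂μI L) + ∫ x, ψ x • b x ∂μI L := by
    rw [← integral_add (integrable_smul_coe a hψ hψc) (integrable_smul_coe b hψ hψc)]
    refine integral_congr_ae ?_
    filter_upwards [Lp.coeFn_add a b] with x hx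
    rw [hx, Pi.add_apply, smul_add]
  rw [h _ (hφ.continuous_deriv (by simp)) hc.deriv, h _ hφ.continuous hc, h₁ φ hφ hc hs,
    h₂ φ hφ hc hs, neg_add]

theorem HasWeakDeriv.smul (a : 𝕜) {y g : L2 𝕜 L} (h : HasWeakDeriv y g) :
    HasWeakDeriv (a • y) (a • g) := by
  intro φ hφ hc hs
  have h' (ψ : ℝ → ℝ) (b : L2 𝕜 L) :
      ∫ x, ψ x • (a • b : L2 𝕜 L) x ∂μI L = a • ∫ x, ψ x • b x ∂μI L := by
    rw [← integral_smul]
    refine integral_congr_ae ?_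
    filter_upwards [Lp.coeFn_smul a b] with x hx
    rw [hx, Pi.smul_apply, smul_comm]
  rw [h', h', h φ hφ hc hs, smul_neg]

variable (𝕜 L) in
/-- The domain `{y ∈ H¹(0, L) | y(L) = 0}`. -/
def generatorDomain : Submodule 𝕜 (L2 𝕜 L) where
  carrier := {y | (∃ g, HasWeakDeriv y g) ∧ HasTrace y L 0}
  zero_mem' := ⟨⟨0, HasWeakDeriv.zero⟩, HasTrace.zero L⟩
  add_mem' := by
    rintro y z ⟨⟨g, hg⟩, hy⟩ ⟨⟨h, hh⟩, hz⟩
    exact ⟨⟨g + h, hg.add hh⟩, by simpa using hy.add hz⟩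
  smul_mem' := by
    rintro a y ⟨⟨g, hg⟩, hy⟩
    exact ⟨⟨a • g, hg.smul a⟩, by simpa using hy.smul a⟩

variable (𝕜 L) in
/-- `y ↦ y_x`, with domain `{y ∈ H¹(0, L) | y(L) = 0}`. -/
def weakDeriv : generatorDomain 𝕜 L →ₗ[𝕜] L2 𝕜 L where
  toFun y := y.2.1.choose
  map_add' y z := (y + z).2.1.choose_spec.unique (y.2.1.choose_spec.add z.2.1.choose_spec)
  map_smul' a y := (a • y).2.1.choose_spec.unique (y.2.1.choose_spec.smul a)

theorem weakDeriv_spec (y : generatorDomain 𝕜 L) : HasWeakDeriv (y : L2 𝕜 L) (weakDeriv 𝕜 L y) :=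
  y.2.1.choose_spec

section Kernel

variable {k : ℝ × ℝ → ℝ}

theorem kernel_section_memLp (hk : MemLp k 2 ((μI L).prod (μI L))) :
    ∀ᵐ x ∂μI L, MemLp (fun ξ => k (x, ξ)) 2 (μI L) := by
  have h2 := hk.integrable_sq
  filter_upwards [h2.prod_right_ae, hk.aestronglyMeasurable.prodMk_left] with x hx hm
  exact (memLp_two_iff_integrable_sq hm).2 hx

theorem kernel_integrable (hk : MemLp k 2 ((μI L).prod (μI L))) (y : L2 𝕜 L) :
    ∀ᵐ x ∂μI L, Integrable (fun ξ => k (x, ξ) • y ξ) (μI L) := by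
  filter_upwards [kernel_section_memLp hk] with x hx
  exact memLp_one_iff_integrable.1 ((Lp.memLp y).smul (p := 2) (q := 2) (r := 1) hx)

theorem kernel_aestronglyMeasurable (hk : MemLp k 2 ((μI L).prod (μI L))) (y : L2 𝕜 L) :
    AEStronglyMeasurable (fun x => ∫ ξ in Ioo 0 L, k (x, ξ) • y ξ) (μI L) :=
  (hk.aestronglyMeasurable.smul (Lp.aestronglyMeasurable y).comp_snd).integral_prod_right'

theorem eLpNorm_two_sq {α E : Type*} [MeasurableSpace α] [NormedAddCommGroup E] (μ : Measure α)
    (f : α → E) : eLpNorm f 2 μ ^ 2 = ∫⁻ x, ‖f x‖ₑ ^ 2 ∂μ := by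
  have := eLpNorm_nnreal_pow_eq_lintegral (f := f) (μ := μ) (p := 2) (by norm_num)
  simpa using this

theorem kernel_eLpNorm_le (hk : MemLp k 2 ((μI L).prod (μI L))) (y : L2 𝕜 L) :
    eLpNorm (fun x => ∫ ξ in Ioo 0 L, k (x, ξ) • y ξ) 2 (μI L)
      ≤ eLpNorm k 2 ((μI L).prod (μI L)) * eLpNorm y 2 (μI L) := by
  have hpow : (eLpNorm (fun x => ∫ ξ in Ioo 0 L, k (x, ξ) • y ξ) 2 (μI L)) ^ 2
      ≤ (eLpNorm k 2 ((μI L).prod (μI L)) * eLpNorm y 2 (μI L)) ^ 2 := by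
    rw [mul_pow, eLpNorm_two_sq, eLpNorm_two_sq ((μI L).prod (μI L)),
      lintegral_prod _ (hk.aestronglyMeasurable.enorm.pow_const 2),
      ← lintegral_mul_const' _ _ (ENNReal.pow_ne_top (Lp.memLp y).eLpNorm_ne_top)]
    refine lintegral_mono_ae ?_
    filter_upwards [kernel_section_memLp hk] with x hx
    rw [← eLpNorm_two_sq (μI L) (fun ξ => k (x, ξ)), ← mul_pow]
    refine pow_le_pow_left' ?_ 2
    refine (enorm_integral_le_lintegral_enorm _).trans ?_
    rw [← eLpNorm_one_eq_lintegral_enorm]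
    have h := eLpNorm_smul_le_mul_eLpNorm (p := 2) (q := 2) (r := 1) (μ := μI L)
      (Lp.aestronglyMeasurable y) hx.aestronglyMeasurable
    exact h
  exact (ENNReal.pow_le_pow_left_iff (by norm_num)).1 hpow

theorem kernel_memLp (hk : MemLp k 2 ((μI L).prod (μI L))) (y : L2 𝕜 L) :
    MemLp (fun x => ∫ ξ in Ioo 0 L, k (x, ξ) • y ξ) 2 (μI L) :=
  ⟨kernel_aestronglyMeasurable hk y, (kernel_eLpNorm_le hk y).trans_lt
    (ENNReal.mul_lt_top hk.eLpNorm_lt_top (Lp.memLp y).eLpNorm_lt_top)⟩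

variable (𝕜) in
/-- The integral operator `(K y)(x) = ∫₀^L k(x, ξ) y(ξ) dξ` on `L²(0, L; 𝕜)`, for a real kernel `k`
(over `𝕜 = ℂ`, it is the complexification of the operator over `ℝ`). -/
def integralOperator (k : ℝ × ℝ → ℝ) (hk : MemLp k 2 ((μI L).prod (μI L))) :
    L2 𝕜 L →L[𝕜] L2 𝕜 L :=
  LinearMap.mkContinuous
    { toFun := fun y => (kernel_memLp hk y).toLp _
      map_add' := fun y z => by
        rw [← MemLp.toLp_add, MemLp.toLp_eq_toLp_iff]
        filter_upwards [kernel_integrable hk y, kernel_integrable hk z] with x hy hz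
        rw [Pi.add_apply, ← integral_add hy hz]
        refine integral_congr_ae ?_
        filter_upwards [Lp.coeFn_add y z] with ξ h
        rw [h, Pi.add_apply, smul_add]
      map_smul' := fun a y => by
        rw [RingHom.id_apply, ← MemLp.toLp_const_smul, MemLp.toLp_eq_toLp_iff]
        refine .of_forall fun x => ?_
        rw [Pi.smul_apply, ← integral_smul]
        refine integral_congr_ae ?_
        filter_upwards [Lp.coeFn_smul a y] with ξ h
        rw [h, Pi.smul_apply, smul_comm] }
    (eLpNorm k 2 ((μI L).prod (μI L))).toReal (fun y => by
      change ‖(kernel_memLp hk y).toLp _‖ ≤ _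
      rw [Lp.norm_toLp, Lp.norm_def, ← ENNReal.toReal_mul]
      exact ENNReal.toReal_mono
        (ENNReal.mul_ne_top hk.eLpNorm_ne_top (Lp.memLp y).eLpNorm_ne_top)
        (kernel_eLpNorm_le hk y))

variable (𝕜) in
/-- The operator `A_K y = y_x + ∫₀^L k(·, ξ) y(ξ) dξ` on `L²(0, L; 𝕜)`, with domain
`{y ∈ H¹(0, L) | y(L) = 0}`. -/
def generator (k : ℝ × ℝ → ℝ) (hk : MemLp k 2 ((μI L).prod (μI L))) :
    L2 𝕜 L →ₗ.[𝕜] L2 𝕜 L where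
  domain := generatorDomain 𝕜 L
  toFun := weakDeriv 𝕜 L + (integralOperator 𝕜 k hk).toLinearMap ∘ₗ (generatorDomain 𝕜 L).subtype

variable (𝕜) in
/-- The adjoint `B* z = z(L)`, `z ∈ D(A_K*) ⊆ H¹(0, L)`, of the control operator
`⟨B u, z⟩ = u z(L)`. -/
def controlAdjoint (k : ℝ × ℝ → ℝ) (hk : MemLp k 2 ((μI L).prod (μI L)))
    (z : (generator 𝕜 k hk)†.domain) : 𝕜 :=
  trace (z : L2 𝕜 L) L

end Kernel

end

end IntegralTransport

/-! The equation is treated as a compact perturbation of pure transport. A signal `w` on the line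
carries all data: its values on `(0, L)` are the initial state and `w (L + t)` is the control at
time `t`. Without the integral term the state at time `t` is `restr L (shift t w)`; with it, the
state `mild K t w` solves a Duhamel equation. Mild solutions are solutions by transposition
(`isTranspositionSolution_mild`), and every solution by transposition ends in a mild state
(`IsTranspositionSolution.exists_eq_mild`). Controllability in time `T` thus concerns only the
subspace `reach K T` of states reachable from `0`.

For `T ≥ L` pure transport reaches any `x`: feed `x` in during the last `L` units of time. The same
control in the perturbed equation reaches `x + C x`, where `C` is the Duhamel term. The kernel is
square integrable, so `K` is compact and `C` is of finite rank up to a small error. Hence `reach K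
T` is closed with finite-dimensional orthogonal complement (`reach_isClosed_and_finiteDimensional`).
Part (i) follows, since a closed dense subspace is everything.

For (ii), an eigenvector `z` of the complex adjoint gives an exponential adjoint solution. If its
trace at `L` vanishes, the duality identity makes its real and imaginary parts orthogonal to all
reachable states; so exact controllability forces the Fattorini criterion. Conversely, reachable
spaces grow with time, and on `[L, T)` the dimension of their complements attains a minimum at some
`t`. From `t` until `T` the complement `N` is constant. It is therefore stable under the adjoint
semigroup for short times and, being finite-dimensional, is contained in the domain of the adjoint
and invariant under it (`orthogonal_reach_le_map`). If `N` were nonzero, its complexification would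
contain an eigenvector; orthogonality to the reachable states makes the trace of this eigenvector
vanish, against the criterion. So `reach K t` is the whole space, and so is `reach K T`. -/

open Filter Topology
open scoped ENNReal InnerProductSpace

/-! ### Ranges of finite rank and compact perturbations in a Hilbert space. -/

section HilbertPerturbation

variable {H : Type*} [NormedAddCommGroup H] [InnerProductSpace ℝ H]

/-- A totally bounded set lies within `δ` of a finite-dimensional subspace. -/
theorem TotallyBounded.exists_finiteDimensional_norm_sub_starProjection_le {Ω : Set H}
    (hΩ : TotallyBounded Ω) {δ : ℝ} (hδ : 0 < δ) :
    ∃ V : Submodule ℝ H, ∃ _ : FiniteDimensional ℝ V,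
      ∀ v ∈ Ω, ‖v - V.starProjection v‖ ≤ δ := by
  obtain ⟨t, ht, hcov⟩ := Metric.totallyBounded_iff.1 hΩ δ hδ
  refine ⟨Submodule.span ℝ t, FiniteDimensional.span_of_finite ℝ ht, fun v hv => ?_⟩
  have := FiniteDimensional.span_of_finite ℝ ht
  obtain ⟨c, hc, hcv⟩ := mem_iUnion₂.1 (hcov hv)
  rw [Submodule.starProjection_minimal]
  refine (ciInf_le ⟨0, by rintro _ ⟨y, rfl⟩; positivity⟩
    (⟨c, Submodule.subset_span hc⟩ : Submodule.span ℝ t)).trans ?_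
  rw [← dist_eq_norm]
  exact (Metric.mem_ball.1 hcv).le



/-- If `E` contains the range of a finite rank perturbation of an invertible operator, then `E` is
closed with finite-dimensional orthogonal complement. -/
theorem Submodule.isClosed_and_finiteDimensional_orthogonal_of_range_le {E : Submodule ℝ H}
    (X : H ≃L[ℝ] H) (D : H →L[ℝ] H) [FiniteDimensional ℝ (LinearMap.range (D : H →ₗ[ℝ] H))]
    (h : ∀ x, X x + D x ∈ E) :
    IsClosed (E : Set H) ∧ FiniteDimensional ℝ Eᗮ := by
  -- On the kernel of `D` the perturbed map is `X`, so `E` contains the image of this kernel under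
  -- `X`. The image is closed of finite codimension, and any larger subspace is closed too, with a
  -- smaller orthogonal complement.
  set W : Submodule ℝ H := LinearMap.ker (D : H →ₗ[ℝ] H) with hW
  have hWc : IsClosed (W : Set H) := D.isClosed_ker
  set R : Submodule ℝ H := W.map (X : H →ₗ[ℝ] H) with hR
  have hRc : IsClosed (R : Set H) := by
    rw [hR, Submodule.map_coe]
    exact X.toHomeomorph.isClosedMap _ hWc
  have hRE : R ≤ E := by
    rintro _ ⟨x, hx, rfl⟩
    have := h x
    have hx' : D x = 0 := hx
    rwa [hx', add_zero] at this
  have f1 : FiniteDimensional ℝ (H ⧸ W) :=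
    (D : H →ₗ[ℝ] H).quotKerEquivRange.symm.finiteDimensional
  have f2 : FiniteDimensional ℝ (H ⧸ R) :=
    (Submodule.Quotient.equiv W R X.toLinearEquiv rfl).finiteDimensional
  refine ⟨Submodule.isClosed_mono_of_finiteDimensional_quotient hRc hRE, ?_⟩
  have hle : Eᗮ ≤ Rᗮ := Submodule.orthogonal_le hRE
  have : FiniteDimensional ℝ Rᗮ := by
    refine FiniteDimensional.of_injective (R.mkQ ∘ₗ Rᗮ.subtype) ?_
    rw [injective_iff_map_eq_zero]
    rintro ⟨x, hx⟩ h0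
    have hxR : x ∈ R := by simpa using h0
    have : x ∈ R ⊓ Rᗮ := ⟨hxR, hx⟩
    rw [Submodule.inf_orthogonal_eq_bot] at this
    simpa using this
  exact Submodule.finiteDimensional_of_le hle

/-- If `E` contains the range of `1 + C` and `C` is, up to an error of norm at most `1 / 2`, of
finite rank, then `E` is closed with finite-dimensional orthogonal complement. -/
theorem Submodule.isClosed_and_finiteDimensional_orthogonal_of_id_add [CompleteSpace H] {E : Submodule ℝ H}
    (C : H →L[ℝ] H) (V : Submodule ℝ H) [FiniteDimensional ℝ V]
    (hC : ∀ x, ‖C x - V.starProjection (C x)‖ ≤ 1 / 2 * ‖x‖) (h : ∀ x, x + C x ∈ E) :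
    IsClosed (E : Set H) ∧ FiniteDimensional ℝ Eᗮ := by
  set P : H →L[ℝ] H := V.starProjection
  have hn : ‖-(C - P ∘L C)‖ < 1 := by
    rw [norm_neg]
    refine (ContinuousLinearMap.opNorm_le_bound _ (by norm_num) hC).trans_lt (by norm_num)
  -- Split `1 + C` as `X + P C`: the remainder `C - P C` has norm below `1`, so `X` is invertible by
  -- a Neumann series, and `P C` has range in `V`.
  let X : H ≃L[ℝ] H := ContinuousLinearEquiv.unitsEquiv ℝ H (Units.oneSub _ hn)
  have hX : ∀ x, X x = x + (C x - P (C x)) := fun x => by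
    change ((1 : H →L[ℝ] H) - -(C - P ∘L C)) x = _
    simp; abel
  have : FiniteDimensional ℝ (LinearMap.range ((P ∘L C : H →L[ℝ] H) : H →ₗ[ℝ] H)) := by
    refine Submodule.finiteDimensional_of_le (S₂ := V) ?_
    rintro _ ⟨x, rfl⟩
    exact Submodule.starProjection_apply_mem V (C x)
  refine Submodule.isClosed_and_finiteDimensional_orthogonal_of_range_le X (P ∘L C) fun x => ?_
  convert h x using 1
  rw [hX]
  simp only [ContinuousLinearMap.comp_apply]
  abel

end HilbertPerturbation

/-! ### Signals on the real line and the free transport semigroup. -/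

namespace IntegralTransport

/-- The space `L²(ℝ)`. -/
abbrev L2R : Type := Lp ℝ 2 (volume : Measure ℝ)

noncomputable section

/-- Left translation by `t` on `L²(ℝ)`, `(shift t w)(x) = w(t + x)`. -/
def shift (t : ℝ) : L2R →L[ℝ] L2R :=
  LinearMap.mkContinuous
    { toFun := fun w => DomAddAct.mk t +ᵥ w
      map_add' := fun v w => DomAddAct.vadd_Lp_add _ v w
      map_smul' := fun a w => by
        rcases w with ⟨⟨_⟩, _⟩; rfl } 1 (fun w => by simp)

theorem shift_apply (t : ℝ) (w : L2R) : shift t w = DomAddAct.mk t +ᵥ w := rfl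

theorem coeFn_shift (t : ℝ) (w : L2R) : shift t w =ᵐ[volume] fun x => w (t + x) :=
  DomAddAct.vadd_Lp_ae_eq (DomAddAct.mk t) w

theorem norm_shift_apply (t : ℝ) (w : L2R) : ‖shift t w‖ = ‖w‖ :=
  DomAddAct.norm_vadd_Lp _ w

theorem shift_zero (w : L2R) : shift 0 w = w := by
  rw [shift_apply]; exact zero_vadd _ w

theorem shift_shift (s t : ℝ) (w : L2R) : shift s (shift t w) = shift (s + t) w := by
  simp only [shift_apply, vadd_vadd, ← DomAddAct.mk_add, add_comm]

theorem continuous_shift : Continuous fun p : ℝ × L2R => shift p.1 p.2 := by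
  have : Fact ((2 : ℝ≥0∞) ≠ ⊤) := ⟨ENNReal.ofNat_ne_top⟩
  have : Continuous fun p : ℝ × L2R => DomAddAct.mk p.1 +ᵥ p.2 :=
    (DomAddAct.continuous_mk.comp continuous_fst).vadd continuous_snd
  exact this

theorem inner_shift_shift (t : ℝ) (v w : L2R) : ⟪shift t v, shift t w⟫_ℝ = ⟪v, w⟫_ℝ := by
  have h (x y : L2R) : ⟪x, y⟫_ℝ = (‖x + y‖ * ‖x + y‖ - ‖x‖ * ‖x‖ - ‖y‖ * ‖y‖) / 2 :=
    real_inner_eq_norm_add_mul_self_sub_norm_mul_self_sub_norm_mul_self_div_two x y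
  rw [h, h, ← map_add, norm_shift_apply, norm_shift_apply, norm_shift_apply]

theorem inner_shift_left (t : ℝ) (v w : L2R) : ⟪shift t v, w⟫_ℝ = ⟪v, shift (-t) w⟫_ℝ := by
  rw [← inner_shift_shift t v, shift_shift, add_neg_cancel, shift_zero]

/-- Multiplication by the indicator function of `s`. -/
def cut (s : Set ℝ) (hs : MeasurableSet s) : L2R →L[ℝ] L2R :=
  LinearMap.mkContinuous
    { toFun := fun w => ((Lp.memLp w).indicator hs).toLp _
      map_add' := fun v w => by
        rw [← MemLp.toLp_add, MemLp.toLp_eq_toLp_iff]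
        filter_upwards [Lp.coeFn_add v w] with x hx
        by_cases h : x ∈ s
        · simpa [h] using hx
        · simp [h]
      map_smul' := fun a w => by
        rw [RingHom.id_apply, ← MemLp.toLp_const_smul, MemLp.toLp_eq_toLp_iff]
        filter_upwards [Lp.coeFn_smul a w] with x hx
        by_cases h : x ∈ s
        · simpa [h] using hx
        · simp [h] } 1 (fun w => by
      change ‖((Lp.memLp w).indicator hs).toLp _‖ ≤ _
      rw [one_mul]
      refine (Lp.norm_toLp _ _).trans_le ?_
      rw [Lp.norm_def]
      exact ENNReal.toReal_mono (Lp.memLp w).eLpNorm_ne_top (eLpNorm_indicator_le _))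

theorem coeFn_cut (s : Set ℝ) (hs : MeasurableSet s) (w : L2R) :
    cut s hs w =ᵐ[volume] s.indicator w := by
  have h : cut s hs w = ((Lp.memLp w).indicator hs).toLp (s.indicator w) := rfl
  rw [h]
  exact MemLp.coeFn_toLp _

variable (L : ℝ)

/-- Restriction of functions on `ℝ` to `(0, L)`. -/
def restr : L2R →L[ℝ] L2 ℝ L := LpToLpRestrictCLM ℝ ℝ ℝ volume 2 (Ioo 0 L)

theorem coeFn_restr (w : L2R) : restr L w =ᵐ[μI L] w :=
  LpToLpRestrictCLM_coeFn ℝ (Ioo 0 L) w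

/-- Extension by zero of functions on `(0, L)`. -/
def extZ : L2 ℝ L →L[ℝ] L2R :=
  LinearMap.mkContinuous
    { toFun := fun y => ((memLp_indicator_iff_restrict measurableSet_Ioo).2 (Lp.memLp y)).toLp _
      map_add' := fun v w => by
        rw [← MemLp.toLp_add, MemLp.toLp_eq_toLp_iff]
        filter_upwards [ae_imp_of_ae_restrict (Lp.coeFn_add v w)] with x hx
        by_cases h : x ∈ Ioo 0 L
        · simpa [h] using hx h
        · simp [h]
      map_smul' := fun a w => by
        rw [RingHom.id_apply, ← MemLp.toLp_const_smul, MemLp.toLp_eq_toLp_iff]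
        filter_upwards [ae_imp_of_ae_restrict (Lp.coeFn_smul a w)] with x hx
        by_cases h : x ∈ Ioo 0 L
        · simpa [h] using hx h
        · simp [h] } 1 (fun y => by
      change ‖((memLp_indicator_iff_restrict measurableSet_Ioo).2 (Lp.memLp y)).toLp _‖ ≤ _
      rw [one_mul]
      refine (Lp.norm_toLp _ _).trans_le ?_
      rw [Lp.norm_def, eLpNorm_indicator_eq_eLpNorm_restrict measurableSet_Ioo])

theorem coeFn_ext (y : L2 ℝ L) : extZ L y =ᵐ[volume] (Ioo 0 L).indicator y := by
  have h : extZ L y = ((memLp_indicator_iff_restrict measurableSet_Ioo).2 (Lp.memLp y)).toLp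
    ((Ioo 0 L).indicator y) := rfl
  rw [h]
  exact MemLp.coeFn_toLp _

theorem restr_ext (y : L2 ℝ L) : restr L (extZ L y) = y := by
  refine Lp.ext ?_
  filter_upwards [coeFn_restr L (extZ L y), ae_restrict_of_ae (coeFn_ext L y),
    ae_restrict_mem measurableSet_Ioo] with x h1 h2 h3
  rw [h1, h2, indicator_of_mem h3]

theorem ext_restr (w : L2R) : extZ L (restr L w) = cut (Ioo 0 L) measurableSet_Ioo w := by
  refine Lp.ext ?_
  filter_upwards [coeFn_ext L (restr L w), coeFn_cut _ measurableSet_Ioo w,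
    ae_imp_of_ae_restrict (coeFn_restr L w)] with x h1 h2 h3
  rw [h1, h2]
  by_cases h : x ∈ Ioo 0 L
  · simp [h, h3 h]
  · simp [h]

theorem norm_ext_le (y : L2 ℝ L) : ‖extZ L y‖ ≤ ‖y‖ := by
  have := (extZ L).le_of_opNorm_le (LinearMap.mkContinuous_norm_le _ zero_le_one _) y
  rwa [one_mul] at this

theorem inner_restr (y : L2 ℝ L) (w : L2R) : ⟪y, restr L w⟫_ℝ = ⟪extZ L y, w⟫_ℝ := by
  rw [L2.inner_def, L2.inner_def, ← integral_indicator measurableSet_Ioo]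
  refine integral_congr_ae ?_
  filter_upwards [coeFn_ext L y, ae_imp_of_ae_restrict (coeFn_restr L w)] with x h1 h2
  rw [h1]
  by_cases h : x ∈ Ioo 0 L
  · simp [h, h2 h]
  · simp [h]

theorem norm_restr_le (w : L2R) : ‖restr L w‖ ≤ ‖w‖ := by
  rw [Lp.norm_def, Lp.norm_def, eLpNorm_congr_ae (coeFn_restr L w)]
  exact ENNReal.toReal_mono (Lp.memLp w).eLpNorm_ne_top (eLpNorm_restrict_le _ _ _ _)

/-- `w` vanishes almost everywhere on `s`. -/
def VanishesOn (w : L2R) (s : Set ℝ) : Prop := ∀ᵐ x, x ∈ s → w x = 0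

variable {L}

theorem VanishesOn.mono {w : L2R} {s s' : Set ℝ} (h : VanishesOn w s) (hs : s' ⊆ s) :
    VanishesOn w s' := by
  filter_upwards [h] with x hx h' using hx (hs h')

theorem VanishesOn.shift {w : L2R} {s : Set ℝ} (h : VanishesOn w s) (t : ℝ) :
    VanishesOn (shift t w) {x | t + x ∈ s} := by
  filter_upwards [coeFn_shift t w,
    (measurePreserving_add_left volume t).quasiMeasurePreserving.ae h] with x h1 h2 h3
  rw [h1, h2 h3]

theorem VanishesOn.restr_eq_zero {w : L2R} {s : Set ℝ} (h : VanishesOn w s)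
    (hs : Ioo 0 L ⊆ s) : restr L w = 0 := by
  rw [Lp.eq_zero_iff_ae_eq_zero]
  filter_upwards [coeFn_restr L w, ae_restrict_of_ae h, ae_restrict_mem measurableSet_Ioo]
    with x h1 h2 h3
  rw [h1, h2 (hs h3), Pi.zero_apply]

/-- If `w` vanishes on `(t, t + L)`, then `restr (shift t w) = 0`. -/
theorem VanishesOn.restr_shift_eq_zero {w : L2R} {s : Set ℝ} (h : VanishesOn w s) {t : ℝ}
    (hs : Ioo t (t + L) ⊆ s) : restr L (IntegralTransport.shift t w) = 0 :=
  (h.shift t).restr_eq_zero fun x hx => hs ⟨by linarith [hx.1], by linarith [hx.2]⟩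

theorem vanishesOn_cut {s : Set ℝ} (hs : MeasurableSet s) (w : L2R) :
    VanishesOn (cut s hs w) sᶜ := by
  filter_upwards [coeFn_cut s hs w] with x h1 h2
  rw [h1, indicator_of_notMem h2]

theorem VanishesOn.cut {w : L2R} {s' : Set ℝ} (h : VanishesOn w s') {s : Set ℝ}
    (hs : MeasurableSet s) : VanishesOn (cut s hs w) s' := by
  filter_upwards [coeFn_cut s hs w, h] with x h1 h2 h3
  rw [h1]
  by_cases h : x ∈ s <;> simp [h, h2 h3]

theorem vanishesOn_sub_cut {s : Set ℝ} (hs : MeasurableSet s) (w : L2R) :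
    VanishesOn (w - IntegralTransport.cut s hs w) s := by
  filter_upwards [coeFn_cut s hs w, Lp.coeFn_sub w (IntegralTransport.cut s hs w)] with x h1 h2 h3
  rw [h2, Pi.sub_apply, h1, indicator_of_mem h3, sub_self]

theorem vanishesOn_ext (y : L2 ℝ L) : VanishesOn (extZ L y) (Ioo 0 L)ᶜ := by
  filter_upwards [coeFn_ext L y] with x h1 h2
  rw [h1, indicator_of_notMem h2]

theorem VanishesOn.add {v w : L2R} {s : Set ℝ} (hv : VanishesOn v s) (hw : VanishesOn w s) :
    VanishesOn (v + w) s := by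
  filter_upwards [hv, hw, Lp.coeFn_add v w] with x h1 h2 h3 h4
  rw [h3, Pi.add_apply, h1 h4, h2 h4, add_zero]

theorem VanishesOn.smul {w : L2R} {s : Set ℝ} (hw : VanishesOn w s) (a : ℝ) :
    VanishesOn (a • w) s := by
  filter_upwards [hw, Lp.coeFn_smul a w] with x h1 h3 h4
  rw [h3, Pi.smul_apply, h1 h4, smul_zero]

theorem vanishesOn_zero (s : Set ℝ) : VanishesOn 0 s := by
  filter_upwards [Lp.coeFn_zero ℝ 2 (volume : Measure ℝ)] with x h1 _ using h1

variable (L) in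
/-- The part of `w` that lives outside `(0, L)`. -/
def outer : L2R →L[ℝ] L2R := ContinuousLinearMap.id ℝ L2R - extZ L ∘L restr L

theorem outer_apply (w : L2R) : outer L w = w - extZ L (restr L w) := rfl

theorem restr_outer (w : L2R) : restr L (outer L w) = 0 := by
  rw [outer_apply, map_sub, restr_ext, sub_self]

theorem VanishesOn.outer {w : L2R} {s : Set ℝ} (h : VanishesOn w s) :
    VanishesOn (outer L w) (s ∪ Ioo 0 L) := by
  have h0 : VanishesOn (IntegralTransport.outer L w) (Ioo 0 L) := by
    rw [outer_apply, ext_restr]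
    exact vanishesOn_sub_cut _ w
  have h1 := h.cut (measurableSet_Ioo (a := 0) (b := L))
  rw [← ext_restr] at h1
  filter_upwards [h0, h1, h, Lp.coeFn_sub w (extZ L (restr L w))] with x h2 h3 h4 h5 h6
  rcases h6 with h6 | h6
  · rw [outer_apply, h5, Pi.sub_apply, h3 h6, h4 h6, sub_self]
  · exact h2 h6

theorem outer_eq_self {w : L2R} (h : restr L w = 0) : outer L w = w := by
  rw [outer_apply, h, map_zero, sub_zero]

/-- A signal supported to the left of `L` never enters `(0, L)` again once it has left it. -/
theorem VanishesOn.restr_shift_outer_eq_zero {w : L2R} (h : VanishesOn w (Ici L)) {t : ℝ}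
    (ht : 0 ≤ t) : restr L (IntegralTransport.shift t (IntegralTransport.outer L w)) = 0 :=
  h.outer.restr_shift_eq_zero fun x hx => by
    rcases le_or_gt L x with h | h
    · exact Or.inl h
    · exact Or.inr ⟨ht.trans_lt hx.1, h⟩

variable (L)

/-- The nilpotent left translation semigroup on `L²(0, L)`. -/
def freeSg (t : ℝ) : L2 ℝ L →L[ℝ] L2 ℝ L := restr L ∘L shift t ∘L extZ L

theorem freeSg_apply (t : ℝ) (y : L2 ℝ L) : freeSg L t y = restr L (shift t (extZ L y)) := rfl

theorem norm_freeSg_apply_le (t : ℝ) (y : L2 ℝ L) : ‖freeSg L t y‖ ≤ ‖y‖ :=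
  (norm_restr_le L _).trans ((norm_shift_apply t _).le.trans (norm_ext_le L y))

theorem continuous_freeSg : Continuous fun p : ℝ × L2 ℝ L => freeSg L p.1 p.2 :=
  (restr L).continuous.comp (continuous_shift.comp
    (continuous_fst.prodMk ((extZ L).continuous.comp continuous_snd)))

theorem freeSg_zero (y : L2 ℝ L) : freeSg L 0 y = y := by
  rw [freeSg_apply, shift_zero, restr_ext]

/-- At negative times `freeSg` is right translation with zero inflow, which is the adjoint of the
left translation semigroup. -/
theorem inner_freeSg (t : ℝ) (y z : L2 ℝ L) :
    ⟪freeSg L t y, z⟫_ℝ = ⟪y, freeSg L (-t) z⟫_ℝ := by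
  rw [real_inner_comm, freeSg_apply, inner_restr, freeSg_apply, inner_restr, real_inner_comm,
    inner_shift_left]

/-- Translating a whole signal differs from translating its restriction by whatever enters `(0, L)`
from outside; this correction carries the control. -/
theorem freeSg_restr (t : ℝ) (w : L2R) :
    freeSg L t (restr L w) = restr L (shift t w) - restr L (shift t (outer L w)) := by
  rw [freeSg_apply, ← map_sub, ← map_sub, outer_apply, sub_sub_cancel]

/-- Both signs matter: mass that leaves through `0` is lost and does not return under further left
translation, whereas a right translation would have to bring it back. -/
theorem freeSg_freeSg {s t : ℝ} (hs : 0 ≤ s) (ht : 0 ≤ t) (y : L2 ℝ L) :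
    freeSg L t (freeSg L s y) = freeSg L (t + s) y := by
  have h : VanishesOn (shift s (extZ L y)) (Ici L) :=
    ((vanishesOn_ext y).shift s).mono fun x hx h => absurd h.2 (by
      have := mem_Ici.1 hx; simp only [not_lt]; linarith)
  rw [freeSg_apply L s, freeSg_restr, h.restr_shift_outer_eq_zero ht, sub_zero, shift_shift,
    freeSg_apply]

end

noncomputable section

open scoped BoundedContinuousFunction

/-! ### The Duhamel equation for a bounded perturbation of a family of contractions. -/

section Duhamel

/-- A strongly continuous family of contractions indexed by `ℝ`. -/
structure ContractionFamily (G H : Type*) [NormedAddCommGroup G] [NormedSpace ℝ G]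
    [NormedAddCommGroup H] [NormedSpace ℝ H] where
  /-- The contractions. -/
  toFun : ℝ → G →L[ℝ] H
  cont : Continuous fun p : ℝ × G => toFun p.1 p.2
  norm_le : ∀ t w, ‖toFun t w‖ ≤ ‖w‖

instance {G H : Type*} [NormedAddCommGroup G] [NormedSpace ℝ G] [NormedAddCommGroup H]
    [NormedSpace ℝ H] : CoeFun (ContractionFamily G H) fun _ => ℝ → G →L[ℝ] H :=
  ⟨ContractionFamily.toFun⟩

variable {G H : Type*} [NormedAddCommGroup G] [NormedSpace ℝ G] [NormedAddCommGroup H]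
  [NormedSpace ℝ H] (S₀ : ContractionFamily H H) (Φ : ContractionFamily G H)
  (K : H →L[ℝ] H)

/-- The rate of an exponential weight for which the Volterra operator is a contraction. -/
def rate : ℝ := 2 * ‖K‖ + 1

theorem rate_pos : 0 < rate K := by unfold rate; positivity

theorem integral_exp_rate_le {r : ℝ} (hr : 0 < r) (t : ℝ) :
    ∫ s in (0 : ℝ)..t, Real.exp (-(r * (t - s))) ≤ 1 / r := by
  have h : ∀ s ∈ uIcc 0 t, HasDerivAt (fun s => Real.exp (-(r * (t - s))) / r)
      (Real.exp (-(r * (t - s)))) s := fun s _ => by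
    have h1 : HasDerivAt (fun s => -(r * (t - s))) r s := by
      convert! (((hasDerivAt_id s).const_sub t).const_mul r).neg using 1; simp
    have h2 := h1.exp.div_const r
    rwa [mul_div_assoc, div_self hr.ne', mul_one] at h2
  rw [intervalIntegral.integral_eq_sub_of_hasDerivAt h
    (Continuous.intervalIntegrable (by fun_prop) _ _)]
  have : 0 < Real.exp (-(r * (t - 0))) / r := by positivity
  simp only [sub_self, mul_zero, neg_zero, Real.exp_zero]
  linarith

theorem continuous_duhamel_integrand {x : ℝ → H} (hx : Continuous x) :
    Continuous fun p : ℝ × ℝ => S₀ (p.1 - p.2) (K (x p.2)) :=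
  S₀.cont.comp ((continuous_fst.sub continuous_snd).prodMk
    (K.continuous.comp (hx.comp continuous_snd)))

theorem continuous_duhamel_integrand_left {x : ℝ → H} (hx : Continuous x) (t : ℝ) :
    Continuous fun s => S₀ (t - s) (K (x s)) :=
  (continuous_duhamel_integrand S₀ K hx).comp (Continuous.prodMk_right t)

/-- Grönwall's lemma in integral form, obtained from the differential form applied to the primitive
of `f`. -/
theorem eq_zero_of_le_mul_integral {f : ℝ → ℝ} {T C : ℝ} (hf : ContinuousOn f (Icc 0 T))
    (h0 : ∀ t ∈ Icc 0 T, 0 ≤ f t)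
    (h : ∀ t ∈ Icc 0 T, f t ≤ C * ∫ s in (0 : ℝ)..t, f s) :
    ∀ t ∈ Icc 0 T, f t = 0 := by
  intro t ht
  have hT : 0 ≤ T := ht.1.trans ht.2
  -- Extending `f` by its end values makes it continuous on the line, so that its primitive is
  -- differentiable everywhere.
  set g : ℝ → ℝ := IccExtend hT (domRestrict (Icc 0 T) f)
  have hg : Continuous g := hf.domRestrict.Icc_extend'
  have hgf : ∀ s ∈ Icc 0 T, g s = f s := fun s hs => IccExtend_of_mem hT _ hs
  have hint : ∀ s ∈ Icc 0 T, ∫ r in (0 : ℝ)..s, f r = ∫ r in (0 : ℝ)..s, g r := fun s hs => by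
    refine intervalIntegral.integral_congr fun r hr => (hgf r ?_).symm
    rw [uIcc_of_le hs.1] at hr
    exact ⟨hr.1, hr.2.trans hs.2⟩
  have hd : ∀ s, HasDerivAt (fun s => ∫ r in (0 : ℝ)..s, g r) (g s) s := fun s =>
    intervalIntegral.integral_hasDerivAt_right (hg.intervalIntegrable _ _)
      (hg.stronglyMeasurableAtFilter _ _) hg.continuousAt
  have hnn : ∀ s ∈ Icc 0 T, 0 ≤ ∫ r in (0 : ℝ)..s, g r := fun s hs =>
    intervalIntegral.integral_nonneg hs.1 fun r hr => by
      rw [hgf r ⟨hr.1, hr.2.trans hs.2⟩]; exact h0 r ⟨hr.1, hr.2.trans hs.2⟩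
  have key := norm_le_gronwallBound_of_norm_deriv_right_le (δ := 0) (K := C) (ε := 0)
    (f := fun s => ∫ r in (0 : ℝ)..s, g r) (f' := g) (a := 0) (b := T)
    (fun s _ => (hd s).continuousAt.continuousWithinAt)
    (fun s _ => (hd s).hasDerivWithinAt) (by simp) (fun s hs => by
      have hs' : s ∈ Icc 0 T := ⟨hs.1, hs.2.le⟩
      rw [hgf s hs', Real.norm_of_nonneg (h0 s hs'), Real.norm_of_nonneg (hnn s hs'), add_zero,
        ← hint s hs']
      exact h s hs') t ht
  rw [gronwallBound_ε0_δ0] at key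
  have h1 : ∫ r in (0 : ℝ)..t, g r = 0 := norm_le_zero_iff.1 key
  have h2 := h t ht
  rw [hint t ht, h1, mul_zero] at h2
  exact le_antisymm h2 (h0 t ht)

theorem duhamel_unique {T : ℝ} {y : ℝ → H} (hy : Continuous y)
    (h : ∀ t ∈ Icc 0 T, y t = ∫ s in (0 : ℝ)..t, S₀ (t - s) (K (y s))) :
    ∀ t ∈ Icc 0 T, y t = 0 := by
  intro t ht
  refine norm_eq_zero.1 (eq_zero_of_le_mul_integral (f := fun t => ‖y t‖) (C := ‖K‖)
    hy.norm.continuousOn (fun _ _ => norm_nonneg _) (fun s hs => ?_) t ht)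
  rw [← intervalIntegral.integral_const_mul]
  conv_lhs => rw [h s hs]
  exact intervalIntegral.norm_integral_le_of_norm_le hs.1
    (.of_forall fun r _ => (S₀.norm_le _ _).trans (K.le_opNorm _))
    (Continuous.intervalIntegrable (by fun_prop) _ _)

theorem continuous_weighted_integrand {x : ℝ → H} (hx : Continuous x) (r : ℝ) :
    Continuous (Function.uncurry fun t s : ℝ =>
      Real.exp (-(r * (max t 0 - s))) • S₀ (max t 0 - s) (K (x s))) := by
  refine Continuous.smul (by fun_prop) ?_
  exact (continuous_duhamel_integrand S₀ K hx).comp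
    (((continuous_fst.max continuous_const)).prodMk continuous_snd)

/-- The weight has mass at most `1 / rate K`, and `rate K = 2 * ‖K‖ + 1` makes this times `‖K‖` at
most `1 / 2`. Replacing `t` by `max t 0` freezes everything before time `0`, so one Banach space of
bounded functions on the line serves all time horizons. -/
theorem norm_weighted_integral_le (x : ℝ →ᵇ H) (t : ℝ) :
    ‖∫ s in (0 : ℝ)..max t 0, Real.exp (-(rate K * (max t 0 - s))) •
      S₀ (max t 0 - s) (K (x s))‖ ≤ 1 / 2 * ‖x‖ := by
  have hb : ∀ s, ‖Real.exp (-(rate K * (max t 0 - s))) • S₀ (max t 0 - s) (K (x s))‖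
      ≤ Real.exp (-(rate K * (max t 0 - s))) * (‖K‖ * ‖x‖) := fun s => by
    rw [norm_smul, Real.norm_of_nonneg (Real.exp_pos _).le]
    gcongr
    exact (S₀.norm_le _ _).trans ((K.le_opNorm _).trans (by
      gcongr; exact x.norm_coe_le_norm s))
  refine (intervalIntegral.norm_integral_le_of_norm_le (le_max_right _ _)
    (.of_forall fun s _ => hb s) (Continuous.intervalIntegrable (by fun_prop) _ _)).trans ?_
  rw [intervalIntegral.integral_mul_const]
  have h1 := integral_exp_rate_le (rate_pos K) (max t 0)
  have h2 : 1 / rate K * ‖K‖ ≤ 1 / 2 := by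
    rw [div_mul_eq_mul_div, one_mul, div_le_div_iff₀ (rate_pos K) two_pos, rate]
    linarith
  calc _ ≤ 1 / rate K * (‖K‖ * ‖x‖) := by gcongr
    _ = (1 / rate K * ‖K‖) * ‖x‖ := by ring
    _ ≤ _ := by gcongr

/-- The exponentially weighted Volterra operator of the mild formulation. -/
def volterra : (ℝ →ᵇ H) →L[ℝ] (ℝ →ᵇ H) :=
  LinearMap.mkContinuous
    { toFun := fun x => BoundedContinuousFunction.ofNormedAddCommGroup
        (fun t => ∫ s in (0 : ℝ)..max t 0, Real.exp (-(rate K * (max t 0 - s))) •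
          S₀ (max t 0 - s) (K (x s)))
        (intervalIntegral.continuous_parametric_intervalIntegral_of_continuous
          (continuous_weighted_integrand S₀ K x.continuous _) (continuous_id.max continuous_const))
        _ (norm_weighted_integral_le S₀ K x)
      map_add' := fun x y => by
        ext1 t
        have h (x : ℝ →ᵇ H) := (continuous_weighted_integrand S₀ K x.continuous
          (rate K)).uncurry_left t
        simp only [BoundedContinuousFunction.coe_ofNormedAddCommGroup,
          BoundedContinuousFunction.add_apply, map_add, smul_add]
        exact intervalIntegral.integral_add ((h x).intervalIntegrable _ _)
          ((h y).intervalIntegrable _ _)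
      map_smul' := fun a x => by
        ext1 t
        simp only [BoundedContinuousFunction.coe_ofNormedAddCommGroup,
          BoundedContinuousFunction.smul_apply, map_smul, RingHom.id_apply]
        rw [← intervalIntegral.integral_smul]
        simp only [smul_comm a] } (1 / 2) (fun x =>
      BoundedContinuousFunction.norm_ofNormedAddCommGroup_le _ (by positivity)
        (norm_weighted_integral_le S₀ K x))

theorem volterra_apply (x : ℝ →ᵇ H) (t : ℝ) :
    volterra S₀ K x t = ∫ s in (0 : ℝ)..max t 0, Real.exp (-(rate K * (max t 0 - s))) •
      S₀ (max t 0 - s) (K (x s)) := rfl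

theorem norm_volterra_lt_one : ‖volterra S₀ K‖ < 1 :=
  (LinearMap.mkContinuous_norm_le _ (by norm_num) _).trans_lt (by norm_num)

theorem norm_exp_smul_le (w : G) (t : ℝ) :
    ‖Real.exp (-(rate K * max t 0)) • Φ (max t 0) w‖ ≤ ‖w‖ := by
  rw [norm_smul, Real.norm_of_nonneg (Real.exp_pos _).le]
  have h1 : Real.exp (-(rate K * max t 0)) ≤ 1 := Real.exp_le_one_iff.2 (by
    have := mul_nonneg (rate_pos K).le (le_max_right t 0); linarith)
  exact (mul_le_mul h1 (Φ.norm_le (max t 0) w) (norm_nonneg _) zero_le_one).trans (one_mul _).le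

/-- The exponentially weighted solution of the unperturbed equation. -/
def freeFlow : G →L[ℝ] (ℝ →ᵇ H) :=
  LinearMap.mkContinuous
    { toFun := fun w => BoundedContinuousFunction.ofNormedAddCommGroup
        (fun t => Real.exp (-(rate K * max t 0)) • Φ (max t 0) w)
        (Continuous.smul (by fun_prop) (Φ.cont.comp
          ((continuous_id.max continuous_const).prodMk continuous_const))) ‖w‖
        (norm_exp_smul_le Φ K w)
      map_add' := fun v w => by
        ext1 t
        simp only [BoundedContinuousFunction.coe_ofNormedAddCommGroup,
          BoundedContinuousFunction.add_apply, map_add, smul_add]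
      map_smul' := fun a w => by
        ext1 t
        simp only [BoundedContinuousFunction.coe_ofNormedAddCommGroup,
          BoundedContinuousFunction.smul_apply, map_smul, RingHom.id_apply, smul_comm a] }
    1 (fun w => by
      refine le_of_le_of_eq ?_ (one_mul ‖w‖).symm
      exact BoundedContinuousFunction.norm_ofNormedAddCommGroup_le _ (norm_nonneg _)
        (norm_exp_smul_le Φ K w))

theorem freeFlow_apply (w : G) (t : ℝ) :
    freeFlow Φ K w t = Real.exp (-(rate K * max t 0)) • Φ (max t 0) w := rfl

variable [CompleteSpace H]

/-- The exponentially weighted mild solution. -/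
def weightedFlow : G →L[ℝ] (ℝ →ᵇ H) :=
  ((Units.oneSub (volterra S₀ K) (norm_volterra_lt_one S₀ K))⁻¹ :
    ((ℝ →ᵇ H) →L[ℝ] (ℝ →ᵇ H))ˣ).val ∘L freeFlow Φ K

/-- The Volterra operator has norm below `1`, and `weightedFlow` applies the inverse of `1 -
volterra` to the free flow. -/
theorem weightedFlow_eq (w : G) :
    weightedFlow S₀ Φ K w = freeFlow Φ K w + volterra S₀ K (weightedFlow S₀ Φ K w) := by
  have h := congrArg (fun f : (ℝ →ᵇ H) →L[ℝ] (ℝ →ᵇ H) => f (freeFlow Φ K w))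
    (Units.mul_inv (Units.oneSub (volterra S₀ K) (norm_volterra_lt_one S₀ K)))
  have h' : weightedFlow S₀ Φ K w - volterra S₀ K (weightedFlow S₀ Φ K w) = freeFlow Φ K w := h
  rw [← h', sub_add_cancel]

/-- The duhamel solution: `duhamel S₀ Φ K t w` is the state at time `t` for the data `w`, where `w` restricted
to `(0, L)` is the initial state and `w(L + t)` is the control at time `t`. -/
def duhamel (t : ℝ) : G →L[ℝ] H :=
  Real.exp (rate K * max t 0) • (BoundedContinuousFunction.evalCLM ℝ t ∘L weightedFlow S₀ Φ K)

theorem duhamel_apply (t : ℝ) (w : G) :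
    duhamel S₀ Φ K t w = Real.exp (rate K * max t 0) • weightedFlow S₀ Φ K w t := rfl

theorem continuous_duhamel (w : G) : Continuous fun t => duhamel S₀ Φ K t w :=
  Continuous.smul (by fun_prop) (weightedFlow S₀ Φ K w).continuous

theorem exists_norm_duhamel_le (T : ℝ) : ∃ M : ℝ, 0 < M ∧ ∀ t ≤ T, ∀ w, ‖duhamel S₀ Φ K t w‖ ≤ M * ‖w‖ := by
  refine ⟨Real.exp (rate K * max T 0) * (‖weightedFlow S₀ Φ K‖ + 1), by positivity, fun t ht w => ?_⟩
  rw [duhamel_apply, norm_smul, Real.norm_of_nonneg (Real.exp_pos _).le, mul_assoc]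
  gcongr
  · exact (rate_pos K).le
  · exact ((weightedFlow S₀ Φ K w).norm_coe_le_norm t).trans (((weightedFlow S₀ Φ K).le_opNorm w).trans (by
      gcongr; linarith))

/-- Undoing the weight: the factors `exp (rate K * t)` and `exp (-(rate K * (t - s)))` combine to
`exp (rate K * s)`, which is the factor in the definition of `duhamel` at time `s`. -/
theorem duhamel_eq {t : ℝ} (ht : 0 ≤ t) (w : G) :
    duhamel S₀ Φ K t w = Φ t w
      + ∫ s in (0 : ℝ)..t, S₀ (t - s) (K (duhamel S₀ Φ K s w)) := by
  rw [duhamel_apply, weightedFlow_eq, BoundedContinuousFunction.add_apply, smul_add, freeFlow_apply,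
    volterra_apply, max_eq_left ht, smul_smul, ← Real.exp_add, add_neg_cancel, Real.exp_zero,
    one_smul, ← intervalIntegral.integral_smul]
  congr 1
  refine intervalIntegral.integral_congr fun s hs => ?_
  rw [uIcc_of_le ht] at hs
  simp only [duhamel_apply, map_smul]
  rw [smul_smul, ← Real.exp_add, max_eq_left hs.1]
  congr 2
  ring

/-- Mild solutions are unique. -/
theorem eq_duhamel {T : ℝ} {y : ℝ → H} (hy : Continuous y) {w : G}
    (h : ∀ t ∈ Icc 0 T, y t = Φ t w
      + ∫ s in (0 : ℝ)..t, S₀ (t - s) (K (y s))) :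
    ∀ t ∈ Icc 0 T, y t = duhamel S₀ Φ K t w := by
  intro t ht
  refine sub_eq_zero.1 (duhamel_unique S₀ K (y := fun t => y t - duhamel S₀ Φ K t w)
    (hy.sub (continuous_duhamel S₀ Φ K w)) (fun s hs => ?_) t ht)
  rw [h s hs, duhamel_eq S₀ Φ K hs.1 w, add_sub_add_left_eq_sub, ← intervalIntegral.integral_sub]
  · simp only [map_sub]
  · exact (continuous_duhamel_integrand_left S₀ K hy s).intervalIntegrable _ _
  · exact (continuous_duhamel_integrand_left S₀ K (continuous_duhamel S₀ Φ K w) s).intervalIntegrable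
      _ _

end Duhamel

/-! ### Mild solutions and the perturbed semigroup. -/

variable {L : ℝ} (K : L2 ℝ L →L[ℝ] L2 ℝ L)

variable (L) in
/-- The free semigroup as a family of contractions. -/
def freeFamily : ContractionFamily (L2 ℝ L) (L2 ℝ L) :=
  ⟨freeSg L, continuous_freeSg L, norm_freeSg_apply_le L⟩

variable (L) in
/-- The solution operators of the unperturbed controlled equation as a family of contractions. -/
def signalFamily : ContractionFamily L2R (L2 ℝ L) :=
  ⟨fun t => restr L ∘L shift t, (restr L).continuous.comp continuous_shift,
    fun t w => (norm_restr_le L (shift t w)).trans (norm_shift_apply t w).le⟩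

/-- The mild solution: `mild K t w` is the state at time `t` for the data `w`, where `w` restricted
to `(0, L)` is the initial state and `w(L + t)` is the control at time `t`. -/
def mild (t : ℝ) : L2R →L[ℝ] L2 ℝ L := duhamel (freeFamily L) (signalFamily L) K t

theorem continuous_mild (w : L2R) : Continuous fun t => mild K t w :=
  continuous_duhamel (freeFamily L) (signalFamily L) K w

theorem exists_norm_mild_le (T : ℝ) :
    ∃ M : ℝ, 0 < M ∧ ∀ t ≤ T, ∀ w, ‖mild K t w‖ ≤ M * ‖w‖ :=
  exists_norm_duhamel_le (freeFamily L) (signalFamily L) K T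

theorem mild_eq {t : ℝ} (ht : 0 ≤ t) (w : L2R) :
    mild K t w = restr L (shift t w)
      + ∫ s in (0 : ℝ)..t, freeSg L (t - s) (K (mild K s w)) :=
  duhamel_eq (freeFamily L) (signalFamily L) K ht w

theorem mild_zero (w : L2R) : mild K 0 w = restr L w := by
  rw [mild_eq K le_rfl, shift_zero, intervalIntegral.integral_same, add_zero]

theorem continuous_freeSg_sub {x : ℝ → L2 ℝ L} (hx : Continuous x) (t : ℝ) :
    Continuous fun s => freeSg L (t - s) (K (x s)) :=
  continuous_duhamel_integrand_left (freeFamily L) K hx t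

/-- Mild solutions are unique. -/
theorem eq_mild {T : ℝ} {y : ℝ → L2 ℝ L} (hy : Continuous y) {w : L2R}
    (h : ∀ t ∈ Icc 0 T, y t = restr L (shift t w)
      + ∫ s in (0 : ℝ)..t, freeSg L (t - s) (K (y s))) :
    ∀ t ∈ Icc 0 T, y t = mild K t w :=
  eq_duhamel (freeFamily L) (signalFamily L) K hy h

theorem mild_eq_zero {t : ℝ} (ht : 0 ≤ t) {w : L2R}
    (h : ∀ s ∈ Icc 0 t, restr L (shift s w) = 0) : mild K t w = 0 :=
  (eq_mild K (T := t) (y := fun _ => 0) continuous_const (fun s hs => by simp [h s hs]) t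
    ⟨ht, le_rfl⟩).symm

/-- Causality: up to time `t` only the values of the signal on `(0, t + L)` pass through the window
`(0, L)`. -/
theorem mild_eq_zero_of_vanishesOn {t : ℝ} (ht : 0 ≤ t) {w : L2R} {s : Set ℝ}
    (h : VanishesOn w s) (hs : Ioo 0 (t + L) ⊆ s) : mild K t w = 0 :=
  mild_eq_zero K ht fun _ hr => h.restr_shift_eq_zero fun _ hx =>
    hs ⟨hr.1.trans_lt hx.1, hx.2.trans_le (by linarith [hr.2])⟩

/-- The evolution property of mild solutions. -/
theorem mild_add {s t : ℝ} (hs : 0 ≤ s) (ht : 0 ≤ t) (w : L2R) :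
    mild K (t + s) w = mild K t (extZ L (mild K s w) + outer L (shift s w)) := by
  refine eq_mild K (T := t) (y := fun t => mild K (t + s) w)
    ((continuous_mild K w).comp (by fun_prop)) (fun r hr => ?_) t ⟨ht, le_rfl⟩
  have hcont (r : ℝ) := continuous_freeSg_sub K (continuous_mild K w) r
  have h1 : ∫ σ in s..r + s, freeSg L (r + s - σ) (K (mild K σ w))
      = ∫ σ in (0 : ℝ)..r, freeSg L (r - σ) (K (mild K (σ + s) w)) := by
    have h := intervalIntegral.integral_comp_add_right (a := 0) (b := r)
      (fun σ => freeSg L (r + s - σ) (K (mild K σ w))) s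
    rw [zero_add] at h
    rw [← h]
    simp only [add_sub_add_right_eq_sub]
  -- The past integral is the Duhamel term at time `s` transported for a further time `r`. Together
  -- with the correction in `freeSg_restr` it accounts for restarting from the state `mild K s w`
  -- with the remaining signal as control.
  have h2 : ∫ σ in (0 : ℝ)..s, freeSg L (r + s - σ) (K (mild K σ w))
      = freeSg L r (mild K s w - restr L (shift s w)) := by
    rw [mild_eq K hs, add_sub_cancel_left,
      ← ContinuousLinearMap.intervalIntegral_comp_comm _ ((hcont s).intervalIntegrable _ _)]
    refine intervalIntegral.integral_congr fun σ hσ => ?_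
    rw [uIcc_of_le hs] at hσ
    rw [freeSg_freeSg L (sub_nonneg.2 hσ.2) hr.1]
    congr 2
    ring
  change mild K (r + s) w = _
  rw [mild_eq K (add_nonneg hr.1 hs), ← intervalIntegral.integral_add_adjacent_intervals
    ((hcont (r + s)).intervalIntegrable 0 s) ((hcont (r + s)).intervalIntegrable s (r + s)),
    h1, h2, map_sub, freeSg_restr, shift_shift, map_add, map_add, ← freeSg_apply]
  abel

/-- The semigroup generated by the perturbed operator. -/
def sg (t : ℝ) : L2 ℝ L →L[ℝ] L2 ℝ L := mild K t ∘L extZ L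

theorem sg_apply (t : ℝ) (y : L2 ℝ L) : sg K t y = mild K t (extZ L y) := rfl

theorem mild_outer_eq_zero {w : L2R} (h : VanishesOn w (Ici L)) {t : ℝ} (ht : 0 ≤ t) :
    mild K t (outer L w) = 0 :=
  mild_eq_zero K ht fun _ hr => h.restr_shift_outer_eq_zero hr.1

/-- The assumption on `w` says that the control is switched off from time `s` on, so the semigroup
alone drives the state afterwards. -/
theorem sg_mild {s t : ℝ} (hs : 0 ≤ s) (ht : 0 ≤ t) {w : L2R} (h : VanishesOn w (Ici (L + s))) :
    sg K t (mild K s w) = mild K (t + s) w := by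
  rw [mild_add K hs ht, map_add, mild_outer_eq_zero K ((h.shift s).mono fun x hx => ?_) ht,
    add_zero, sg_apply]
  have := mem_Ici.1 hx
  change L + s ≤ s + x
  linarith

theorem sg_sg {s t : ℝ} (hs : 0 ≤ s) (ht : 0 ≤ t) (y : L2 ℝ L) :
    sg K t (sg K s y) = sg K (t + s) y :=
  sg_mild K hs ht ((vanishesOn_ext y).mono fun x hx h => by
    have := mem_Ici.1 hx
    linarith [h.2])

theorem sg_zero (y : L2 ℝ L) : sg K 0 y = y := by rw [sg_apply, mild_zero, restr_ext]

theorem continuous_sg (y : L2 ℝ L) : Continuous fun t => sg K t y := continuous_mild K _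

end

noncomputable section

/-! ### Integrals of strongly continuous operator families. -/

section StrongIntegral

variable {E F : Type*} [NormedAddCommGroup E] [NormedSpace ℝ E]
  [NormedAddCommGroup F] [NormedSpace ℝ F]

theorem norm_integral_le_of_strongly_continuous {S : ℝ → E →L[ℝ] F} {C R a b : ℝ}
    (hC : ∀ t, |t| ≤ R → ‖S t‖ ≤ C) (ha : |a| ≤ R) (hb : |b| ≤ R) (y : E) :
    ‖∫ s in a..b, S s y‖ ≤ C * |b - a| * ‖y‖ := by
  have := intervalIntegral.norm_integral_le_of_norm_le_const (a := a) (b := b)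
    (f := fun s => S s y) (C := C * ‖y‖) fun s hs => by
      refine ((S s).le_opNorm y).trans ?_
      gcongr
      refine hC s (abs_le.2 ?_)
      have := uIoc_subset_uIcc hs
      have hsub : uIcc a b ⊆ Icc (-R) R := uIcc_subset_Icc (abs_le.1 ha) (abs_le.1 hb)
      exact hsub this
  linarith

variable [CompleteSpace E]

theorem exists_opNorm_le_of_strongly_continuous {S : ℝ → E →L[ℝ] F}
    (hS : ∀ y, Continuous fun t => S t y) (R : ℝ) :
    ∃ C : ℝ, 0 ≤ C ∧ ∀ t, |t| ≤ R → ‖S t‖ ≤ C := by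
  obtain ⟨C, hC⟩ := banach_steinhaus (g := fun t : Icc (-R) R => S t) fun y => by
    obtain ⟨C, hC⟩ := isCompact_Icc.exists_bound_of_continuousOn (hS y).continuousOn
    exact ⟨C, fun t => hC t t.2⟩
  exact ⟨max C 0, le_max_right _ _, fun t ht =>
    (hC ⟨t, abs_le.1 ht⟩).trans (le_max_left _ _)⟩

/-- The strong integral `∫₀ᵗ S(s) ds` of a strongly continuous family of operators. -/
def strongInt (S : ℝ → E →L[ℝ] F) (hS : ∀ y, Continuous fun t => S t y) (t : ℝ) : E →L[ℝ] F :=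
  LinearMap.mkContinuousOfExistsBound
    { toFun := fun y => ∫ s in (0 : ℝ)..t, S s y
      map_add' := fun x y => by
        simp only [map_add]
        exact intervalIntegral.integral_add ((hS x).intervalIntegrable _ _)
          ((hS y).intervalIntegrable _ _)
      map_smul' := fun a x => by
        simp only [map_smul, RingHom.id_apply, intervalIntegral.integral_smul] } (by
    obtain ⟨C, -, hC⟩ := exists_opNorm_le_of_strongly_continuous hS |t|
    exact ⟨C * |t - 0|, norm_integral_le_of_strongly_continuous hC (by simp) le_rfl⟩)

variable {S : ℝ → E →L[ℝ] F} (hS : ∀ y, Continuous fun t => S t y)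

theorem strongInt_apply (t : ℝ) (y : E) : strongInt S hS t y = ∫ s in (0 : ℝ)..t, S s y := rfl

theorem strongInt_sub_apply (a b : ℝ) (y : E) :
    strongInt S hS b y - strongInt S hS a y = ∫ s in a..b, S s y := by
  rw [strongInt_apply, strongInt_apply, intervalIntegral.integral_interval_sub_left
    ((hS y).intervalIntegrable _ _) ((hS y).intervalIntegrable _ _)]

/-- The strong integral is continuous in the operator norm. -/
theorem continuous_strongInt : Continuous (strongInt S hS) := by
  refine continuous_iff_continuousAt.2 fun t => ?_
  obtain ⟨C, hC0, hC⟩ := exists_opNorm_le_of_strongly_continuous hS (|t| + 1)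
  rw [ContinuousAt, tendsto_iff_norm_sub_tendsto_zero]
  have hlim : Tendsto (fun s => C * |s - t|) (𝓝 t) (𝓝 0) := by
    have : Continuous fun s => C * |s - t| := by fun_prop
    simpa using this.tendsto t
  refine squeeze_zero' (.of_forall fun _ => norm_nonneg _) ?_ hlim
  filter_upwards [Metric.ball_mem_nhds t one_pos] with s hs
  rw [Metric.mem_ball, Real.dist_eq] at hs
  refine ContinuousLinearMap.opNorm_le_bound _ (by positivity) fun y => ?_
  rw [sub_apply, strongInt_sub_apply]
  refine norm_integral_le_of_strongly_continuous hC (by linarith) ?_ y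
  have := abs_add_le (s - t) t
  rw [sub_add_cancel] at this
  linarith

variable [CompleteSpace F]

theorem hasDerivAt_strongInt (t : ℝ) (y : E) :
    HasDerivAt (fun t => strongInt S hS t y) (S t y) t :=
  intervalIntegral.integral_hasDerivAt_right ((hS y).intervalIntegrable _ _)
    ((hS y).stronglyMeasurableAtFilter _ _) (hS y).continuousAt

/-- `ε⁻¹ ∫₀^ε S(s) y ds → S(0) y`. -/
theorem tendsto_inv_smul_strongInt (y : E) :
    Tendsto (fun ε : ℝ => ε⁻¹ • strongInt S hS ε y) (𝓝[>] 0) (𝓝 (S 0 y)) := by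
  have h := (hasDerivAt_strongInt hS 0 y).tendsto_slope_zero_right
  simpa [strongInt_apply] using h

end StrongIntegral

/-! ### Integrals of translated signals as pointwise primitives. -/

section Primitive

variable {L : ℝ}

/-- This is the input to Fubini's theorem in `integral_restr_shift`. By Cauchy–Schwarz each slice
has integral at most `‖h‖ * ‖w‖`, uniformly in the shift. -/
theorem integrable_mul_shift (h : L2 ℝ L) (w : L2R) (t : ℝ) :
    Integrable (fun p : ℝ × ℝ => h p.2 * w (p.1 + p.2))
      ((volume.restrict (Ioc 0 t)).prod (μI L)) := by
  have hm : StronglyMeasurable fun p : ℝ × ℝ => h p.2 * w (p.1 + p.2) :=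
    ((Lp.stronglyMeasurable h).comp_measurable measurable_snd).mul
      ((Lp.stronglyMeasurable w).comp_measurable (measurable_fst.add measurable_snd))
  have hsec (s : ℝ) : MemLp (fun x => w (s + x)) 2 (μI L) :=
    ((Lp.memLp w).comp_measurePreserving (measurePreserving_add_left volume s)).restrict _
  rw [integrable_prod_iff hm.aestronglyMeasurable]
  refine ⟨.of_forall fun s => (Lp.memLp h).integrable_mul (hsec s), ?_⟩
  refine Integrable.of_bound (C := ‖h‖ * ‖w‖) hm.norm.integral_prod_right.aestronglyMeasurable
    (.of_forall fun s => ?_)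
  rw [Real.norm_of_nonneg (integral_nonneg fun _ => norm_nonneg _)]
  set h' : L2 ℝ L := (Lp.memLp h).norm.toLp _
  set w' : L2 ℝ L := (hsec s).norm.toLp _
  have e : ∫ x, ‖h x * w (s + x)‖ ∂μI L = ⟪h', w'⟫_ℝ := by
    rw [L2.inner_def]
    refine integral_congr_ae ?_
    filter_upwards [(Lp.memLp h).norm.coeFn_toLp, (hsec s).norm.coeFn_toLp] with x h1 h2
    rw [h1, h2, norm_mul]
    simp [mul_comm]
  change ∫ x, ‖h x * w (s + x)‖ ∂μI L ≤ _
  rw [e]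
  refine (real_inner_le_norm _ _).trans ?_
  have n1 : ‖h'‖ = ‖h‖ := by
    rw [Lp.norm_toLp, Lp.norm_def, eLpNorm_norm]
  have n2 : ‖w'‖ ≤ ‖w‖ := by
    rw [Lp.norm_toLp, ← norm_shift_apply s w, Lp.norm_def, eLpNorm_norm,
      eLpNorm_congr_ae (coeFn_shift s w)]
    refine ENNReal.toReal_mono ?_ (eLpNorm_restrict_le _ _ _ _)
    exact ((Lp.memLp w).comp_measurePreserving (measurePreserving_add_left volume s)).eLpNorm_ne_top
  rw [n1]
  gcongr

theorem locallyIntegrable_L2R (w : L2R) : LocallyIntegrable w :=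
  (Lp.memLp w).locallyIntegrable (by norm_num)

theorem intervalIntegrable_L2R (w : L2R) (a b : ℝ) : IntervalIntegrable w volume a b :=
  ((locallyIntegrable_L2R w).integrableOn_isCompact isCompact_uIcc).intervalIntegrable

theorem continuous_window (w : L2R) (t : ℝ) : Continuous fun x => ∫ r in x..x + t, w r := by
  have h : Continuous fun x => ∫ r in (0 : ℝ)..x, w r :=
    intervalIntegral.continuous_primitive (intervalIntegrable_L2R w) 0
  have e : (fun x => ∫ r in x..x + t, w r)
      = fun x => (∫ r in (0 : ℝ)..x + t, w r) - ∫ r in (0 : ℝ)..x, w r := by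
    ext x
    rw [intervalIntegral.integral_interval_sub_left] <;> exact intervalIntegrable_L2R w _ _
  rw [e]
  fun_prop

theorem memLp_of_continuous {f : ℝ → ℝ} (hf : Continuous f) : MemLp f 2 (μI L) := by
  obtain ⟨C, hC⟩ := (isCompact_Icc (a := 0) (b := L)).exists_bound_of_continuousOn hf.continuousOn
  refine MemLp.of_bound hf.aestronglyMeasurable C ?_
  filter_upwards [ae_restrict_mem measurableSet_Ioo] with x hx using hC x (Ioo_subset_Icc_self hx)

theorem continuous_restr_shift (w : L2R) : Continuous fun s => restr L (shift s w) :=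
  (restr L).continuous.comp (continuous_shift.comp (Continuous.prodMk_left w))

/-- The Bochner integral `∫₀ᵗ w(s + ·) ds` in `L²(0, L)` is represented by the function
`x ↦ ∫ₓ^{x+t} w`. -/
theorem integral_restr_shift {t : ℝ} (ht : 0 ≤ t) (w : L2R) :
    (∫ s in (0 : ℝ)..t, restr L (shift s w) : L2 ℝ L) =ᵐ[μI L] fun x => ∫ r in x..x + t, w r := by
  have hf := memLp_of_continuous (L := L) (continuous_window w t)
  suffices h : ∫ s in (0 : ℝ)..t, restr L (shift s w) = hf.toLp _ by
    rw [h]; exact hf.coeFn_toLp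
  refine ext_inner_left ℝ fun h => ?_
  have hi := integrable_mul_shift h w t
  calc ⟪h, ∫ s in (0 : ℝ)..t, restr L (shift s w)⟫_ℝ
      = ∫ s in (0 : ℝ)..t, ⟪h, restr L (shift s w)⟫_ℝ :=
        ((innerSL ℝ h).intervalIntegral_comp_comm
          ((continuous_restr_shift w).intervalIntegrable _ _)).symm
    _ = ∫ s in (0 : ℝ)..t, ∫ x, h x * w (s + x) ∂μI L := by
        refine intervalIntegral.integral_congr fun s _ => ?_
        rw [L2.inner_def]
        refine integral_congr_ae ?_
        filter_upwards [coeFn_restr L (shift s w), ae_restrict_of_ae (coeFn_shift s w)]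
          with x h1 h2
        rw [h1, h2]
        simp [mul_comm]
    _ = ∫ x, (∫ s in Ioc 0 t, h x * w (s + x)) ∂μI L := by
        rw [intervalIntegral.integral_of_le ht]
        exact integral_integral_swap (f := fun s x => h x * w (s + x)) hi
    _ = ∫ x, h x * (∫ r in x..x + t, w r) ∂μI L := by
        refine integral_congr_ae (.of_forall fun x => ?_)
        simp only
        rw [integral_const_mul, ← intervalIntegral.integral_of_le ht,
          intervalIntegral.integral_comp_add_right w x, zero_add, add_comm t x]
    _ = ⟪h, hf.toLp _⟫_ℝ := by
        rw [L2.inner_def]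
        refine integral_congr_ae ?_
        filter_upwards [hf.coeFn_toLp] with x h1
        rw [h1]
        simp [mul_comm]

theorem integral_restr_shift_neg {t : ℝ} (ht : 0 ≤ t) (w : L2R) :
    (∫ s in (0 : ℝ)..t, restr L (shift (-s) w) : L2 ℝ L) =ᵐ[μI L] fun x => ∫ r in x - t..x, w r := by
  have h1 : ∫ s in (0 : ℝ)..t, restr L (shift (-s) w)
      = ∫ s in (0 : ℝ)..t, restr L (shift s (shift (-t) w)) := by
    have := intervalIntegral.integral_comp_sub_left (a := 0) (b := t)
      (fun s => restr L (shift s (shift (-t) w))) t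
    rw [sub_self, sub_zero] at this
    rw [← this]
    refine intervalIntegral.integral_congr fun s _ => ?_
    simp only [shift_shift]
    congr 3
    ring
  rw [h1]
  filter_upwards [integral_restr_shift (L := L) ht (shift (-t) w)] with x h2
  rw [h2]
  have h3 : ∫ r in x..x + t, shift (-t) w r = ∫ r in x..x + t, w (-t + r) :=
    intervalIntegral.integral_congr_ae (by
      filter_upwards [coeFn_shift (-t) w] with r hr _ using hr)
  rw [h3, intervalIntegral.integral_comp_add_left w (-t)]
  congr 1 <;> ring

end Primitive

end

/-! ### The primitive operators and the domain of the generator. -/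

noncomputable section

variable {L : ℝ}

theorem continuous_freeSg_apply (y : L2 ℝ L) : Continuous fun t => freeSg L t y :=
  continuous_restr_shift _

theorem continuous_freeSg_neg_apply (y : L2 ℝ L) : Continuous fun t => freeSg L (-t) y :=
  (continuous_freeSg_apply y).comp continuous_neg

variable (L) in
/-- The operator `(prim L g)(x) = ∫ₓᴸ g`, minus the inverse of the free generator. -/
def prim : L2 ℝ L →L[ℝ] L2 ℝ L := strongInt (freeSg L) continuous_freeSg_apply L

variable (L) in
/-- The operator `(primAdj L g)(x) = ∫₀ˣ g`, the adjoint of `prim L`. -/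
def primAdj : L2 ℝ L →L[ℝ] L2 ℝ L :=
  strongInt (fun t => freeSg L (-t)) continuous_freeSg_neg_apply L

theorem inner_prim (y z : L2 ℝ L) : ⟪prim L y, z⟫_ℝ = ⟪y, primAdj L z⟫_ℝ := by
  rw [real_inner_comm]
  change (innerSL ℝ z) (∫ s in (0 : ℝ)..L, freeSg L s y)
    = (innerSL ℝ y) (∫ s in (0 : ℝ)..L, freeSg L (-s) z)
  rw [← ContinuousLinearMap.intervalIntegral_comp_comm _
      ((continuous_freeSg_apply y).intervalIntegrable _ _),
    ← ContinuousLinearMap.intervalIntegral_comp_comm _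
      ((continuous_freeSg_neg_apply z).intervalIntegrable _ _)]
  refine intervalIntegral.integral_congr fun s _ => ?_
  simp only [innerSL_apply_apply]
  rw [real_inner_comm, inner_freeSg]

theorem VanishesOn.intervalIntegral_eq_zero {w : L2R} {s : Set ℝ} (h : VanishesOn w s) {a b : ℝ}
    (hab : a ≤ b) (hs : Ioo a b ⊆ s) : ∫ r in a..b, w r = 0 := by
  rw [intervalIntegral.integral_of_le hab, integral_Ioc_eq_integral_Ioo]
  refine setIntegral_eq_zero_of_ae_eq_zero ?_
  filter_upwards [h] with x hx hx' using hx (hs hx')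

theorem intervalIntegral_ext_restr (w : L2R) {a b : ℝ} (ha : 0 ≤ a) (hab : a ≤ b) (hb : b ≤ L) :
    ∫ r in a..b, extZ L (restr L w) r = ∫ r in a..b, w r := by
  rw [intervalIntegral.integral_of_le hab, intervalIntegral.integral_of_le hab,
    integral_Ioc_eq_integral_Ioo, integral_Ioc_eq_integral_Ioo]
  refine setIntegral_congr_ae measurableSet_Ioo ?_
  rw [ext_restr]
  filter_upwards [coeFn_cut (Ioo 0 L) measurableSet_Ioo w] with x hx hx'
  have hm : x ∈ Ioo 0 L := ⟨ha.trans_lt hx'.1, hx'.2.trans_le hb⟩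
  rw [hx, indicator_of_mem hm]

/-- The window integral over `(x, x + L)` stops at `L` because the extension vanishes beyond. -/
theorem coeFn_prim (hL : 0 < L) (g : L2 ℝ L) :
    prim L g =ᵐ[μI L] fun x => ∫ r in x..L, extZ L g r := by
  have h := integral_restr_shift (L := L) hL.le (extZ L g)
  have h' : prim L g = ∫ s in (0 : ℝ)..L, restr L (shift s (extZ L g)) := rfl
  rw [h']
  filter_upwards [h, ae_restrict_mem measurableSet_Ioo] with x hx hm
  rw [hx, ← intervalIntegral.integral_add_adjacent_intervals
    (intervalIntegrable_L2R _ x L) (intervalIntegrable_L2R _ L (x + L)),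
    (vanishesOn_ext g).intervalIntegral_eq_zero (a := L) (b := x + L) (by linarith [hm.1])
      (fun r hr h => absurd h.2 (by simpa using hr.1.le)), add_zero]

theorem coeFn_primAdj (hL : 0 < L) (g : L2 ℝ L) :
    primAdj L g =ᵐ[μI L] fun x => ∫ r in (0 : ℝ)..x, extZ L g r := by
  have h := integral_restr_shift_neg (L := L) hL.le (extZ L g)
  have h' : primAdj L g = ∫ s in (0 : ℝ)..L, restr L (shift (-s) (extZ L g)) := rfl
  rw [h']
  filter_upwards [h, ae_restrict_mem measurableSet_Ioo] with x hx hm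
  rw [hx, ← intervalIntegral.integral_add_adjacent_intervals
    (intervalIntegrable_L2R _ (x - L) 0) (intervalIntegrable_L2R _ 0 x),
    (vanishesOn_ext g).intervalIntegral_eq_zero (a := x - L) (b := 0) (by linarith [hm.2])
      (fun r hr h => absurd h.1 (by simpa using hr.2.le)), zero_add]

variable (L) in
/-- The constant function `1` in `L²(0, L)`. -/
def oneL : L2 ℝ L := (memLp_of_continuous (continuous_const (y := (1 : ℝ)))).toLp _

theorem coeFn_oneL : oneL L =ᵐ[μI L] fun _ => 1 :=
  (memLp_of_continuous (continuous_const (y := (1 : ℝ)))).coeFn_toLp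

theorem inner_oneL (g : L2 ℝ L) : ⟪oneL L, g⟫_ℝ = ∫ x in Ioo 0 L, g x := by
  rw [L2.inner_def]
  refine integral_congr_ae ?_
  filter_upwards [coeFn_oneL (L := L)] with x hx
  rw [hx]
  simp

/-- The boundary value of a signal is seen by `prim`. -/
theorem prim_restr_shift_sub (hL : 0 < L) {t : ℝ} (ht : 0 ≤ t) (w : L2R) :
    prim L (restr L (shift t w)) - prim L (restr L w)
      = (∫ r in L..L + t, w r) • oneL L - ∫ s in (0 : ℝ)..t, restr L (shift s w) := by
  have hp (v : L2R) : prim L (restr L v) =ᵐ[μI L] fun x => ∫ r in x..L, v r := by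
    filter_upwards [coeFn_prim hL (restr L v), ae_restrict_mem measurableSet_Ioo] with x hx hm
    rw [hx, intervalIntegral_ext_restr v hm.1.le hm.2.le le_rfl]
  refine Lp.ext ?_
  filter_upwards [hp (shift t w), hp w, Lp.coeFn_sub (prim L (restr L (shift t w)))
      (prim L (restr L w)), Lp.coeFn_sub ((∫ r in L..L + t, w r) • oneL L)
      (∫ s in (0 : ℝ)..t, restr L (shift s w)), Lp.coeFn_smul (∫ r in L..L + t, w r) (oneL L),
    coeFn_oneL (L := L), integral_restr_shift (L := L) ht w] with x h1 h2 h3 h4 h5 h6 h7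
  have h8 : ∫ r in x..L, shift t w r = ∫ r in t + x..t + L, w r := by
    rw [← intervalIntegral.integral_comp_add_left w t]
    exact intervalIntegral.integral_congr_ae (by
      filter_upwards [coeFn_shift t w] with r hr _ using hr)
  rw [h3, h4, Pi.sub_apply, Pi.sub_apply, h1, h2, h5, Pi.smul_apply, h6, h7, h8, smul_eq_mul,
    mul_one, add_comm t x, add_comm t L]
  have i (a b : ℝ) := intervalIntegrable_L2R w a b
  have e1 := intervalIntegral.integral_add_adjacent_intervals (i x L) (i L (L + t))
  have e2 := intervalIntegral.integral_add_adjacent_intervals (i x (x + t)) (i (x + t) (L + t))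
  linarith

/-- The identity `S(t) - 1 = ∫₀ᵗ S A` for the free semigroup, composed with `A⁻¹ = -prim L`. No
boundary term appears, since the zero extension carries no control. -/
theorem prim_sub_prim_freeSg (hL : 0 < L) {t : ℝ} (ht : 0 ≤ t) (y : L2 ℝ L) :
    prim L y - prim L (freeSg L t y) = ∫ s in (0 : ℝ)..t, freeSg L s y := by
  have h := prim_restr_shift_sub hL ht (extZ L y)
  rw [(vanishesOn_ext y).intervalIntegral_eq_zero (by linarith)
    (fun r hr h => absurd h.2 (by simpa using hr.1.le)), zero_smul, zero_sub, restr_ext,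
    ← neg_inj, neg_neg, neg_sub] at h
  exact h

theorem freeSg_prim (hL : 0 < L) {t : ℝ} (ht : 0 ≤ t) (y : L2 ℝ L) :
    freeSg L t (prim L y) = prim L (freeSg L t y) := by
  change freeSg L t (∫ s in (0 : ℝ)..L, freeSg L s y) = ∫ s in (0 : ℝ)..L, freeSg L s (freeSg L t y)
  rw [← ContinuousLinearMap.intervalIntegral_comp_comm _
    ((continuous_freeSg_apply y).intervalIntegrable _ _)]
  refine intervalIntegral.integral_congr fun s hs => ?_
  rw [uIcc_of_le hL.le] at hs
  rw [freeSg_freeSg L hs.1 ht, freeSg_freeSg L ht hs.1, add_comm]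

theorem continuous_primitive_ext (g : L2 ℝ L) :
    Continuous fun x => ∫ r in (0 : ℝ)..x, extZ L g r :=
  intervalIntegral.continuous_primitive (intervalIntegrable_L2R _) 0

theorem hasTrace_primAdj (hL : 0 < L) (g : L2 ℝ L) :
    HasTrace (primAdj L g) L ⟪oneL L, g⟫_ℝ := by
  refine ⟨_, (continuous_primitive_ext g).continuousOn, coeFn_primAdj hL g, ?_⟩
  rw [inner_oneL, intervalIntegral.integral_of_le hL.le, integral_Ioc_eq_integral_Ioo]
  refine setIntegral_congr_ae measurableSet_Ioo ?_
  filter_upwards [coeFn_ext L g] with x hx hm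
  rw [hx, indicator_of_mem hm]

theorem hasTrace_prim (hL : 0 < L) (g : L2 ℝ L) : HasTrace (prim L g) L 0 := by
  refine ⟨_, Continuous.continuousOn ?_, coeFn_prim hL g, intervalIntegral.integral_same⟩
  have e : (fun x => ∫ r in x..L, extZ L g r)
      = fun x => (∫ r in (0 : ℝ)..L, extZ L g r) - ∫ r in (0 : ℝ)..x, extZ L g r := by
    ext x
    rw [intervalIntegral.integral_interval_sub_left] <;> exact intervalIntegrable_L2R _ _ _
  rw [e]
  exact continuous_const.sub (continuous_primitive_ext g)

theorem inner_toLp {f : ℝ → ℝ} (hf : Continuous f) (g : L2 ℝ L) :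
    ⟪(memLp_of_continuous hf).toLp f, g⟫_ℝ = ∫ x in Ioo 0 L, f x • g x := by
  rw [L2.inner_def]
  refine integral_congr_ae ?_
  filter_upwards [(memLp_of_continuous (L := L) hf).coeFn_toLp] with x hx
  rw [hx]
  simp [mul_comm]

/-- By duality the primitive moves onto the test function, and `primAdj` recovers `φ` from `φ'`
because `φ` vanishes at `0`. -/
theorem hasWeakDeriv_prim (hL : 0 < L) (g : L2 ℝ L) : HasWeakDeriv (prim L g) (-g) := by
  intro φ hφ hc hs
  have hφ' : Continuous (deriv φ) := hφ.continuous_deriv (by simp)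
  rw [← inner_toLp hφ', ← inner_toLp hφ.continuous, inner_neg_right, neg_neg, real_inner_comm,
    inner_prim, real_inner_comm]
  congr 1
  refine Lp.ext ?_
  filter_upwards [coeFn_primAdj hL ((memLp_of_continuous (L := L) hφ').toLp (deriv φ)),
    (memLp_of_continuous (L := L) hφ.continuous).coeFn_toLp,
    ae_restrict_mem measurableSet_Ioo] with x h1 h2 hx
  rw [h1, h2]
  have h3 : ∫ r in (0 : ℝ)..x, extZ L ((memLp_of_continuous (L := L) hφ').toLp (deriv φ)) r
      = ∫ r in (0 : ℝ)..x, deriv φ r := by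
    rw [intervalIntegral.integral_of_le hx.1.le, intervalIntegral.integral_of_le hx.1.le,
      integral_Ioc_eq_integral_Ioo, integral_Ioc_eq_integral_Ioo]
    refine setIntegral_congr_ae measurableSet_Ioo ?_
    filter_upwards [coeFn_ext L ((memLp_of_continuous (L := L) hφ').toLp (deriv φ)),
      ae_imp_of_ae_restrict (memLp_of_continuous (L := L) hφ').coeFn_toLp] with r h4 h5 hr
    have hr' : r ∈ Ioo 0 L := ⟨hr.1, hr.2.trans hx.2⟩
    rw [h4, indicator_of_mem hr', h5 hr']
  have h0 : φ 0 = 0 := image_eq_zero_of_notMem_tsupport fun h => lt_irrefl _ (hs h).1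
  rw [h3, intervalIntegral.integral_deriv_eq_sub
    (fun r _ => (hφ.differentiable (by simp)).differentiableAt) (hφ'.intervalIntegrable _ _), h0,
    sub_zero]

/-- The lemma of du Bois-Reymond. -/
theorem HasWeakDeriv.exists_ae_eq_const (hL : 0 < L) {d : L2 ℝ L} (hd : HasWeakDeriv d 0) :
    ∃ c : ℝ, d =ᵐ[μI L] fun _ => c := by
  -- A bump of unit mass inside `(0, L)`; the constant will be the mean of `d` against it.
  let b : ContDiffBump (L / 2) := ⟨L / 8, L / 4, by positivity, by linarith⟩
  set ψ : ℝ → ℝ := b.normed volume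
  have hψ : ContDiff ℝ ∞ ψ := b.contDiff_normed
  have hψi : ∫ x, ψ x = 1 := b.integral_normed
  have hψt : tsupport ψ = Metric.closedBall (L / 2) (L / 4) := b.tsupport_normed_eq
  have hψc : HasCompactSupport ψ := b.hasCompactSupport_normed
  set c := ∫ x in Ioo 0 L, ψ x • d x
  refine ⟨c, ?_⟩
  have hdz (φ : ℝ → ℝ) (hφ : ContDiff ℝ ∞ φ) (hc : HasCompactSupport φ)
      (hs : tsupport φ ⊆ Ioo 0 L) : ∫ x in Ioo 0 L, deriv φ x • d x = 0 := by
    rw [hd φ hφ hc hs, neg_eq_zero]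
    refine integral_eq_zero_of_ae ?_
    have h0 : ((0 : L2 ℝ L) : ℝ → ℝ) =ᵐ[μI L] 0 := Lp.coeFn_zero _ _ _
    filter_upwards [h0] with x hx
    rw [hx, Pi.zero_apply, smul_zero]
  have key := isOpen_Ioo.ae_eq_zero_of_integral_contDiff_smul_eq_zero (U := Ioo 0 L)
    (μ := μI L) (f := fun x => d x - c)
    (((integrable_coe d).sub (integrable_const c)).locallyIntegrable.locallyIntegrableOn _) (by
      intro φ hφ hc hs
      set a := ∫ x, φ x
      -- Subtracting `a * ψ` removes the mean, so the primitive `Φ` has compact support in `(0, L)`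
      -- and is an admissible test function.
      have hη : ContDiff ℝ ∞ fun x => φ x - a * ψ x := hφ.sub (contDiff_const.mul hψ)
      set Φ : ℝ → ℝ := fun x => ∫ r in (0 : ℝ)..x, (φ r - a * ψ r)
      have hΦd : ∀ x, HasDerivAt Φ (φ x - a * ψ x) x := fun x =>
        intervalIntegral.integral_hasDerivAt_right (hη.continuous.intervalIntegrable _ _)
          (hη.continuous.stronglyMeasurableAtFilter _ _) hη.continuous.continuousAt
      have hΦ' : deriv Φ = fun x => φ x - a * ψ x := funext fun x => (hΦd x).deriv
      have hΦ : ContDiff ℝ ∞ Φ :=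
        contDiff_infty_iff_deriv.2 ⟨fun x => (hΦd x).differentiableAt, hΦ' ▸ hη⟩
      obtain ⟨α, β, hα, hβ, hφs, hψs⟩ : ∃ α β, 0 < α ∧ β < L ∧ tsupport φ ⊆ Icc α β ∧
          tsupport ψ ⊆ Icc α β := by
        have hK : IsCompact (tsupport φ ∪ tsupport ψ) := hc.isCompact.union hψc.isCompact
        have hKs : tsupport φ ∪ tsupport ψ ⊆ Ioo 0 L := union_subset hs (by
          rw [hψt, Real.closedBall_eq_Icc]
          exact fun x hx => ⟨by linarith [hx.1], by linarith [hx.2]⟩)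
        have hne : (tsupport φ ∪ tsupport ψ).Nonempty := ⟨L / 2, Or.inr (by
          rw [hψt]; exact Metric.mem_closedBall_self (by positivity))⟩
        obtain ⟨α, hαm, hα⟩ := hK.exists_isLeast hne
        obtain ⟨β, hβm, hβ⟩ := hK.exists_isGreatest hne
        exact ⟨α, β, (hKs hαm).1, (hKs hβm).2, fun x hx => ⟨hα (Or.inl hx), hβ (Or.inl hx)⟩,
          fun x hx => ⟨hα (Or.inr hx), hβ (Or.inr hx)⟩⟩
      have hz : ∀ r, r ∉ Icc α β → φ r - a * ψ r = 0 := fun r hr => by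
        rw [image_eq_zero_of_notMem_tsupport fun h => hr (hφs h),
          image_eq_zero_of_notMem_tsupport fun h => hr (hψs h), mul_zero, sub_zero]
      have hηi : ∫ r, (φ r - a * ψ r) = 0 := by
        rw [integral_sub (hφ.continuous.integrable_of_hasCompactSupport hc)
          ((hψ.continuous.integrable_of_hasCompactSupport hψc).const_mul a),
          integral_const_mul, hψi, mul_one, sub_self]
      have hΦs : Function.support Φ ⊆ Icc α β := by
        intro x hx
        by_contra hn
        refine hx ?_
        rcases lt_or_ge x α with h | h
        · refine (intervalIntegral.integral_congr (g := fun _ => 0) fun r hr => hz r fun hr' => ?_).trans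
            intervalIntegral.integral_zero
          have := hr.2
          have h3 : max 0 x < α := max_lt hα h
          linarith [hr'.1]
        · have hβx : β < x := lt_of_not_ge fun h' => hn ⟨h, h'⟩
          have hsupp : Function.support (fun r => φ r - a * ψ r) ⊆ Ioc 0 x := fun r hr => by
            by_contra h'
            exact hr (hz r fun h'' => h' ⟨hα.trans_le h''.1, h''.2.trans hβx.le⟩)
          exact (intervalIntegral.integral_eq_integral_of_support_subset hsupp).trans hηi
      have hΦt : tsupport Φ ⊆ Icc α β := closure_minimal hΦs isClosed_Icc
      have h1 := hdz Φ hΦ (HasCompactSupport.of_support_subset_isCompact isCompact_Icc hΦs)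
        (hΦt.trans fun x hx => ⟨hα.trans_le hx.1, hx.2.trans_lt hβ⟩)
      rw [hΦ'] at h1
      have i1 := integrable_smul_coe d hφ.continuous hc
      have i2 := integrable_smul_coe d hψ.continuous hψc
      have h2 : ∫ x in Ioo 0 L, φ x • d x = a * c := by
        rw [← sub_eq_zero]
        refine Eq.trans ?_ h1
        rw [← integral_const_mul, ← integral_sub i1 (i2.const_mul a)]
        refine integral_congr_ae (.of_forall fun x => ?_)
        simp only [smul_eq_mul]
        ring
      have h3 : ∫ x in Ioo 0 L, φ x = a := by
        rw [setIntegral_eq_integral_of_forall_compl_eq_zero]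
        exact fun x hx => image_eq_zero_of_notMem_tsupport fun h => hx (hs h)
      have h4 : ∫ x in Ioo 0 L, φ x * c = a * c := by rw [integral_mul_const, h3]
      simp only [smul_sub]
      rw [integral_sub i1, h2]
      · simp only [smul_eq_mul]; rw [h4, sub_self]
      · exact (hφ.continuous.integrable_of_hasCompactSupport hc).restrict.mul_const c)
  filter_upwards [key, ae_restrict_mem measurableSet_Ioo] with x hx hm
  exact sub_eq_zero.1 (hx hm)

theorem eq_zero_of_hasWeakDeriv_zero (hL : 0 < L) {d : L2 ℝ L} (hd : HasWeakDeriv d 0)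
    (ht : HasTrace d L 0) : d = 0 := by
  obtain ⟨c, hc⟩ := hd.exists_ae_eq_const hL
  have h : c = 0 := HasTrace.unique hL (right_mem_Icc.2 hL.le)
    ⟨fun _ => c, continuousOn_const, hc, rfl⟩ ht
  rw [Lp.eq_zero_iff_ae_eq_zero]
  filter_upwards [hc] with x hx
  rw [hx, h, Pi.zero_apply]

theorem neg_prim_mem_generatorDomain (hL : 0 < L) (g : L2 ℝ L) :
    -prim L g ∈ generatorDomain ℝ L := by
  refine (generatorDomain ℝ L).neg_mem ⟨⟨_, hasWeakDeriv_prim hL g⟩, hasTrace_prim hL g⟩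

/-- The sum of the two sides' candidates, `y + prim L y_x`, has zero weak derivative and zero trace
at `L`. Thus the domain is the range of `-prim L`, and later computations take `g = y_x` as the
unknown. -/
theorem eq_neg_prim_of_mem (hL : 0 < L) (y : generatorDomain ℝ L) :
    (y : L2 ℝ L) = -prim L (weakDeriv ℝ L y) := by
  rw [eq_neg_iff_add_eq_zero]
  refine eq_zero_of_hasWeakDeriv_zero hL ?_ ?_
  · simpa using (weakDeriv_spec y).add (hasWeakDeriv_prim hL (weakDeriv ℝ L y))
  · simpa using y.2.2.add (hasTrace_prim hL (weakDeriv ℝ L y))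

theorem weakDeriv_neg_prim (hL : 0 < L) (g : L2 ℝ L) :
    weakDeriv ℝ L ⟨-prim L g, neg_prim_mem_generatorDomain hL g⟩ = g := by
  refine (weakDeriv_spec _).unique ?_
  simpa using (hasWeakDeriv_prim hL g).smul (-1)

/-- The time averages `ε⁻¹ ∫₀^ε S(s) y ds` tend to `y`, and by `prim_sub_prim_freeSg` they lie in
the range of `prim L`. -/
theorem dense_generatorDomain (hL : 0 < L) : Dense (generatorDomain ℝ L : Set (L2 ℝ L)) := by
  intro y
  have h := tendsto_inv_smul_strongInt continuous_freeSg_apply y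
  rw [freeSg_zero] at h
  refine mem_closure_of_tendsto h ?_
  filter_upwards [self_mem_nhdsWithin] with ε hε
  refine (generatorDomain ℝ L).smul_mem _ ?_
  rw [strongInt_apply, ← prim_sub_prim_freeSg hL (le_of_lt hε), ← map_sub, ← neg_sub, map_neg]
  exact neg_prim_mem_generatorDomain hL _

/-- The integrand also depends on the upper limit `h`, as in a Duhamel integral. Rescaling to the
unit interval turns the claim into continuity in a parameter. -/
theorem tendsto_inv_smul_integral {E : Type*} [NormedAddCommGroup E] [NormedSpace ℝ E]
    [CompleteSpace E] {f : ℝ → ℝ → E} (hf : Continuous fun p : ℝ × ℝ => f p.1 p.2) :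
    Tendsto (fun h : ℝ => h⁻¹ • ∫ s in (0 : ℝ)..h, f h s) (𝓝[>] 0) (𝓝 (f 0 0)) := by
  have e : ∀ᶠ h : ℝ in 𝓝[>] 0, ∫ s in (0 : ℝ)..1, f h (h * s) = h⁻¹ • ∫ s in (0 : ℝ)..h, f h s := by
    filter_upwards [self_mem_nhdsWithin] with h hh
    rw [intervalIntegral.integral_comp_mul_left (f h) (ne_of_gt hh), mul_zero, mul_one]
  refine Tendsto.congr' e ?_
  have hc : Continuous fun h : ℝ => ∫ s in (0 : ℝ)..1, f h (h * s) :=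
    intervalIntegral.continuous_parametric_intervalIntegral_of_continuous'
      (f := fun h s => f h (h * s)) (hf.comp
        (continuous_fst.prodMk (continuous_fst.mul continuous_snd) :
          Continuous fun p : ℝ × ℝ => (p.1, p.1 * p.2))) 0 1
  have := hc.tendsto 0
  simp only [zero_mul, intervalIntegral.integral_const, sub_zero, one_smul] at this
  exact this.mono_left nhdsWithin_le_nhds

end

noncomputable section

variable {L : ℝ}

theorem tendsto_sub_nhdsGT (t : ℝ) : Tendsto (fun s => s - t) (𝓝[>] t) (𝓝[>] 0) := by
  refine tendsto_nhdsWithin_of_tendsto_nhds_of_eventually_within _ ?_ ?_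
  · have : Tendsto (fun s => s - t) (𝓝 t) (𝓝 (t - t)) := (continuous_sub_right t).tendsto t
    rw [sub_self] at this
    exact this.mono_left nhdsWithin_le_nhds
  · filter_upwards [self_mem_nhdsWithin] with s hs
    exact sub_pos.2 (mem_Ioi.1 hs)

/-! ### Right derivatives of mild solutions. -/

section Mild

variable (K : L2 ℝ L →L[ℝ] L2 ℝ L)

theorem continuous_duhamel_mild (w : L2R) :
    Continuous fun p : ℝ × ℝ => freeSg L (p.1 - p.2) (K (mild K p.2 w)) := by
  have h1 : Continuous fun p : ℝ × ℝ => K (mild K p.2 w) :=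
    K.continuous.comp ((continuous_mild K w).comp continuous_snd)
  have h2 : Continuous fun p : ℝ × ℝ => (p.1 - p.2, K (mild K p.2 w)) :=
    (continuous_fst.sub continuous_snd).prodMk h1
  have h3 := (continuous_freeSg L).comp h2
  exact h3

theorem freeSg_neg_prim_sub (hL : 0 < L) {t : ℝ} (ht : 0 ≤ t) (g : L2 ℝ L) :
    freeSg L t (-prim L g) - (-prim L g) = ∫ s in (0 : ℝ)..t, freeSg L s g := by
  rw [← prim_sub_prim_freeSg hL ht, ← freeSg_prim hL ht, map_neg]
  abel

/-- On `-prim L g` the limit is `A y + K y` with `A y = g`: the free part supplies `g`, and the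
Duhamel integral supplies the value of its integrand at time `0`. -/
theorem tendsto_sg_sub (hL : 0 < L) (g : L2 ℝ L) :
    Tendsto (fun h : ℝ => h⁻¹ • (sg K h (-prim L g) - (-prim L g))) (𝓝[>] 0)
      (𝓝 (g + K (-prim L g))) := by
  have h1 := tendsto_inv_smul_strongInt continuous_freeSg_apply g
  have h2 := tendsto_inv_smul_integral
    (f := fun h s => freeSg L (h - s) (K (mild K s (extZ L (-prim L g))))) (continuous_duhamel_mild K (extZ L (-prim L g)))
  rw [sub_zero, freeSg_zero, mild_zero, restr_ext] at h2
  rw [freeSg_zero] at h1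
  refine (h1.add h2).congr' ?_
  filter_upwards [self_mem_nhdsWithin] with h hh
  have hh' : 0 ≤ h := le_of_lt hh
  rw [sg_apply, mild_eq K hh', ← freeSg_apply, add_sub_right_comm, freeSg_neg_prim_sub hL hh',
    ← smul_add]
  rfl

theorem hasDerivWithinAt_sg (hL : 0 < L) (g : L2 ℝ L) {t : ℝ} (ht : 0 ≤ t) :
    HasDerivWithinAt (fun t => sg K t (-prim L g)) (sg K t (g + K (-prim L g))) (Ioi t) t := by
  rw [hasDerivWithinAt_iff_tendsto_slope' self_notMem_Ioi]
  have h := ((sg K t).continuous.tendsto _).comp (tendsto_sg_sub K hL g)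
  have hs := tendsto_sub_nhdsGT t
  refine (h.comp hs).congr' ?_
  filter_upwards [self_mem_nhdsWithin] with s hs
  have hs' : 0 ≤ s - t := sub_nonneg.2 (le_of_lt hs)
  simp only [Function.comp_apply, map_smul, map_sub]
  rw [sg_sg K hs' ht, add_sub_cancel, slope_def_module]

theorem integral_sg (hL : 0 < L) (g : L2 ℝ L) {t : ℝ} (ht : 0 ≤ t) :
    ∫ s in (0 : ℝ)..t, sg K s (g + K (-prim L g)) = sg K t (-prim L g) - (-prim L g) := by
  rw [intervalIntegral.integral_eq_sub_of_hasDeriv_right_of_le ht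
    (continuous_sg K _).continuousOn (fun s hs => hasDerivWithinAt_sg K hL g hs.1.le)
    ((continuous_sg K _).intervalIntegrable _ _), sg_zero]

/-- Right derivative of `prim` of a mild solution at time `0`. -/
theorem tendsto_prim_mild_sub (hL : 0 < L) (v : L2R) {c : ℝ}
    (hc : Tendsto (fun h : ℝ => h⁻¹ * ∫ r in L..L + h, v r) (𝓝[>] 0) (𝓝 c)) :
    Tendsto (fun h : ℝ => h⁻¹ • prim L (mild K h v - restr L v)) (𝓝[>] 0)
      (𝓝 (c • oneL L - restr L v + prim L (K (restr L v)))) := by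
  have h1 : Tendsto (fun h : ℝ => h⁻¹ • ∫ s in (0 : ℝ)..h, restr L (shift s v)) (𝓝[>] 0)
      (𝓝 (restr L (shift 0 v))) :=
    tendsto_inv_smul_integral (f := fun _ s => restr L (shift s v))
      ((continuous_restr_shift v).comp continuous_snd)
  rw [shift_zero] at h1
  have h2 := ((prim L).continuous.tendsto _).comp
    (tendsto_inv_smul_integral
    (f := fun h s => freeSg L (h - s) (K (mild K s v))) (continuous_duhamel_mild K v))
  rw [sub_zero, freeSg_zero, mild_zero] at h2
  refine (((hc.smul_const (oneL L)).sub h1).add h2).congr' ?_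
  filter_upwards [self_mem_nhdsWithin] with h hh
  have hh' : 0 ≤ h := le_of_lt hh
  rw [mild_eq K hh', add_sub_right_comm, map_add, map_sub, prim_restr_shift_sub hL hh',
    Function.comp_apply, map_smul, smul_add, smul_sub, smul_smul]

/-- Restarting at time `t` replaces the state part of the signal but leaves the future control
untouched, so the boundary flux can be read off `w`. -/
theorem intervalIntegral_restart (w : L2R) (y : L2 ℝ L) (t : ℝ) {h : ℝ} (hh : 0 ≤ h) :
    ∫ r in L..L + h, (extZ L y + outer L (shift t w)) r = ∫ r in L + t..L + t + h, w r := by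
  have e : extZ L y + outer L (shift t w) = extZ L (y - restr L (shift t w)) + shift t w := by
    rw [outer_apply, map_sub]
    abel
  rw [e]
  have h1 : ∫ r in L..L + h, (extZ L (y - restr L (shift t w)) + shift t w) r
      = (∫ r in L..L + h, extZ L (y - restr L (shift t w)) r)
        + ∫ r in L..L + h, shift t w r := by
    rw [← intervalIntegral.integral_add (intervalIntegrable_L2R _ _ _)
      (intervalIntegrable_L2R _ _ _)]
    exact intervalIntegral.integral_congr_ae (by
      filter_upwards [Lp.coeFn_add (extZ L (y - restr L (shift t w))) (shift t w)] with r hr _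
      rw [hr, Pi.add_apply])
  have h2 : ∫ r in L..L + h, shift t w r = ∫ r in L..L + h, w (t + r) :=
    intervalIntegral.integral_congr_ae (by
      filter_upwards [coeFn_shift t w] with r hr _ using hr)
  rw [h1, (vanishesOn_ext (y - restr L (shift t w))).intervalIntegral_eq_zero (by linarith)
    (fun r hr h => absurd h.2 (by simpa using hr.1.le)), zero_add, h2,
    intervalIntegral.integral_comp_add_left w t]
  congr 1 <;> ring

/-- Right derivative of a mild solution tested against an element of the domain of the adjoint. -/
theorem tendsto_inner_mild_sub (hL : 0 < L) (w : L2R) {f : ℝ → ℝ} (hf : Continuous f)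
    (hwf : w =ᵐ[volume] f) (g : L2 ℝ L) {t : ℝ} (ht : 0 ≤ t) :
    Tendsto (fun h : ℝ => h⁻¹ * ⟪-primAdj L g, mild K (t + h) w - mild K t w⟫_ℝ) (𝓝[>] 0)
      (𝓝 (⟪g, mild K t w⟫_ℝ + ⟪-primAdj L g, K (mild K t w)⟫_ℝ - f (L + t) * ⟪oneL L, g⟫_ℝ)) := by
  -- By `mild_add` the solution restarts at time `t` from `v`, so only the right derivative at time
  -- `0` is needed. With a nonzero boundary value the state lies outside the generator's domain,
  -- whence the derivative is taken after applying `prim L`.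
  set v := extZ L (mild K t w) + outer L (shift t w) with hv
  have hrv : restr L v = mild K t w := by rw [hv, map_add, restr_ext, restr_outer, add_zero]
  have hc : Tendsto (fun h : ℝ => h⁻¹ * ∫ r in L..L + h, v r) (𝓝[>] 0) (𝓝 (f (L + t))) := by
    have hd : HasDerivAt (fun x => ∫ r in L + t..x, f r) (f (L + t)) (L + t) :=
      intervalIntegral.integral_hasDerivAt_right (hf.intervalIntegrable _ _)
        (hf.stronglyMeasurableAtFilter _ _) hf.continuousAt
    refine hd.tendsto_slope_zero_right.congr' ?_
    filter_upwards [self_mem_nhdsWithin] with h hh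
    rw [intervalIntegral.integral_same, sub_zero, smul_eq_mul, hv,
      intervalIntegral_restart w _ t (le_of_lt hh)]
    congr 1
    exact intervalIntegral.integral_congr_ae (by filter_upwards [hwf] with r hr _ using hr.symm)
  have h1 := ((innerSL ℝ g).continuous.tendsto _).comp (tendsto_prim_mild_sub K hL v hc)
  have h2 := h1.neg
  rw [hrv] at h2
  simp only [innerSL_apply_apply, inner_add_right, inner_sub_right, real_inner_smul_right] at h2
  have e1 (x : L2 ℝ L) : ⟪g, prim L x⟫_ℝ = ⟪primAdj L g, x⟫_ℝ := by
    rw [real_inner_comm, inner_prim, real_inner_comm]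
  have e : ⟪g, mild K t w⟫_ℝ + ⟪-primAdj L g, K (mild K t w)⟫_ℝ - f (L + t) * ⟪oneL L, g⟫_ℝ
      = -(f (L + t) * ⟪g, oneL L⟫_ℝ - ⟪g, mild K t w⟫_ℝ + ⟪g, prim L (K (mild K t w))⟫_ℝ) := by
    rw [e1, inner_neg_left, real_inner_comm g (oneL L)]
    ring
  rw [e]
  refine h2.congr' ?_
  filter_upwards [self_mem_nhdsWithin] with h hh
  simp only [Function.comp_apply, innerSL_apply_apply]
  rw [real_inner_smul_right, e1, inner_neg_left, add_comm t h,
    mild_add K ht (le_of_lt hh)]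
  ring

end Mild

/-! ### The adjoint operator and the duality identity. -/

section Adjoint

variable {k : ℝ × ℝ → ℝ} (hk : MemLp k 2 ((μI L).prod (μI L)))

theorem generator_apply (y : (generator ℝ k hk).domain) :
    generator ℝ k hk y = weakDeriv ℝ L y + integralOperator ℝ k hk y := rfl

theorem generator_neg_prim (hL : 0 < L) (g : L2 ℝ L) :
    generator ℝ k hk ⟨-prim L g, neg_prim_mem_generatorDomain hL g⟩
      = g + integralOperator ℝ k hk (-prim L g) := by
  rw [generator_apply]
  congr 1
  exact weakDeriv_neg_prim hL g

theorem inner_adjoint_apply (hL : 0 < L) (z : (generator ℝ k hk)†.domain)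
    (y : (generator ℝ k hk).domain) :
    ⟪(generator ℝ k hk)† z, (y : L2 ℝ L)⟫_ℝ = ⟪(z : L2 ℝ L), generator ℝ k hk y⟫_ℝ := by
  have hd : Dense ((generator ℝ k hk).domain : Set (L2 ℝ L)) := dense_generatorDomain hL
  have h := LinearPMap.adjoint_isFormalAdjoint hd
  exact h z y

/-- The free part `A* z - K* z = -z_x` of the adjoint. -/
def adjointFree (z : (generator ℝ k hk)†.domain) : L2 ℝ L :=
  (generator ℝ k hk)† z - ContinuousLinearMap.adjoint (integralOperator ℝ k hk) (z : L2 ℝ L)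

/-- Testing the adjoint relation on `-prim L h` for all `h` identifies `z`. Hence `z` is a primitive
vanishing at `0`, which gives it a continuous representative. -/
theorem adjoint_domain_eq (hL : 0 < L) (z : (generator ℝ k hk)†.domain) :
    (z : L2 ℝ L) = -primAdj L (adjointFree hk z) := by
  refine ext_inner_right ℝ fun h => ?_
  have h1 := inner_adjoint_apply hk hL z ⟨-prim L h, neg_prim_mem_generatorDomain hL h⟩
  rw [generator_neg_prim hk hL, inner_add_right] at h1
  simp only [map_neg, inner_neg_right] at h1
  rw [inner_neg_left, real_inner_comm h (primAdj L _), ← inner_prim, real_inner_comm, adjointFree,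
    inner_sub_right, ContinuousLinearMap.adjoint_inner_right, real_inner_comm _ (prim L h),
    real_inner_comm (z : L2 ℝ L) (integralOperator ℝ k hk _), real_inner_comm (z : L2 ℝ L) h]
  linarith

/-- The trace at `L` is the integral of the derivative over `(0, L)`, hence continuous in the graph
norm of the adjoint. -/
theorem controlAdjoint_eq (hL : 0 < L) (z : (generator ℝ k hk)†.domain) :
    controlAdjoint ℝ k hk z = -⟪oneL L, adjointFree hk z⟫_ℝ := by
  refine HasTrace.trace_eq hL (right_mem_Icc.2 hL.le) ?_
  have h := (hasTrace_primAdj hL (adjointFree hk z)).smul (-1)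
  rw [neg_one_smul, neg_one_mul, ← adjoint_domain_eq hk hL z] at h
  exact h

theorem IsAdjointSolution.continuousOn_coe {τ : ℝ} {z : ℝ → (generator ℝ k hk)†.domain}
    (hz : IsAdjointSolution (generator ℝ k hk) τ z) :
    ContinuousOn (fun t => (z t : L2 ℝ L)) (Icc 0 τ) :=
  fun t ht => (hz.1 t ht).continuousWithinAt

theorem IsAdjointSolution.continuousOn_controlAdjoint (hL : 0 < L) {τ : ℝ}
    {z : ℝ → (generator ℝ k hk)†.domain} (hz : IsAdjointSolution (generator ℝ k hk) τ z) :
    ContinuousOn (fun t => controlAdjoint ℝ k hk (z t)) (Icc 0 τ) := by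
  simp only [controlAdjoint_eq hk hL]
  refine ((innerSL ℝ (oneL L)).continuous.comp_continuousOn ?_).neg
  exact hz.2.sub ((ContinuousLinearMap.adjoint (integralOperator ℝ k hk)).continuous.comp_continuousOn
    (IsAdjointSolution.continuousOn_coe hk hz))

/-- Differentiate `⟪z t, y t⟫` from the right: the terms with the adjoint operator cancel and only
the boundary term is left. Continuity of `f` gives the control a value at each time. -/
theorem inner_mild_sub_of_continuous (hL : 0 < L) {τ : ℝ} (hτ : 0 ≤ τ)
    {z : ℝ → (generator ℝ k hk)†.domain} (hz : IsAdjointSolution (generator ℝ k hk) τ z)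
    (w : L2R) {f : ℝ → ℝ} (hf : Continuous f) (hwf : w =ᵐ[volume] f) :
    ⟪(z τ : L2 ℝ L), mild (integralOperator ℝ k hk) τ w⟫_ℝ - ⟪(z 0 : L2 ℝ L), restr L w⟫_ℝ
      = ∫ t in (0 : ℝ)..τ, f (L + t) * controlAdjoint ℝ k hk (z t) := by
  set K := integralOperator ℝ k hk
  have hzc := IsAdjointSolution.continuousOn_coe hk hz
  have hcont : ContinuousOn (fun t => ⟪(z t : L2 ℝ L), mild K t w⟫_ℝ) (Icc 0 τ) :=
    hzc.inner (𝕜 := ℝ) (continuous_mild K w).continuousOn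
  have hcc : ContinuousOn (fun t => f (L + t) * controlAdjoint ℝ k hk (z t)) (Icc 0 τ) :=
    (hf.comp (continuous_const_add L)).continuousOn.mul
      (IsAdjointSolution.continuousOn_controlAdjoint hk hL hz)
  rw [intervalIntegral.integral_eq_sub_of_hasDeriv_right_of_le hτ hcont (fun t ht => ?_)
    (by rw [← uIcc_of_le hτ] at hcc; exact hcc.intervalIntegrable), mild_zero]
  rw [hasDerivWithinAt_iff_tendsto_slope' self_notMem_Ioi]
  have hmem : Icc 0 τ ∈ 𝓝[>] t :=
    mem_nhdsWithin_of_mem_nhds (Icc_mem_nhds ht.1 ht.2)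
  have hzd := (hz.1 t (Ioo_subset_Icc_self ht)).mono_of_mem_nhdsWithin hmem
  rw [hasDerivWithinAt_iff_tendsto_slope' self_notMem_Ioi] at hzd
  have h1 : Tendsto (fun s => ⟪slope (fun s => (z s : L2 ℝ L)) t s, mild K s w⟫_ℝ) (𝓝[>] t)
      (𝓝 ⟪-((generator ℝ k hk)† (z t)), mild K t w⟫_ℝ) :=
    hzd.inner (((continuous_mild K w).tendsto t).mono_left nhdsWithin_le_nhds)
  have hs := tendsto_sub_nhdsGT t
  have h2 := (tendsto_inner_mild_sub K hL w hf hwf (adjointFree hk (z t)) ht.1.le).comp hs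
  rw [← adjoint_domain_eq hk hL] at h2
  have h3 := h1.add h2
  have e : ⟪-((generator ℝ k hk)† (z t)), mild K t w⟫_ℝ
      + (⟪adjointFree hk (z t), mild K t w⟫_ℝ + ⟪(z t : L2 ℝ L), K (mild K t w)⟫_ℝ
        - f (L + t) * ⟪oneL L, adjointFree hk (z t)⟫_ℝ)
      = f (L + t) * controlAdjoint ℝ k hk (z t) := by
    rw [controlAdjoint_eq hk hL, adjointFree, inner_neg_left, inner_sub_left,
      ContinuousLinearMap.adjoint_inner_left]
    ring
  rw [e] at h3
  refine h3.congr' ?_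
  filter_upwards [self_mem_nhdsWithin] with s hs
  simp only [Function.comp_apply, slope_def_module, add_sub_cancel,
    real_inner_smul_left, inner_sub_left, inner_sub_right]
  ring

/-- Mild solutions are solutions by transposition. -/
theorem inner_mild_sub (hL : 0 < L) {τ : ℝ} (hτ : 0 ≤ τ)
    {z : ℝ → (generator ℝ k hk)†.domain} (hz : IsAdjointSolution (generator ℝ k hk) τ z)
    (w : L2R) :
    ⟪(z τ : L2 ℝ L), mild (integralOperator ℝ k hk) τ w⟫_ℝ - ⟪(z 0 : L2 ℝ L), restr L w⟫_ℝ
      = ∫ t in (0 : ℝ)..τ, w (L + t) * controlAdjoint ℝ k hk (z t) := by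
  set K := integralOperator ℝ k hk
  set c : ℝ → ℝ := fun t => controlAdjoint ℝ k hk (z t)
  have hc : ContinuousOn c (Icc 0 τ) := IsAdjointSolution.continuousOn_controlAdjoint hk hL hz
  have hcm : MemLp ((Icc 0 τ).indicator c) 2 volume := by
    rw [memLp_indicator_iff_restrict measurableSet_Icc]
    obtain ⟨C, hC⟩ := isCompact_Icc.exists_bound_of_continuousOn hc
    refine MemLp.of_bound (hc.aestronglyMeasurable measurableSet_Icc) C ?_
    filter_upwards [ae_restrict_mem measurableSet_Icc] with t ht using hC t ht
  have hR (w : L2R) : ∫ t in (0 : ℝ)..τ, w (L + t) * c t = ⟪hcm.toLp _, shift L w⟫_ℝ := by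
    rw [L2.inner_def, intervalIntegral.integral_of_le hτ, ← integral_Icc_eq_integral_Ioc,
      ← integral_indicator measurableSet_Icc]
    refine integral_congr_ae ?_
    filter_upwards [hcm.coeFn_toLp, coeFn_shift L w] with t h1 h2
    rw [h1, h2]
    by_cases h : t ∈ Icc 0 τ <;> simp [h]
  rw [hR]
  -- Both sides are continuous in `w` for the `L²` norm, so smooth signals suffice.
  have hdense := Lp.dense_hasCompactSupport_contDiff (E := ℝ) (F := ℝ) (μ := volume) (p := 2)
    (by norm_num)
  refine congrFun (Continuous.ext_on hdense (f := fun w : L2R => ⟪(z τ : L2 ℝ L), mild K τ w⟫_ℝ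
    - ⟪(z 0 : L2 ℝ L), restr L w⟫_ℝ) (g := fun w : L2R => ⟪hcm.toLp _, shift L w⟫_ℝ)
    ?_ ?_ ?_) w
  · exact ((innerSL ℝ (z τ : L2 ℝ L)).continuous.comp (mild K τ).continuous).sub
      ((innerSL ℝ (z 0 : L2 ℝ L)).continuous.comp (restr L).continuous)
  · exact (innerSL ℝ (hcm.toLp _)).continuous.comp (shift L).continuous
  · rintro w ⟨f, hwf, -, hf⟩
    simp only
    rw [← hR, inner_mild_sub_of_continuous hk hL hτ hz w hf.continuous hwf]
    refine intervalIntegral.integral_congr_ae ?_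
    filter_upwards [(measurePreserving_add_left volume L).quasiMeasurePreserving.ae hwf] with t h1 _
    rw [h1]

end Adjoint

end

noncomputable section

variable {L : ℝ}

/-! ### Enough classical adjoint solutions to determine a state. -/

section SgInt

variable (K : L2 ℝ L →L[ℝ] L2 ℝ L)

/-- The integrated semigroup `∫₀ᵗ S(s) ds`. -/
def sgInt (t : ℝ) : L2 ℝ L →L[ℝ] L2 ℝ L := strongInt (sg K) (continuous_sg K) t

theorem sgInt_apply (t : ℝ) (y : L2 ℝ L) : sgInt K t y = ∫ s in (0 : ℝ)..t, sg K s y := rfl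

theorem continuous_sgInt : Continuous (sgInt K) := continuous_strongInt (continuous_sg K)

theorem sgInt_sub_apply (a b : ℝ) (y : L2 ℝ L) :
    sgInt K b y - sgInt K a y = ∫ s in a..b, sg K s y :=
  strongInt_sub_apply (continuous_sg K) a b y

theorem sgInt_sg {t ε : ℝ} (ht : 0 ≤ t) (hε : 0 ≤ ε) (y : L2 ℝ L) :
    sgInt K ε (sg K t y) = sgInt K (t + ε) y - sgInt K t y := by
  rw [sgInt_sub_apply, sgInt_apply]
  have h := intervalIntegral.integral_comp_add_right (a := 0) (b := ε) (fun s => sg K s y) t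
  rw [zero_add, add_comm ε t] at h
  rw [← h]
  refine intervalIntegral.integral_congr fun s hs => ?_
  rw [uIcc_of_le hε] at hs
  exact sg_sg K ht hs.1 y

theorem eq_zero_of_sgInt_eq_zero {d : L2 ℝ L} (h : ∀ ε > 0, sgInt K ε d = 0) : d = 0 := by
  have h1 := tendsto_inv_smul_strongInt (continuous_sg K) d
  rw [sg_zero] at h1
  refine tendsto_nhds_unique h1 (tendsto_const_nhds.congr' ?_)
  filter_upwards [self_mem_nhdsWithin] with ε hε
  have h2 : strongInt (sg K) (continuous_sg K) ε d = 0 := h ε hε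
  rw [h2, smul_zero]

end SgInt

section Uniqueness

variable {k : ℝ × ℝ → ℝ} (hk : MemLp k 2 ((μI L).prod (μI L)))

theorem integral_sg_generator (hL : 0 < L) (y : (generator ℝ k hk).domain) {a b : ℝ} (ha : 0 ≤ a)
    (hab : a ≤ b) : ∫ s in a..b, sg (integralOperator ℝ k hk) s (generator ℝ k hk y)
      = sg (integralOperator ℝ k hk) b y - sg (integralOperator ℝ k hk) a y := by
  set K := integralOperator ℝ k hk
  have hy : (y : L2 ℝ L) = -prim L (weakDeriv ℝ L y) := eq_neg_prim_of_mem hL y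
  have hg : generator ℝ k hk y
      = weakDeriv ℝ L y + K (-prim L (weakDeriv ℝ L y)) := by
    rw [generator_apply, ← hy]
  rw [← sgInt_sub_apply, sgInt_apply, sgInt_apply, hg, integral_sg K hL _ (ha.trans hab),
    integral_sg K hL _ ha, ← hy]
  abel

/-- Smoothed orbits of the adjoint semigroup are classical solutions of the adjoint equation. -/
theorem exists_isAdjointSolution (hL : 0 < L) {T ε ε' : ℝ} (hε : 0 ≤ ε)
    (hε' : 0 ≤ ε') (z₁ : L2 ℝ L) :
    ∃ z : ℝ → (generator ℝ k hk)†.domain, IsAdjointSolution (generator ℝ k hk) T z ∧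
      ∀ d, ⟪(z T : L2 ℝ L), d⟫_ℝ = ⟪z₁, sgInt (integralOperator ℝ k hk) ε
        (sgInt (integralOperator ℝ k hk) ε' d)⟫_ℝ := by
  set K := integralOperator ℝ k hk
  -- For `r ≥ 0` this is `sgInt K ε ∘ sg K r`. As a difference of integrals it is continuous in
  -- operator norm, hence so is its adjoint. The second average, over a window of length `ε'`, will
  -- put `z` in the domain of the adjoint.
  set P : ℝ → L2 ℝ L →L[ℝ] L2 ℝ L := fun r => sgInt K (r + ε) - sgInt K r with hPdef
  have hPc : Continuous P :=
    ((continuous_sgInt K).comp (continuous_add_const ε)).sub (continuous_sgInt K)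
  have hP : ∀ r, 0 ≤ r → ∀ y, P r y = sgInt K ε (sg K r y) := fun r hr y =>
    (sgInt_sg K hr hε y).symm
  set m : ℝ → L2 ℝ L := fun r => ContinuousLinearMap.adjoint (P r) z₁ with hmdef
  have hm : Continuous m :=
    ((ContinuousLinearMap.adjoint (𝕜 := ℝ)).continuous.comp hPc).clm_apply continuous_const
  have hinner (a b : ℝ) (y : L2 ℝ L) :
      ⟪∫ r in a..b, m r, y⟫_ℝ = ∫ r in a..b, ⟪z₁, P r y⟫_ℝ := by
    rw [real_inner_comm]
    refine ((innerSL ℝ y).intervalIntegral_comp_comm (hm.intervalIntegrable a b)).symm.trans ?_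
    refine intervalIntegral.integral_congr fun r _ => ?_
    simp only [innerSL_apply_apply]
    rw [real_inner_comm, hmdef, ContinuousLinearMap.adjoint_inner_left]
  have hint (a b : ℝ) (ha : 0 ≤ a) (hab : a ≤ b) (y : L2 ℝ L) :
      ⟪∫ r in a..b, m r, y⟫_ℝ = ⟪z₁, sgInt K ε (∫ r in a..b, sg K r y)⟫_ℝ := by
    rw [hinner]
    have h1 := ((innerSL ℝ z₁) ∘L sgInt K ε).intervalIntegral_comp_comm
      ((continuous_sg K y).intervalIntegrable (μ := volume) a b)
    refine Eq.trans ?_ h1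
    refine intervalIntegral.integral_congr fun r hr => ?_
    rw [uIcc_of_le hab] at hr
    rw [hP r (ha.trans hr.1)]
    rfl
  have hdom (a b : ℝ) (ha : 0 ≤ a) (hab : a ≤ b) (y : (generator ℝ k hk).domain) :
      ⟪m b - m a, (y : L2 ℝ L)⟫_ℝ = ⟪∫ r in a..b, m r, generator ℝ k hk y⟫_ℝ := by
    rw [hint a b ha hab, integral_sg_generator hk hL y ha hab, inner_sub_left, hmdef]
    simp only
    rw [ContinuousLinearMap.adjoint_inner_left, ContinuousLinearMap.adjoint_inner_left,
      hP a ha, hP b (ha.trans hab), map_sub, inner_sub_right]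
  have hd : Dense ((generator ℝ k hk).domain : Set (L2 ℝ L)) := dense_generatorDomain hL
  have hmem (t : ℝ) (ht : t ≤ T) :
      ∫ r in T - t..T - t + ε', m r ∈ (generator ℝ k hk)†.domain :=
    LinearPMap.mem_adjoint_domain_of_exists _
      ⟨_, hdom (T - t) (T - t + ε') (sub_nonneg.2 ht) (by linarith)⟩
  classical
  set z : ℝ → (generator ℝ k hk)†.domain := fun t => if h : t ≤ T then ⟨_, hmem t h⟩ else 0
  have hz (t : ℝ) (ht : t ≤ T) : (z t : L2 ℝ L) = ∫ r in T - t..T - t + ε', m r := by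
    simp only [z, dif_pos ht]
  have hAz (t : ℝ) (ht : t ≤ T) : (generator ℝ k hk)† (z t) = m (T - t + ε') - m (T - t) :=
    LinearPMap.adjoint_apply_eq hd (z t) fun y => by
      rw [hz t ht]
      exact hdom (T - t) (T - t + ε') (sub_nonneg.2 ht) (by linarith) y
  refine ⟨z, ⟨fun t ht => ?_, ?_⟩, fun d => ?_⟩
  · rw [hAz t ht.2]
    set N : ℝ → L2 ℝ L := fun x => ∫ r in (0 : ℝ)..x, m r
    have hN (x : ℝ) : HasDerivAt N (m x) x :=
      intervalIntegral.integral_hasDerivAt_right (hm.intervalIntegrable _ _)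
        (hm.stronglyMeasurableAtFilter _ _) hm.continuousAt
    have h1 : HasDerivAt (fun t => T - t) (-1) t := (hasDerivAt_id t).const_sub T
    have h2 : HasDerivAt (fun t => N (T - t + ε') - N (T - t))
        (-(m (T - t + ε') - m (T - t))) t := by
      have h3 := (hN (T - t + ε')).scomp t (h1.add_const ε')
      have h4 := (hN (T - t)).scomp t h1
      convert! h3.sub h4 using 1
      module
    refine h2.hasDerivWithinAt.congr (fun s hs => ?_) ?_
    · rw [hz s hs.2, intervalIntegral.integral_interval_sub_left] <;>
        exact hm.intervalIntegrable _ _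
    · rw [hz t ht.2, intervalIntegral.integral_interval_sub_left] <;>
        exact hm.intervalIntegrable _ _
  · refine ContinuousOn.congr (f := fun t => m (T - t + ε') - m (T - t))
      (Continuous.continuousOn (by fun_prop)) fun t ht => hAz t ht.2
  · rw [hz T le_rfl, sub_self, zero_add, hint 0 ε' le_rfl hε']
    rfl

/-- The final data of classical adjoint solutions are total. -/
theorem eq_zero_of_forall_isAdjointSolution (hL : 0 < L) {T : ℝ} {d : L2 ℝ L}
    (h : ∀ z : ℝ → (generator ℝ k hk)†.domain, IsAdjointSolution (generator ℝ k hk) T z →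
      ⟪(z T : L2 ℝ L), d⟫_ℝ = 0) : d = 0 := by
  refine eq_zero_of_sgInt_eq_zero (integralOperator ℝ k hk) fun ε' hε' =>
    eq_zero_of_sgInt_eq_zero (integralOperator ℝ k hk) fun ε hε => ?_
  refine ext_inner_left ℝ fun z₁ => ?_
  obtain ⟨z, hz, hzd⟩ := exists_isAdjointSolution hk hL (le_of_lt hε) (le_of_lt hε') z₁
  rw [← hzd, h z hz, inner_zero_right]

theorem memLp_comp_add (w : L2R) (T : ℝ) :
    MemLp (fun t => w (L + t)) 2 (volume.restrict (Ioo 0 T)) :=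
  ((Lp.memLp w).comp_measurePreserving (measurePreserving_add_left volume L)).restrict _

theorem isTranspositionSolution_mild (hL : 0 < L) (T : ℝ) (w : L2R) :
    IsTranspositionSolution (generator ℝ k hk) (controlAdjoint ℝ k hk) T (restr L w)
      (fun t => w (L + t)) (fun t => mild (integralOperator ℝ k hk) t w) := by
  refine ⟨(continuous_mild _ w).continuousOn, fun τ hτ z hz => ?_⟩
  rw [inner_mild_sub hk hL hτ.1 hz w]
  rfl

/-- Solutions by transposition are mild solutions. -/
theorem IsTranspositionSolution.exists_eq_mild (hL : 0 < L) {T : ℝ} (hT : 0 ≤ T) {y₀ : L2 ℝ L}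
    {u : ℝ → ℝ} (hu : MemLp u 2 (volume.restrict (Ioo 0 T))) {y : ℝ → L2 ℝ L}
    (hy : IsTranspositionSolution (generator ℝ k hk) (controlAdjoint ℝ k hk) T y₀ u y) :
    ∃ w : L2R, VanishesOn w (Iio L) ∧
      y T = mild (integralOperator ℝ k hk) T (extZ L y₀ + w) := by
  have hu' := (memLp_indicator_iff_restrict measurableSet_Ioo).2 hu
  set v : L2R := hu'.toLp _
  have hv : v =ᵐ[volume] (Ioo 0 T).indicator u := hu'.coeFn_toLp
  -- The control is placed to the right of `L`, so that `w (L + t) = u t` on `(0, T)`.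
  set w := shift (-L) v
  have hw : VanishesOn w (Iio L) := by
    have : VanishesOn v (Ioo 0 T)ᶜ := by
      filter_upwards [hv] with x hx hx'
      rw [hx, indicator_of_notMem hx']
    refine (this.shift (-L)).mono fun x hx h => ?_
    have := mem_Iio.1 hx
    linarith [h.1]
  refine ⟨w, hw, sub_eq_zero.1 (eq_zero_of_forall_isAdjointSolution hk hL (T := T) fun z hz => ?_)⟩
  have h1 := hy.2 T ⟨hT, le_rfl⟩ z hz
  have h2 := inner_mild_sub hk hL hT hz (extZ L y₀ + w)
  have hr : restr L w = 0 := hw.restr_eq_zero fun x hx => hx.2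
  rw [map_add (restr L), restr_ext, hr, add_zero] at h2
  have h3 : ∫ t in (0 : ℝ)..T, (extZ L y₀ + w) (L + t) * controlAdjoint ℝ k hk (z t)
      = ∫ t in (0 : ℝ)..T, inner ℝ (controlAdjoint ℝ k hk (z t)) (u t) := by
    rw [intervalIntegral.integral_of_le hT, intervalIntegral.integral_of_le hT,
      integral_Ioc_eq_integral_Ioo, integral_Ioc_eq_integral_Ioo]
    refine setIntegral_congr_ae measurableSet_Ioo ?_
    have qm := (measurePreserving_add_left volume L).quasiMeasurePreserving
    filter_upwards [qm.ae (Lp.coeFn_add (extZ L y₀) w), qm.ae (vanishesOn_ext y₀),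
      qm.ae (coeFn_shift (-L) v), hv] with t e1 e2 e3 e4 ht
    rw [e1, Pi.add_apply, e2 (fun h => by linarith [h.2, ht.1]), e3, neg_add_cancel_left, e4,
      indicator_of_mem ht, zero_add]
    rfl
  rw [h3, ← h1] at h2
  rw [inner_sub_right]
  linarith

end Uniqueness

end

noncomputable section

variable {L : ℝ}

/-! ### The reachable subspace. -/

section Reach

variable (K : L2 ℝ L →L[ℝ] L2 ℝ L)

variable (L) in
/-- Signals that carry a control only. -/
def controlSignals : Submodule ℝ L2R where
  carrier := {w | VanishesOn w (Iio L)}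
  zero_mem' := vanishesOn_zero _
  add_mem' hv hw := hv.add hw
  smul_mem' a _ hw := hw.smul a

/-- The states that can be reached from `0` in time `t`. -/
def reach (t : ℝ) : Submodule ℝ (L2 ℝ L) :=
  (controlSignals L).map (mild K t : L2R →ₗ[ℝ] L2 ℝ L)

theorem mild_mem_reach {t : ℝ} {w : L2R} (hw : VanishesOn w (Iio L)) : mild K t w ∈ reach K t :=
  ⟨w, hw, rfl⟩

/-- Starting from rest, wait for a time `t - s` with zero control and then apply the old control. -/
theorem reach_mono {s t : ℝ} (hs : 0 ≤ s) (hst : s ≤ t) : reach K s ≤ reach K t := by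
  rintro _ ⟨w, hw, rfl⟩
  have hw' : VanishesOn w (Iio L) := hw
  set r := t - s
  have hr : 0 ≤ r := sub_nonneg.2 hst
  have hv := hw'.shift (-r)
  have e : mild K (s + r) (shift (-r) w) = mild K s w := by
    rw [mild_add K hr hs, mild_eq_zero_of_vanishesOn K hr hv, map_zero, zero_add, shift_shift,
      add_neg_cancel, shift_zero, outer_eq_self (hw'.restr_eq_zero fun x hx => hx.2)]
    intro x hx
    change -r + x < L
    linarith [hx.2]
  have h := mild_mem_reach K (t := s + r) (w := shift (-r) w) (hv.mono fun x hx => by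
    change -r + x < L
    linarith [mem_Iio.1 hx])
  rw [e] at h
  change mild K s w ∈ reach K t
  rwa [show s + r = t from add_sub_cancel s t] at h

/-- Switch the control off at time `t`: the semigroup then moves the reached state for a further
time `s`. Cutting the signal at `L + t` does not affect the state at time `t`. -/
theorem sg_mem_reach {s t : ℝ} (hs : 0 ≤ s) (ht : 0 ≤ t) {y : L2 ℝ L} (hy : y ∈ reach K t) :
    sg K s y ∈ reach K (s + t) := by
  obtain ⟨w, hw, rfl⟩ := hy
  have hw' : VanishesOn w (Iio L) := hw
  set w₁ := cut (Iio (L + t)) measurableSet_Iio w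
  have e : mild K t w = mild K t w₁ := by
    rw [← sub_eq_zero, ← map_sub]
    refine mild_eq_zero_of_vanishesOn K ht (vanishesOn_sub_cut measurableSet_Iio w) fun x hx => ?_
    change x < L + t
    linarith [hx.2]
  change sg K s (mild K t w) ∈ _
  rw [e, sg_mild K ht hs ((vanishesOn_cut measurableSet_Iio w).mono fun x hx => ?_)]
  · exact mild_mem_reach K (hw'.cut measurableSet_Iio)
  · simpa using hx

/-- The signal places `x` on `(T, T + L)`, so its free final state is `x` and only the Duhamel
integral remains. Its integrand lies in multiples of the compact set of all `freeSg L r (K y)` with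
`r ∈ [0, T]` and `‖y‖ ≤ 1`, which is nearly finite-dimensional. -/
theorem exists_finiteDimensional_duhamel (hK : IsCompactOperator K) {T : ℝ} (hT : 0 ≤ T) :
    ∃ V : Submodule ℝ (L2 ℝ L), ∃ _ : FiniteDimensional ℝ V, ∀ x : L2 ℝ L,
      ‖(mild K T (shift (-T) (extZ L x)) - x) -
        V.starProjection (mild K T (shift (-T) (extZ L x)) - x)‖ ≤ 1 / 2 * ‖x‖ := by
  obtain ⟨M, hM, hMle⟩ := exists_norm_mild_le K T
  set Ω : Set (L2 ℝ L) := (fun p : ℝ × L2 ℝ L => freeSg L p.1 p.2) ''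
    (Icc 0 T ×ˢ closure (K '' Metric.closedBall 0 1))
  have hΩ : TotallyBounded Ω := by
    refine IsCompact.totallyBounded (IsCompact.image ?_ (continuous_freeSg L))
    exact isCompact_Icc.prod (IsCompactOperator.isCompact_closure_image_closedBall
      (f := (K : L2 ℝ L →ₗ[ℝ] L2 ℝ L)) hK 1)
  -- Integrating `δ * M * ‖x‖` over `(0, T)` must give at most `‖x‖ / 2`; `T + 1` in place of `T`
  -- also covers `T = 0`.
  set δ : ℝ := 1 / (2 * (T + 1) * M)
  have hδ : 0 < δ := by positivity
  obtain ⟨V, hV, hVΩ⟩ := hΩ.exists_finiteDimensional_norm_sub_starProjection_le hδ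
  refine ⟨V, hV, fun x => ?_⟩
  set Q : L2 ℝ L →L[ℝ] L2 ℝ L := ContinuousLinearMap.id ℝ _ - V.starProjection
  have hQ (r : ℝ) (hr : r ∈ Icc 0 T) (y : L2 ℝ L) : ‖Q (freeSg L r (K y))‖ ≤ δ * ‖y‖ := by
    have h : ‖Q ∘L freeSg L r ∘L K‖ ≤ δ := by
      refine ContinuousLinearMap.opNorm_le_of_unit_norm hδ.le fun v hv => ?_
      exact hVΩ _ ⟨(r, K v), ⟨hr, subset_closure ⟨v, by simp [hv], rfl⟩⟩, rfl⟩
    exact (Q ∘L freeSg L r ∘L K).le_of_opNorm_le h y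
  set w := shift (-T) (extZ L x)
  have hw : ‖w‖ ≤ ‖x‖ := (norm_shift_apply _ _).le.trans (norm_ext_le L x)
  have e : mild K T w - x = ∫ s in (0 : ℝ)..T, freeSg L (T - s) (K (mild K s w)) := by
    rw [mild_eq K hT, shift_shift, add_neg_cancel, shift_zero, restr_ext, add_sub_cancel_left]
  change ‖Q (mild K T w - x)‖ ≤ _
  rw [e, ← ContinuousLinearMap.intervalIntegral_comp_comm _
    ((continuous_freeSg_sub K (continuous_mild K w) T).intervalIntegrable _ _)]
  refine (intervalIntegral.norm_integral_le_of_norm_le_const (C := δ * (M * ‖x‖))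
    fun s hs => ?_).trans ?_
  · rw [uIoc_of_le hT] at hs
    refine (hQ (T - s) ⟨by linarith [hs.2], by linarith [hs.1]⟩ _).trans ?_
    gcongr
    refine (hMle s hs.2 w).trans ?_
    gcongr
  · rw [sub_zero, abs_of_nonneg hT]
    have h1 : δ * (M * ‖x‖) * T = T / (T + 1) * (1 / 2 * ‖x‖) := by
      simp only [δ]
      field_simp
    rw [h1]
    have h2 : T / (T + 1) ≤ 1 := (div_le_one (by linarith)).2 (by linarith)
    exact mul_le_of_le_one_left (by positivity) h2

/-- `T ≥ L` is what makes the signal carrying `x` on `(T, T + L)` a pure control, with nothing to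
the left of `L`. -/
theorem reach_isClosed_and_finiteDimensional (hK : IsCompactOperator K) (hL : 0 < L) {T : ℝ}
    (hT : L ≤ T) :
    IsClosed (reach K T : Set (L2 ℝ L)) ∧ FiniteDimensional ℝ (reach K T)ᗮ := by
  obtain ⟨V, hV, h⟩ := exists_finiteDimensional_duhamel K hK (hL.le.trans hT)
  set C : L2 ℝ L →L[ℝ] L2 ℝ L :=
    mild K T ∘L (shift (-T) ∘L extZ L) - ContinuousLinearMap.id ℝ (L2 ℝ L)
  have hC (x : L2 ℝ L) : C x = mild K T (shift (-T) (extZ L x)) - x := rfl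
  refine Submodule.isClosed_and_finiteDimensional_orthogonal_of_id_add C V
    (fun x => by rw [hC]; exact h x) fun x => ?_
  have e : x + C x = mild K T (shift (-T) (extZ L x)) := by rw [hC, add_sub_cancel]
  rw [e]
  refine mild_mem_reach K (((vanishesOn_ext x).shift (-T)).mono fun r hr h => ?_)
  have := mem_Iio.1 hr
  linarith [h.1]

end Reach

/-! ### Controllability in terms of the reachable subspace. -/

section Controllability

variable {k : ℝ × ℝ → ℝ} (hk : MemLp k 2 ((μI L).prod (μI L)))

theorem exists_control_of_mem_reach (hL : 0 < L) (T : ℝ) {y₀ y₁ : L2 ℝ L}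
    (h : y₁ - sg (integralOperator ℝ k hk) T y₀ ∈ reach (integralOperator ℝ k hk) T) :
    ∃ u : ℝ → ℝ, MemLp u 2 (volume.restrict (Ioo 0 T)) ∧ ∃ y : ℝ → L2 ℝ L,
      IsTranspositionSolution (generator ℝ k hk) (controlAdjoint ℝ k hk) T y₀ u y ∧ y T = y₁ := by
  obtain ⟨w, hw, hwy⟩ := h
  have hw' : VanishesOn w (Iio L) := hw
  have h1 := isTranspositionSolution_mild hk hL T (extZ L y₀ + w)
  rw [map_add, restr_ext, hw'.restr_eq_zero fun x hx => hx.2, add_zero] at h1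
  refine ⟨_, memLp_comp_add _ T, _, h1, ?_⟩
  have h2 : mild (integralOperator ℝ k hk) T w = y₁ - sg (integralOperator ℝ k hk) T y₀ := hwy
  rw [map_add, h2, ← sg_apply, add_sub_cancel]

theorem mem_reach_of_isTranspositionSolution (hL : 0 < L) {T : ℝ} (hT : 0 ≤ T) {u : ℝ → ℝ}
    (hu : MemLp u 2 (volume.restrict (Ioo 0 T))) {y : ℝ → L2 ℝ L}
    (hy : IsTranspositionSolution (generator ℝ k hk) (controlAdjoint ℝ k hk) T 0 u y) :
    y T ∈ reach (integralOperator ℝ k hk) T := by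
  obtain ⟨w, hw, h⟩ := IsTranspositionSolution.exists_eq_mild hk hL hT hu hy
  rw [h, map_zero, zero_add]
  exact mild_mem_reach _ hw

/-- By linearity, steering `y₀` to `y₁` amounts to reaching `y₁ - sg K T y₀` from `0`. -/
theorem exactlyControllable_iff (hL : 0 < L) {T : ℝ} (hT : 0 ≤ T) :
    ExactlyControllable (generator ℝ k hk) (controlAdjoint ℝ k hk) T ↔
      reach (integralOperator ℝ k hk) T = ⊤ := by
  refine ⟨fun h => eq_top_iff.2 fun y₁ _ => ?_, fun h y₀ y₁ =>
    exists_control_of_mem_reach hk hL T (h ▸ Submodule.mem_top)⟩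
  obtain ⟨u, hu, y, hy, rfl⟩ := h 0 y₁
  exact mem_reach_of_isTranspositionSolution hk hL hT hu hy

theorem dense_reach_of_approximatelyControllable (hL : 0 < L) {T : ℝ} (hT : 0 ≤ T)
    (h : ApproximatelyControllable (generator ℝ k hk) (controlAdjoint ℝ k hk) T) :
    Dense (reach (integralOperator ℝ k hk) T : Set (L2 ℝ L)) := by
  intro y₁
  refine Metric.mem_closure_iff.2 fun ε hε => ?_
  obtain ⟨u, hu, y, hy, hle⟩ := h (ε / 2) (half_pos hε) 0 y₁
  refine ⟨y T, mem_reach_of_isTranspositionSolution hk hL hT hu hy, ?_⟩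
  rw [dist_comm, dist_eq_norm]
  linarith

theorem ExactlyControllable.approximatelyControllable {T : ℝ}
    (h : ExactlyControllable (generator ℝ k hk) (controlAdjoint ℝ k hk) T) :
    ApproximatelyControllable (generator ℝ k hk) (controlAdjoint ℝ k hk) T := by
  intro ε hε y₀ y₁
  obtain ⟨u, hu, y, hy, rfl⟩ := h y₀ y₁
  exact ⟨u, hu, y, hy, by rw [sub_self, norm_zero]; exact hε.le⟩

end Controllability

end

noncomputable section

variable {L : ℝ}

/-! ### Compactness of integral operators with square integrable kernels. -/

section Compact

theorem coeFn_integralOperator {𝕜 : Type*} [RCLike 𝕜] {k : ℝ × ℝ → ℝ}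
    (hk : MemLp k 2 ((μI L).prod (μI L))) (y : L2 𝕜 L) :
    integralOperator 𝕜 k hk y =ᵐ[μI L] fun x => ∫ ξ in Ioo 0 L, k (x, ξ) • y ξ := by
  have h : integralOperator 𝕜 k hk y = (kernel_memLp hk y).toLp _ := rfl
  rw [h]
  exact MemLp.coeFn_toLp _

theorem norm_integralOperator_le {k : ℝ × ℝ → ℝ} (hk : MemLp k 2 ((μI L).prod (μI L))) :
    ‖integralOperator ℝ k hk‖ ≤ (eLpNorm k 2 ((μI L).prod (μI L))).toReal :=
  LinearMap.mkContinuous_norm_le _ ENNReal.toReal_nonneg _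

theorem integralOperator_sub {k g : ℝ × ℝ → ℝ} (hk : MemLp k 2 ((μI L).prod (μI L)))
    (hg : MemLp g 2 ((μI L).prod (μI L))) :
    integralOperator ℝ (k - g) (hk.sub hg) = integralOperator ℝ k hk - integralOperator ℝ g hg := by
  ext1 y
  refine Lp.ext ?_
  have e : (integralOperator ℝ k hk - integralOperator ℝ g hg) y
      = integralOperator ℝ k hk y - integralOperator ℝ g hg y := rfl
  rw [e]
  filter_upwards [coeFn_integralOperator (hk.sub hg) y, coeFn_integralOperator hk y,
    coeFn_integralOperator hg y, Lp.coeFn_sub (integralOperator ℝ k hk y)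
    (integralOperator ℝ g hg y), kernel_integrable hk y, kernel_integrable hg y]
    with x h1 h2 h3 h4 h5 h6
  rw [h1, h4, Pi.sub_apply, h2, h3, ← integral_sub h5 h6]
  simp only [Pi.sub_apply, sub_smul]

theorem isCompactOperator_of_range_le {H : Type*} [NormedAddCommGroup H] [NormedSpace ℝ H]
    (T : H →L[ℝ] H) (V : Submodule ℝ H) [FiniteDimensional ℝ V] (h : ∀ x, T x ∈ V) :
    IsCompactOperator T := by
  have : ProperSpace V := FiniteDimensional.proper ℝ V
  have hc : IsCompactOperator (T.codRestrict V h) :=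
    isCompactOperator_of_locallyCompactSpace_dom _
  exact hc.clm_comp V.subtypeL

/-- A kernel that is a step function in its first variable defines a finite rank operator. -/
theorem isCompactOperator_of_step {g : ℝ × ℝ → ℝ} {q : ℝ → ℝ} (hq : Measurable q)
    (hg : MemLp (fun p : ℝ × ℝ => g (q p.1, p.2)) 2 ((μI L).prod (μI L)))
    (hfin : (q '' Ioo 0 L).Finite) :
    IsCompactOperator (integralOperator ℝ _ hg) := by
  classical
  have hm (a : ℝ) : MemLp ((q ⁻¹' {a}).indicator fun _ => (1 : ℝ)) 2 (μI L) :=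
    (memLp_const 1).indicator (hq (measurableSet_singleton a))
  set S : Finset ℝ := hfin.toFinset
  set e : ℝ → L2 ℝ L := fun a => (hm a).toLp _
  have : FiniteDimensional ℝ (Submodule.span ℝ (e '' S)) :=
    FiniteDimensional.span_of_finite ℝ (S.finite_toSet.image e)
  refine isCompactOperator_of_range_le _ (Submodule.span ℝ (e '' S)) fun y => ?_
  -- The output is constant on each level set of `q`, hence a combination of finitely many indicator
  -- functions.
  have key : integralOperator ℝ _ hg y
      = ∑ a ∈ S, (∫ ξ in Ioo 0 L, g (a, ξ) • y ξ) • e a := by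
    refine Lp.ext ?_
    have h1 : ∀ᵐ x ∂μI L, ∀ a ∈ S, ((∫ ξ in Ioo 0 L, g (a, ξ) • y ξ) • e a : L2 ℝ L) x
        = (∫ ξ in Ioo 0 L, g (a, ξ) • y ξ) * (q ⁻¹' {a}).indicator (fun _ => (1 : ℝ)) x := by
      refine (Finset.eventually_all S).2 fun a _ => ?_
      filter_upwards [Lp.coeFn_smul (∫ ξ in Ioo 0 L, g (a, ξ) • y ξ) (e a), (hm a).coeFn_toLp]
        with x h2 h3
      rw [h2, Pi.smul_apply, h3, smul_eq_mul]
    filter_upwards [coeFn_integralOperator hg y, h1, ae_restrict_mem measurableSet_Ioo,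
      Lp.coeFn_finsetSum S fun a => (∫ ξ in Ioo 0 L, g (a, ξ) • y ξ) • e a] with x h2 h3 h4 h5
    rw [h2, h5, Finset.sum_apply, Finset.sum_congr rfl h3]
    have hx : q x ∈ S := hfin.mem_toFinset.2 ⟨x, h4, rfl⟩
    rw [Finset.sum_eq_single_of_mem (q x) hx]
    · simp
    · intro b _ hb
      rw [indicator_of_notMem (fun h => hb (by simpa using h.symm)), mul_zero]
  rw [key]
  exact Submodule.sum_mem _ fun a ha => Submodule.smul_mem _ _
    (Submodule.subset_span ⟨a, ha, rfl⟩)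

theorem isCompactOperator_of_forall_exists {H : Type*} [NormedAddCommGroup H] [NormedSpace ℝ H]
    [CompleteSpace H] {T : H →L[ℝ] H}
    (h : ∀ ε > 0, ∃ S : H →L[ℝ] H, IsCompactOperator S ∧ ‖T - S‖ ≤ ε) : IsCompactOperator T := by
  have hc : IsClosed {f : H →L[ℝ] H | IsCompactOperator f} := isClosed_setOfPred_isCompactOperator
  have hm : T ∈ closure {f : H →L[ℝ] H | IsCompactOperator f} := by
    refine Metric.mem_closure_iff.2 fun ε hε => ?_
    obtain ⟨S, hS, hle⟩ := h (ε / 2) (half_pos hε)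
    exact ⟨S, hS, by rw [dist_eq_norm]; linarith⟩
  rwa [hc.closure_eq] at hm

theorem exists_isCompactOperator_norm_sub_le {k g : ℝ × ℝ → ℝ}
    (hk : MemLp k 2 ((μI L).prod (μI L))) (hg : MemLp g 2 ((μI L).prod (μI L)))
    (hc : IsCompactOperator (integralOperator ℝ g hg)) {ε : ℝ} (hε : 0 ≤ ε)
    (h : eLpNorm (k - g) 2 ((μI L).prod (μI L)) ≤ ENNReal.ofReal ε) :
    ∃ S : L2 ℝ L →L[ℝ] L2 ℝ L, IsCompactOperator S ∧ ‖integralOperator ℝ k hk - S‖ ≤ ε := by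
  refine ⟨_, hc, ?_⟩
  rw [← integralOperator_sub]
  exact (norm_integralOperator_le _).trans (ENNReal.toReal_le_of_le_ofReal hε h)

/-- By uniform continuity, rounding the first variable to a fine grid changes the kernel little, and
the rounded kernel has finite rank. -/
theorem isCompactOperator_of_continuous {g : ℝ × ℝ → ℝ} (hgc : Continuous g)
    (hgs : HasCompactSupport g) (hg : MemLp g 2 ((μI L).prod (μI L))) :
    IsCompactOperator (integralOperator ℝ g hg) := by
  refine isCompactOperator_of_forall_exists fun ε hε => ?_
  set C : ℝ≥0∞ := (((μI L).prod (μI L)) univ) ^ (2 : ℝ≥0∞).toReal⁻¹ with hCdef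
  have hC : C ≠ ⊤ := ENNReal.rpow_ne_top_of_nonneg (by positivity) (measure_ne_top _ _)
  -- A uniform error `η` costs at most `C * η` in the `L²` norm, where `C` is the square root of the
  -- total mass.
  set η : ℝ := ε / (C.toReal + 1)
  have hη : 0 < η := by positivity
  obtain ⟨δ, hδ, hδu⟩ := Metric.uniformContinuous_iff.1
    (hgs.uniformContinuous_of_continuous hgc) η hη
  set q : ℝ → ℝ := fun x => ⌊x / (δ / 2)⌋ * (δ / 2)
  have hqm : Measurable q := by fun_prop
  have hqx (x : ℝ) : |x - q x| < δ := by
    have h1 := Int.floor_le (x / (δ / 2))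
    have h2 := Int.lt_floor_add_one (x / (δ / 2))
    have h3 : x / (δ / 2) * (δ / 2) = x := by field_simp
    have hδ2 : 0 < δ / 2 := by positivity
    have h4 : q x ≤ x := by
      have := mul_le_mul_of_nonneg_right h1 hδ2.le
      rwa [h3] at this
    have h5 : x < q x + δ / 2 := by
      have := mul_lt_mul_of_pos_right h2 hδ2
      rw [h3, add_mul, one_mul] at this
      exact this
    rw [abs_of_nonneg (by linarith)]
    linarith
  have hfin : (q '' Ioo 0 L).Finite := by
    have : q '' Ioo 0 L ⊆ (fun n : ℤ => (n : ℝ) * (δ / 2)) '' Icc 0 ⌊L / (δ / 2)⌋ := by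
      rintro _ ⟨x, hx, rfl⟩
      refine ⟨⌊x / (δ / 2)⌋, ⟨Int.floor_nonneg.2 (by have := hx.1; positivity),
        Int.floor_mono ?_⟩, rfl⟩
      have := hx.2.le
      gcongr
    exact ((finite_Icc _ _).image _).subset this
  obtain ⟨B, hB⟩ := hgs.exists_bound_of_continuous hgc
  have hgm : Measurable fun p : ℝ × ℝ => g (q p.1, p.2) :=
    hgc.measurable.comp ((hqm.comp measurable_fst).prodMk measurable_snd)
  have hgq : MemLp (fun p : ℝ × ℝ => g (q p.1, p.2)) 2 ((μI L).prod (μI L)) :=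
    MemLp.of_bound hgm.aestronglyMeasurable B (.of_forall fun p => hB _)
  refine exists_isCompactOperator_norm_sub_le hg hgq (isCompactOperator_of_step hqm hgq hfin) hε.le ?_
  refine (eLpNorm_le_of_ae_bound (C := η) (.of_forall fun p => ?_)).trans ?_
  · rw [Pi.sub_apply, ← dist_eq_norm]
    refine (hδu ?_).le
    rw [Prod.dist_eq, dist_self, Real.dist_eq]
    exact max_lt (hqx p.1) hδ
  · rw [← hCdef, ← ENNReal.ofReal_toReal hC, ← ENNReal.ofReal_mul ENNReal.toReal_nonneg]
    refine ENNReal.ofReal_le_ofReal ?_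
    have h0 : 0 ≤ C.toReal := ENNReal.toReal_nonneg
    rw [← mul_div_assoc, div_le_iff₀ (by positivity)]
    nlinarith

/-- Integral operators with square integrable kernels are compact. -/
theorem isCompactOperator_integralOperator {k : ℝ × ℝ → ℝ}
    (hk : MemLp k 2 ((μI L).prod (μI L))) : IsCompactOperator (integralOperator ℝ k hk) := by
  refine isCompactOperator_of_forall_exists fun ε hε => ?_
  obtain ⟨g, hgs, hle, hgc, hg⟩ := hk.exists_hasCompactSupport_eLpNorm_sub_le
    ENNReal.ofNat_ne_top (ε := ENNReal.ofReal ε) (by simpa using hε)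
  exact exists_isCompactOperator_norm_sub_le hk hg (isCompactOperator_of_continuous hgc hgs hg)
    hε.le hle

end Compact

end

noncomputable section

variable {L : ℝ}

/-! ### Transfer between real and complex functions: real part, imaginary part and inclusion at
once. -/

section Map

variable {𝕜 𝕜' : Type*} [RCLike 𝕜] [RCLike 𝕜']

/-- Pointwise action of a real linear map on square integrable functions. -/
def mapL2 (T : 𝕜 →L[ℝ] 𝕜') : L2 𝕜 L →L[ℝ] L2 𝕜' L := T.compLpL 2 (μI L)

theorem coeFn_mapL2 (T : 𝕜 →L[ℝ] 𝕜') (y : L2 𝕜 L) : mapL2 T y =ᵐ[μI L] fun x => T (y x) :=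
  T.coeFn_compLpL y

theorem HasWeakDeriv.map (T : 𝕜 →L[ℝ] 𝕜') {y g : L2 𝕜 L} (h : HasWeakDeriv y g) :
    HasWeakDeriv (mapL2 T y) (mapL2 T g) := by
  intro φ hφ hc hs
  have h' (ψ : ℝ → ℝ) (hψ : Continuous ψ) (hψc : HasCompactSupport ψ) (a : L2 𝕜 L) :
      ∫ x, ψ x • mapL2 T a x ∂μI L = T (∫ x, ψ x • a x ∂μI L) := by
    rw [← T.integral_comp_comm (integrable_smul_coe a hψ hψc)]
    refine integral_congr_ae ?_
    filter_upwards [coeFn_mapL2 T a] with x hx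
    rw [hx, map_smul]
  rw [h' _ (hφ.continuous_deriv (by simp)) hc.deriv, h' _ hφ.continuous hc, h φ hφ hc hs, map_neg]

theorem HasTrace.map (T : 𝕜 →L[ℝ] 𝕜') {y : L2 𝕜 L} {x : ℝ} {c : 𝕜} (h : HasTrace y x c) :
    HasTrace (mapL2 T y) x (T c) := by
  obtain ⟨f, hf, hyf, rfl⟩ := h
  refine ⟨fun x => T (f x), T.continuous.comp_continuousOn hf, ?_, rfl⟩
  filter_upwards [coeFn_mapL2 T y, hyf] with x h1 h2
  rw [h1, h2]

theorem mapL2_mem_generatorDomain (T : 𝕜 →L[ℝ] 𝕜') {y : L2 𝕜 L} (h : y ∈ generatorDomain 𝕜 L) :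
    mapL2 T y ∈ generatorDomain 𝕜' L := by
  obtain ⟨⟨g, hg⟩, hy⟩ := h
  have h0 := hy.map T
  rw [map_zero] at h0
  exact ⟨⟨_, hg.map T⟩, h0⟩

theorem mapL2_integralOperator (T : 𝕜 →L[ℝ] 𝕜') {k : ℝ × ℝ → ℝ}
    (hk : MemLp k 2 ((μI L).prod (μI L))) (y : L2 𝕜 L) :
    mapL2 T (integralOperator 𝕜 k hk y) = integralOperator 𝕜' k hk (mapL2 T y) := by
  refine Lp.ext ?_
  filter_upwards [coeFn_mapL2 T (integralOperator 𝕜 k hk y), coeFn_integralOperator hk y,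
    coeFn_integralOperator hk (mapL2 T y), kernel_integrable hk y] with x h1 h2 h3 h4
  rw [h1, h2, h3, ← T.integral_comp_comm h4]
  refine integral_congr_ae ?_
  filter_upwards [coeFn_mapL2 T y] with ξ h5
  rw [h5, map_smul]

theorem mapL2_generator (T : 𝕜 →L[ℝ] 𝕜') {k : ℝ × ℝ → ℝ}
    (hk : MemLp k 2 ((μI L).prod (μI L))) (y : (generator 𝕜 k hk).domain) :
    mapL2 T (generator 𝕜 k hk y)
      = generator 𝕜' k hk ⟨mapL2 T y, mapL2_mem_generatorDomain T y.2⟩ := by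
  have e1 : generator 𝕜 k hk y = weakDeriv 𝕜 L y + integralOperator 𝕜 k hk y := rfl
  have e2 : generator 𝕜' k hk ⟨mapL2 T y, mapL2_mem_generatorDomain T y.2⟩
      = weakDeriv 𝕜' L ⟨mapL2 T y, mapL2_mem_generatorDomain T y.2⟩
        + integralOperator 𝕜' k hk (mapL2 T y) := rfl
  have e3 : mapL2 T (weakDeriv 𝕜 L y)
      = weakDeriv 𝕜' L ⟨mapL2 T y, mapL2_mem_generatorDomain T y.2⟩ := by
    have h1 := (weakDeriv_spec y).map T
    have h2 := weakDeriv_spec (⟨mapL2 T y, mapL2_mem_generatorDomain T y.2⟩ : generatorDomain 𝕜' L)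
    exact h1.unique h2
  rw [e1, e2, map_add, e3, mapL2_integralOperator]

end Map

/-! ### Complexified operators, their adjoints and traces. -/

section Complex

/-- The real part of a complex function. -/
def reL2 : L2 ℂ L →L[ℝ] L2 ℝ L := mapL2 Complex.reCLM

/-- The imaginary part of a complex function. -/
def imL2 : L2 ℂ L →L[ℝ] L2 ℝ L := mapL2 Complex.imCLM

/-- A real function, as a complex function. -/
def ofRealL2 : L2 ℝ L →L[ℝ] L2 ℂ L := mapL2 Complex.ofRealCLM

theorem coeFn_reL2 (z : L2 ℂ L) : reL2 z =ᵐ[μI L] fun x => (z x).re := coeFn_mapL2 _ z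

theorem coeFn_imL2 (z : L2 ℂ L) : imL2 z =ᵐ[μI L] fun x => (z x).im := coeFn_mapL2 _ z

theorem coeFn_ofRealL2 (y : L2 ℝ L) : ofRealL2 y =ᵐ[μI L] fun x => (y x : ℂ) := coeFn_mapL2 _ y

theorem ofRealL2_re_add_im (z : L2 ℂ L) :
    ofRealL2 (reL2 z) + Complex.I • ofRealL2 (imL2 z) = z := by
  refine Lp.ext ?_
  filter_upwards [Lp.coeFn_add (ofRealL2 (reL2 z)) (Complex.I • ofRealL2 (imL2 z)),
    Lp.coeFn_smul Complex.I (ofRealL2 (imL2 z)), coeFn_ofRealL2 (reL2 z), coeFn_ofRealL2 (imL2 z),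
    coeFn_reL2 z, coeFn_imL2 z] with x h1 h2 h3 h4 h5 h6
  rw [h1, Pi.add_apply, h2, Pi.smul_apply, h3, h4, h5, h6, smul_eq_mul, mul_comm,
    Complex.re_add_im]

theorem reL2_smul (c : ℂ) (z : L2 ℂ L) : reL2 (c • z) = c.re • reL2 z - c.im • imL2 z := by
  refine Lp.ext ?_
  filter_upwards [coeFn_reL2 (c • z), Lp.coeFn_smul c z,
    Lp.coeFn_sub (c.re • reL2 z) (c.im • imL2 z), Lp.coeFn_smul c.re (reL2 z),
    Lp.coeFn_smul c.im (imL2 z), coeFn_reL2 z, coeFn_imL2 z] with x h1 h2 h3 h4 h5 h6 h7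
  rw [h1, h2, h3, Pi.sub_apply, h4, h5, Pi.smul_apply, Pi.smul_apply, Pi.smul_apply, h6, h7]
  simp

theorem imL2_smul (c : ℂ) (z : L2 ℂ L) : imL2 (c • z) = c.re • imL2 z + c.im • reL2 z := by
  refine Lp.ext ?_
  filter_upwards [coeFn_imL2 (c • z), Lp.coeFn_smul c z,
    Lp.coeFn_add (c.re • imL2 z) (c.im • reL2 z), Lp.coeFn_smul c.re (imL2 z),
    Lp.coeFn_smul c.im (reL2 z), coeFn_reL2 z, coeFn_imL2 z] with x h1 h2 h3 h4 h5 h6 h7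
  rw [h1, h2, h3, Pi.add_apply, h4, h5, Pi.smul_apply, Pi.smul_apply, Pi.smul_apply, h6, h7]
  simp

theorem reL2_ofRealL2 (y : L2 ℝ L) : reL2 (ofRealL2 y) = y := by
  refine Lp.ext ?_
  filter_upwards [coeFn_reL2 (ofRealL2 y), coeFn_ofRealL2 y] with x h1 h2
  rw [h1, h2, Complex.ofReal_re]

theorem imL2_ofRealL2 (y : L2 ℝ L) : imL2 (ofRealL2 y) = 0 := by
  refine Lp.ext ?_
  filter_upwards [coeFn_imL2 (ofRealL2 y), coeFn_ofRealL2 y, Lp.coeFn_zero ℝ 2 (μI L)]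
    with x h1 h2 h3
  rw [h1, h2, h3, Complex.ofReal_im, Pi.zero_apply]

theorem eq_zero_of_reL2_imL2 {z : L2 ℂ L} (h1 : reL2 z = 0) (h2 : imL2 z = 0) : z = 0 := by
  rw [← ofRealL2_re_add_im z, h1, h2, map_zero, smul_zero, add_zero]

theorem re_inner_ofRealL2 (y : L2 ℝ L) (z : L2 ℂ L) : (⟪ofRealL2 y, z⟫_ℂ).re = ⟪y, reL2 z⟫_ℝ := by
  rw [L2.inner_def, L2.inner_def]
  refine (Complex.reCLM.integral_comp_comm (L2.integrable_inner (𝕜 := ℂ) (ofRealL2 y) z)).symm.trans ?_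
  refine integral_congr_ae ?_
  filter_upwards [coeFn_ofRealL2 y, coeFn_reL2 z] with x h1 h2
  rw [h1, h2]
  simp

theorem im_inner_ofRealL2 (y : L2 ℝ L) (z : L2 ℂ L) : (⟪ofRealL2 y, z⟫_ℂ).im = ⟪y, imL2 z⟫_ℝ := by
  rw [L2.inner_def, L2.inner_def]
  refine (Complex.imCLM.integral_comp_comm (L2.integrable_inner (𝕜 := ℂ) (ofRealL2 y) z)).symm.trans ?_
  refine integral_congr_ae ?_
  filter_upwards [coeFn_ofRealL2 y, coeFn_imL2 z] with x h1 h2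
  rw [h1, h2]
  simp

theorem dense_generatorDomain_complex (hL : 0 < L) :
    Dense (generatorDomain ℂ L : Set (L2 ℂ L)) := by
  have h (y : L2 ℝ L) : ofRealL2 y ∈ (generatorDomain ℂ L).topologicalClosure :=
    map_mem_closure ofRealL2.continuous (dense_generatorDomain hL y)
      fun x hx => mapL2_mem_generatorDomain _ hx
  intro z
  rw [← ofRealL2_re_add_im z]
  exact Submodule.add_mem _ (h _) (Submodule.smul_mem _ _ (h _))

variable {k : ℝ × ℝ → ℝ} (hk : MemLp k 2 ((μI L).prod (μI L)))

/-- The kernel is real, so the complex generator acts on real functions as the real one; take real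
parts in the complex adjoint relation. -/
theorem inner_reL2_adjoint (hL : 0 < L) (z : (generator ℂ k hk)†.domain)
    (y : (generator ℝ k hk).domain) :
    ⟪reL2 ((generator ℂ k hk)† z), (y : L2 ℝ L)⟫_ℝ = ⟪reL2 (z : L2 ℂ L), generator ℝ k hk y⟫_ℝ := by
  have hd : Dense ((generator ℂ k hk).domain : Set (L2 ℂ L)) := dense_generatorDomain_complex hL
  have h : ⟪(generator ℂ k hk)† z, ofRealL2 y⟫_ℂ = ⟪(z : L2 ℂ L), ofRealL2 (generator ℝ k hk y)⟫_ℂ := by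
    have h1 := LinearPMap.adjoint_isFormalAdjoint hd z
      ⟨ofRealL2 y, mapL2_mem_generatorDomain _ y.2⟩
    have h2 : ofRealL2 (generator ℝ k hk y) = generator ℂ k hk
      ⟨ofRealL2 y, mapL2_mem_generatorDomain _ y.2⟩ := mapL2_generator _ hk y
    rw [h2]
    exact h1
  rw [real_inner_comm, ← re_inner_ofRealL2, real_inner_comm, ← re_inner_ofRealL2,
    ← inner_conj_symm, ← inner_conj_symm (ofRealL2 (generator ℝ k hk y)), h]

/-- The real part of an element of the domain of the complex adjoint. -/
def reAdjoint (hL : 0 < L) (z : (generator ℂ k hk)†.domain) : (generator ℝ k hk)†.domain :=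
  ⟨reL2 (z : L2 ℂ L), LinearPMap.mem_adjoint_domain_of_exists _ ⟨_, inner_reL2_adjoint hk hL z⟩⟩

theorem adjoint_reAdjoint (hL : 0 < L) (z : (generator ℂ k hk)†.domain) :
    (generator ℝ k hk)† (reAdjoint hk hL z) = reL2 ((generator ℂ k hk)† z) := by
  have hd : Dense ((generator ℝ k hk).domain : Set (L2 ℝ L)) := dense_generatorDomain hL
  exact LinearPMap.adjoint_apply_eq hd _ (inner_reL2_adjoint hk hL z)

theorem ofRealL2_mem_adjoint_domain (hL : 0 < L) (a : (generator ℝ k hk)†.domain) :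
    ofRealL2 (a : L2 ℝ L) ∈ (generator ℂ k hk)†.domain := by
  refine LinearPMap.mem_adjoint_domain_of_exists _ ⟨ofRealL2 ((generator ℝ k hk)† a), fun w => ?_⟩
  have h1 : reL2 (generator ℂ k hk w)
      = generator ℝ k hk ⟨reL2 (w : L2 ℂ L), mapL2_mem_generatorDomain _ w.2⟩ :=
    mapL2_generator _ hk w
  have h2 : imL2 (generator ℂ k hk w)
      = generator ℝ k hk ⟨imL2 (w : L2 ℂ L), mapL2_mem_generatorDomain _ w.2⟩ :=
    mapL2_generator _ hk w
  refine Complex.ext ?_ ?_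
  · rw [re_inner_ofRealL2, re_inner_ofRealL2, h1, ← inner_adjoint_apply hk hL]
  · rw [im_inner_ofRealL2, im_inner_ofRealL2, h2, ← inner_adjoint_apply hk hL]

theorem hasTrace_controlAdjoint (hL : 0 < L) (z : (generator ℝ k hk)†.domain) :
    HasTrace (z : L2 ℝ L) L (controlAdjoint ℝ k hk z) := by
  have h := (hasTrace_primAdj hL (adjointFree hk z)).smul (-1)
  rw [neg_one_smul, neg_one_mul, ← adjoint_domain_eq hk hL z, ← controlAdjoint_eq hk hL] at h
  exact h

/-- `trace` falls back to `0` when there is no continuous representative, so one must be exhibited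
before linearity of the trace can be used. The imaginary part is handled as the real part of `-I •
z`. -/
theorem hasTrace_controlAdjoint_complex (hL : 0 < L) (z : (generator ℂ k hk)†.domain) :
    HasTrace (z : L2 ℂ L) L (controlAdjoint ℂ k hk z) := by
  have h1 := (hasTrace_controlAdjoint hk hL (reAdjoint hk hL z)).map Complex.ofRealCLM
  have h2 := (hasTrace_controlAdjoint hk hL
    (reAdjoint hk hL ((-Complex.I) • z))).map Complex.ofRealCLM
  have e : imL2 (z : L2 ℂ L) = reL2 ((-Complex.I) • (z : L2 ℂ L)) := by
    rw [reL2_smul]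
    simp
  have h3 := h1.add (h2.smul Complex.I)
  have e1 : ofRealL2 (reL2 (z : L2 ℂ L)) + Complex.I • ofRealL2 (reL2 ((-Complex.I) • (z : L2 ℂ L)))
      = z := by
    rw [← e, ofRealL2_re_add_im]
  have h4 : HasTrace (z : L2 ℂ L) L _ := e1 ▸ h3
  have e2 : controlAdjoint ℂ k hk z = _ := h4.trace_eq hL (right_mem_Icc.2 hL.le)
  rw [e2]
  exact h4

theorem controlAdjoint_smul (hL : 0 < L) (c : ℂ) (z : (generator ℂ k hk)†.domain) :
    controlAdjoint ℂ k hk (c • z) = c * controlAdjoint ℂ k hk z :=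
  ((hasTrace_controlAdjoint_complex hk hL z).smul c).trace_eq hL (right_mem_Icc.2 hL.le)

theorem controlAdjoint_reAdjoint (hL : 0 < L) (z : (generator ℂ k hk)†.domain) :
    controlAdjoint ℝ k hk (reAdjoint hk hL z) = (controlAdjoint ℂ k hk z).re :=
  ((hasTrace_controlAdjoint_complex hk hL z).map Complex.reCLM).trace_eq hL
    (right_mem_Icc.2 hL.le)

/-- Eigenvectors of the complex adjoint yield exponential solutions of the adjoint equation. -/
theorem isAdjointSolution_exp (hL : 0 < L) {z : (generator ℂ k hk)†.domain} {lam : ℂ}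
    (hz : (generator ℂ k hk)† z = lam • (z : L2 ℂ L)) (T : ℝ) :
    IsAdjointSolution (generator ℝ k hk) T
      fun t => reAdjoint hk hL (Complex.exp (lam * (T - t : ℝ)) • z) := by
  have e (t : ℝ) : (generator ℝ k hk)† (reAdjoint hk hL (Complex.exp (lam * (T - t : ℝ)) • z))
      = reL2 ((Complex.exp (lam * (T - t : ℝ)) * lam) • (z : L2 ℂ L)) := by
    rw [adjoint_reAdjoint, LinearPMap.map_smul, hz, smul_smul]
  refine ⟨fun t _ => ?_, ?_⟩
  · rw [e]
    have h1 : HasDerivAt (fun t : ℝ => Complex.exp (lam * (T - t : ℝ)))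
        (Complex.exp (lam * (T - t : ℝ)) * (lam * (-1 : ℝ))) t :=
      ((((hasDerivAt_id t).const_sub T).ofReal_comp).const_mul lam).cexp
    have h2 := reL2.hasFDerivAt.comp_hasDerivAt t (h1.smul_const (z : L2 ℂ L))
    have e3 : -reL2 ((Complex.exp (lam * (T - t : ℝ)) * lam) • (z : L2 ℂ L))
        = reL2 ((Complex.exp (lam * (T - t : ℝ)) * (lam * (-1 : ℝ))) • (z : L2 ℂ L)) := by
      rw [← map_neg, ← neg_smul]
      congr 2
      push_cast
      ring
    rw [e3]
    exact h2.hasDerivWithinAt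
  · simp only [e]
    refine Continuous.continuousOn (reL2.continuous.comp ?_)
    fun_prop

end Complex

end

noncomputable section

variable {L : ℝ}

variable {k : ℝ × ℝ → ℝ} (hk : MemLp k 2 ((μI L).prod (μI L)))

/-! ### Eigenvectors of the adjoint against reachable states. -/

section Eigenvector

theorem reL2_neg_I_smul (z : L2 ℂ L) : reL2 ((-Complex.I) • z) = imL2 z := by
  rw [reL2_smul]
  simp

/-- Pairing of reachable states with the exponential solution given by an eigenvector. -/
theorem inner_reL2_mild (hL : 0 < L) {z : (generator ℂ k hk)†.domain} {lam : ℂ}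
    (hz : (generator ℂ k hk)† z = lam • (z : L2 ℂ L)) {T : ℝ} (hT : 0 ≤ T) {w : L2R}
    (hw : VanishesOn w (Iio L)) :
    ⟪reL2 (z : L2 ℂ L), mild (integralOperator ℝ k hk) T w⟫_ℝ
      = ∫ t in (0 : ℝ)..T,
        w (L + t) * (Complex.exp (lam * (T - t : ℝ)) * controlAdjoint ℂ k hk z).re := by
  have h := inner_mild_sub hk hL hT (isAdjointSolution_exp hk hL hz T) w
  rw [hw.restr_eq_zero fun x hx => hx.2, inner_zero_right, sub_zero] at h
  simp only [controlAdjoint_reAdjoint, controlAdjoint_smul hk hL] at h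
  rw [← h]
  congr 1
  change _ = reL2 (Complex.exp (lam * (T - T : ℝ)) • (z : L2 ℂ L))
  rw [sub_self, Complex.ofReal_zero, mul_zero, Complex.exp_zero, one_smul]

/-- The real part of `z` is itself reachable, and it is orthogonal to every reachable state since
its boundary observation is zero. -/
theorem reL2_eq_zero_of_eigenvector (hL : 0 < L) {z : (generator ℂ k hk)†.domain} {lam : ℂ}
    (hz : (generator ℂ k hk)† z = lam • (z : L2 ℂ L)) (hc : controlAdjoint ℂ k hk z = 0)
    {T : ℝ} (hT : 0 ≤ T) (h : reach (integralOperator ℝ k hk) T = ⊤) :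
    reL2 (z : L2 ℂ L) = 0 := by
  have hm : reL2 (z : L2 ℂ L) ∈ reach (integralOperator ℝ k hk) T := h ▸ Submodule.mem_top
  obtain ⟨w, hw, hwz⟩ := hm
  have hwz' : mild (integralOperator ℝ k hk) T w = reL2 (z : L2 ℂ L) := hwz
  have h1 := inner_reL2_mild hk hL hz hT hw
  rw [hwz', hc] at h1
  simpa using h1

theorem fattoriniCriterion_of_reach_eq_top (hL : 0 < L) {T : ℝ} (hT : 0 ≤ T)
    (h : reach (integralOperator ℝ k hk) T = ⊤) :
    FattoriniCriterion (generator ℂ k hk) (controlAdjoint ℂ k hk) := by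
  intro lam z hz hc
  refine Subtype.ext (eq_zero_of_reL2_imL2 ?_ ?_)
  · exact reL2_eq_zero_of_eigenvector hk hL hz hc hT h
  · rw [← reL2_neg_I_smul]
    refine reL2_eq_zero_of_eigenvector hk hL (z := (-Complex.I) • z) (lam := lam) ?_ ?_ hT h
    · rw [LinearPMap.map_smul, hz]
      exact smul_comm _ _ _
    · rw [controlAdjoint_smul hk hL, hc, mul_zero]

/-- The trace of an eigenvector that is orthogonal to the reachable states is imaginary. -/
theorem re_controlAdjoint_eq_zero (hL : 0 < L) {z : (generator ℂ k hk)†.domain} {lam : ℂ}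
    (hz : (generator ℂ k hk)† z = lam • (z : L2 ℂ L)) {T : ℝ} (hT : 0 < T)
    (h : reL2 (z : L2 ℂ L) ∈ (reach (integralOperator ℝ k hk) T)ᗮ) :
    (controlAdjoint ℂ k hk z).re = 0 := by
  -- Using the observation `g` itself as control turns orthogonality into `∫ g² = 0`. Since `g` is
  -- continuous and `g T` is the real part of the trace, that real part vanishes.
  set g : ℝ → ℝ := fun t => (Complex.exp (lam * (T - t : ℝ)) * controlAdjoint ℂ k hk z).re with hg
  have hgc : Continuous g := by
    refine Complex.continuous_re.comp ?_
    fun_prop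
  have hgm : MemLp ((Ioo 0 T).indicator g) 2 volume := by
    rw [memLp_indicator_iff_restrict measurableSet_Ioo]
    obtain ⟨C, hC⟩ := (isCompact_Icc (a := (0 : ℝ)) (b := T)).exists_bound_of_continuousOn
      hgc.continuousOn
    refine MemLp.of_bound hgc.aestronglyMeasurable C ?_
    filter_upwards [ae_restrict_mem measurableSet_Ioo] with t ht using hC t (Ioo_subset_Icc_self ht)
  set v : L2R := hgm.toLp _
  have hv : v =ᵐ[volume] (Ioo 0 T).indicator g := hgm.coeFn_toLp
  have hv0 : VanishesOn v (Ioo 0 T)ᶜ := by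
    filter_upwards [hv] with x hx hx'
    rw [hx, indicator_of_notMem hx']
  have hw : VanishesOn (shift (-L) v) (Iio L) :=
    (hv0.shift (-L)).mono fun x hx h => by linarith [mem_Iio.1 hx, h.1]
  have h1 := inner_reL2_mild hk hL hz hT.le hw
  rw [real_inner_comm, h _ (mild_mem_reach _ hw)] at h1
  have h2 : ∫ t in (0 : ℝ)..T, shift (-L) v (L + t) * g t = ∫ t in (0 : ℝ)..T, g t * g t := by
    rw [intervalIntegral.integral_of_le hT.le, intervalIntegral.integral_of_le hT.le,
      integral_Ioc_eq_integral_Ioo, integral_Ioc_eq_integral_Ioo]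
    refine setIntegral_congr_ae measurableSet_Ioo ?_
    have qm := (measurePreserving_add_left volume L).quasiMeasurePreserving
    filter_upwards [qm.ae (coeFn_shift (-L) v), hv] with t e1 e2 ht
    rw [e1, neg_add_cancel_left, e2, indicator_of_mem ht]
  by_contra hne
  have hgT : g T = (controlAdjoint ℂ k hk z).re := by simp [hg]
  have h3 := intervalIntegral.integral_pos hT (hgc.mul hgc).continuousOn
    (fun t _ => mul_self_nonneg (g t)) ⟨T, right_mem_Icc.2 hT.le, mul_self_pos.2 (by rwa [hgT])⟩
  exact h3.ne (h1.trans h2)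

theorem controlAdjoint_eq_zero_of_mem_orthogonal (hL : 0 < L) {z : (generator ℂ k hk)†.domain}
    {lam : ℂ} (hz : (generator ℂ k hk)† z = lam • (z : L2 ℂ L)) {T : ℝ} (hT : 0 < T)
    (h1 : reL2 (z : L2 ℂ L) ∈ (reach (integralOperator ℝ k hk) T)ᗮ)
    (h2 : imL2 (z : L2 ℂ L) ∈ (reach (integralOperator ℝ k hk) T)ᗮ) :
    controlAdjoint ℂ k hk z = 0 := by
  refine Complex.ext (re_controlAdjoint_eq_zero hk hL hz hT h1) ?_
  have h3 := re_controlAdjoint_eq_zero hk hL (z := (-Complex.I) • z) (lam := lam) (by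
    rw [LinearPMap.map_smul, hz]
    exact smul_comm _ _ _) hT (by
    rw [← reL2_neg_I_smul] at h2
    exact h2)
  rw [controlAdjoint_smul hk hL] at h3
  simpa using h3

end Eigenvector

/-! ### Invariance of the unreachable directions and the Fattorini criterion. -/

section Invariant

/-- If the reachable space does not grow up to time `T`, its orthogonal complement is an invariant
subspace of the adjoint, contained in the domain. -/
theorem orthogonal_reach_le_map (hL : 0 < L) {t T : ℝ} (ht : 0 ≤ t) (htT : t < T)
    (hfin : FiniteDimensional ℝ (reach (integralOperator ℝ k hk) t)ᗮ)
    (h : ∀ t', t ≤ t' → t' < T → (reach (integralOperator ℝ k hk) t)ᗮ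
      ≤ (reach (integralOperator ℝ k hk) t')ᗮ) :
    (reach (integralOperator ℝ k hk) t)ᗮ ≤
      ((reach (integralOperator ℝ k hk) t)ᗮ.comap (generator ℝ k hk)†.toFun).map
        (generator ℝ k hk)†.domain.subtype := by
  set K := integralOperator ℝ k hk
  set N := (reach K t)ᗮ
  have hsg (s : ℝ) (hs : 0 ≤ s) (hsT : s < T - t) (m : L2 ℝ L) (hm : m ∈ N) :
      ContinuousLinearMap.adjoint (sg K s) m ∈ N := by
    intro y hy
    rw [ContinuousLinearMap.adjoint_inner_right]
    exact h (s + t) (by linarith) (by linarith) hm _ (sg_mem_reach K hs ht hy)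
  have hsgInt (ε : ℝ) (hε : 0 ≤ ε) (hεT : ε < T - t) (m : L2 ℝ L) (hm : m ∈ N) :
      ContinuousLinearMap.adjoint (sgInt K ε) m ∈ N := by
    intro y hy
    rw [ContinuousLinearMap.adjoint_inner_right, real_inner_comm, sgInt_apply]
    refine ((innerSL ℝ m).intervalIntegral_comp_comm
      ((continuous_sg K y).intervalIntegrable 0 ε)).symm.trans ?_
    rw [intervalIntegral.integral_congr (g := fun _ => (0 : ℝ)), intervalIntegral.integral_zero]
    intro s hs
    rw [uIcc_of_le hε] at hs
    have h1 := hsg s hs.1 (hs.2.trans_lt hεT) m hm y hy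
    rw [ContinuousLinearMap.adjoint_inner_right, real_inner_comm] at h1
    exact h1
  -- The averaged vectors lie in the domain of the adjoint, but they might span only a part of `N`.
  set V : Submodule ℝ (L2 ℝ L) := Submodule.span ℝ
    {x | ∃ ε, 0 < ε ∧ ε < T - t ∧ ∃ m ∈ N, ContinuousLinearMap.adjoint (sgInt K ε) m = x}
  have hVN : V ≤ N := by
    refine Submodule.span_le.2 ?_
    rintro _ ⟨ε, hε, hεT, m, hm, rfl⟩
    exact hsgInt ε hε.le hεT m hm
  have hVfin : FiniteDimensional ℝ V := Submodule.finiteDimensional_of_le hVN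
  -- A vector `n` of `N` orthogonal to `V` has `⟪n, ε⁻¹ • sgInt K ε n⟫ = 0` for small `ε`; letting
  -- `ε` tend to `0` gives `n = 0`. Finite dimension rules out a merely dense `V`.
  have hV : V = N := by
    have h1 := Submodule.sup_orthogonal_inf_of_hasOrthogonalProjection hVN
    have h2 : Vᗮ ⊓ N = ⊥ := by
      refine (Submodule.eq_bot_iff _).2 fun n hn => ?_
      have h3 := tendsto_inv_smul_strongInt (continuous_sg K) n
      rw [sg_zero] at h3
      have h4 : Tendsto (fun ε : ℝ => ⟪n, ε⁻¹ • sgInt K ε n⟫_ℝ) (𝓝[>] 0) (𝓝 ⟪n, n⟫_ℝ) :=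
        tendsto_const_nhds.inner h3
      have h5 : ⟪n, n⟫_ℝ = 0 := by
        refine tendsto_nhds_unique h4 (tendsto_const_nhds.congr' ?_)
        filter_upwards [Ioo_mem_nhdsGT (sub_pos.2 htT)] with ε hε
        have h6 := hn.1 _ (Submodule.subset_span ⟨ε, hε.1, hε.2, n, hn.2, rfl⟩)
        rw [ContinuousLinearMap.adjoint_inner_left] at h6
        rw [real_inner_smul_right, h6, mul_zero]
      exact inner_self_eq_zero.1 h5
    rwa [h2, sup_bot_eq] at h1
  rw [← hV]
  refine Submodule.span_le.2 ?_
  rintro _ ⟨ε, hε, hεT, m, hm, rfl⟩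
  -- The adjoint sends the averaged vector to `S(ε)* m - m`, which is again in `N`.
  have hA (y : (generator ℝ k hk).domain) :
      ⟪ContinuousLinearMap.adjoint (sg K ε) m - m, (y : L2 ℝ L)⟫_ℝ
        = ⟪ContinuousLinearMap.adjoint (sgInt K ε) m, generator ℝ k hk y⟫_ℝ := by
    rw [ContinuousLinearMap.adjoint_inner_left, sgInt_apply,
      integral_sg_generator hk hL y le_rfl hε.le, sg_zero, inner_sub_left, inner_sub_right,
      ContinuousLinearMap.adjoint_inner_left]
  have hd : Dense ((generator ℝ k hk).domain : Set (L2 ℝ L)) := dense_generatorDomain hL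
  refine ⟨⟨_, LinearPMap.mem_adjoint_domain_of_exists _ ⟨_, hA⟩⟩, ?_, rfl⟩
  change (generator ℝ k hk)† _ ∈ V
  rw [LinearPMap.adjoint_apply_eq hd _ hA, hV]
  exact N.sub_mem (hsg ε hε.le hεT m hm) hm

/-- The complexification of a space of real functions. -/
def complexify (N : Submodule ℝ (L2 ℝ L)) : Submodule ℂ (L2 ℂ L) where
  carrier := {z | reL2 z ∈ N ∧ imL2 z ∈ N}
  zero_mem' := by simp
  add_mem' := by
    rintro y z ⟨h1, h2⟩ ⟨h3, h4⟩
    exact ⟨by rw [map_add]; exact N.add_mem h1 h3, by rw [map_add]; exact N.add_mem h2 h4⟩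
  smul_mem' := by
    rintro c z ⟨h1, h2⟩
    exact ⟨by rw [reL2_smul]; exact N.sub_mem (N.smul_mem _ h1) (N.smul_mem _ h2),
      by rw [imL2_smul]; exact N.add_mem (N.smul_mem _ h2) (N.smul_mem _ h1)⟩

theorem finiteDimensional_complexify (N : Submodule ℝ (L2 ℝ L)) [FiniteDimensional ℝ N] :
    FiniteDimensional ℂ (complexify N) := by
  let f : complexify N →ₗ[ℝ] N × N :=
    { toFun := fun z => (⟨reL2 (z : L2 ℂ L), z.2.1⟩, ⟨imL2 (z : L2 ℂ L), z.2.2⟩)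
      map_add' := fun y z => by
        ext1 <;> exact Subtype.ext (map_add _ _ _)
      map_smul' := fun c z => by
        ext1 <;> exact Subtype.ext (map_smul _ _ _) }
  have hf : Function.Injective f := by
    refine (injective_iff_map_eq_zero f).2 fun z hz => ?_
    refine Subtype.ext (eq_zero_of_reL2_imL2 ?_ ?_)
    · exact congrArg (fun p : N × N => (p.1 : L2 ℝ L)) hz
    · exact congrArg (fun p : N × N => (p.2 : L2 ℝ L)) hz
  have : FiniteDimensional ℝ (complexify N) := Module.Finite.of_injective f hf
  exact Module.Finite.of_restrictScalars_finite ℝ ℂ _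

/-- A finite dimensional invariant space of the real adjoint contains the real and imaginary parts
of an eigenvector of the complex adjoint. -/
theorem exists_eigenvector_of_invariant (hL : 0 < L) {N : Submodule ℝ (L2 ℝ L)}
    [FiniteDimensional ℝ N] (hN : N ≠ ⊥) (h : N ≤ (N.comap (generator ℝ k hk)†.toFun).map
      (generator ℝ k hk)†.domain.subtype) :
    ∃ z : (generator ℂ k hk)†.domain, ∃ lam : ℂ, z ≠ 0 ∧
      (generator ℂ k hk)† z = lam • (z : L2 ℂ L) ∧
      reL2 (z : L2 ℂ L) ∈ N ∧ imL2 (z : L2 ℂ L) ∈ N := by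
  have hNd (a : L2 ℝ L) (ha : a ∈ N) : a ∈ (generator ℝ k hk)†.domain := by
    obtain ⟨b, -, rfl⟩ := h ha
    exact b.2
  have hNA (a : (generator ℝ k hk)†.domain) (ha : (a : L2 ℝ L) ∈ N) :
      (generator ℝ k hk)† a ∈ N := by
    obtain ⟨b, hb, hba⟩ := h ha
    have e : b = a := Subtype.ext hba
    exact e ▸ hb
  have hdom : complexify N ≤ (generator ℂ k hk)†.domain := by
    rintro z ⟨h1, h2⟩
    rw [← ofRealL2_re_add_im z]
    exact Submodule.add_mem _ (ofRealL2_mem_adjoint_domain hk hL ⟨_, hNd _ h1⟩)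
      (Submodule.smul_mem _ _ (ofRealL2_mem_adjoint_domain hk hL ⟨_, hNd _ h2⟩))
  have hinv (z : (generator ℂ k hk)†.domain) (hz : (z : L2 ℂ L) ∈ complexify N) :
      (generator ℂ k hk)† z ∈ complexify N := by
    refine ⟨?_, ?_⟩
    · rw [← adjoint_reAdjoint hk hL]
      exact hNA _ hz.1
    · rw [← reL2_neg_I_smul, ← LinearPMap.map_smul, ← adjoint_reAdjoint hk hL]
      refine hNA _ ?_
      change reL2 ((-Complex.I) • (z : L2 ℂ L)) ∈ N
      rw [reL2_neg_I_smul]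
      exact hz.2
  -- The complex adjoint restricts to an endomorphism of a nonzero finite-dimensional complex space,
  -- so it has an eigenvalue.
  let f : complexify N →ₗ[ℂ] complexify N :=
    ((generator ℂ k hk)†.toFun ∘ₗ Submodule.inclusion hdom).codRestrict (complexify N)
      fun z => hinv _ z.2
  have hfin := finiteDimensional_complexify N
  have hnt : Nontrivial (complexify N) := by
    obtain ⟨a, ha, ha0⟩ := Submodule.exists_mem_ne_zero_of_ne_bot hN
    refine ⟨⟨ofRealL2 a, by rw [reL2_ofRealL2]; exact ha, by
      rw [imL2_ofRealL2]; exact N.zero_mem⟩, 0, fun h0 => ha0 ?_⟩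
    have h1 : ofRealL2 a = 0 := congrArg Subtype.val h0
    rw [← reL2_ofRealL2 a, h1, map_zero]
  obtain ⟨lam, hlam⟩ := Module.End.exists_eigenvalue f
  obtain ⟨v, hv⟩ := hlam.exists_hasEigenvector
  refine ⟨⟨v, hdom v.2⟩, lam, fun h0 => hv.2 ?_, ?_, v.2.1, v.2.2⟩
  · have h1 : (v : L2 ℂ L) = 0 := congrArg Subtype.val h0
    exact Subtype.ext h1
  · exact congrArg Subtype.val hv.apply_eq_smul

theorem reach_eq_top_of_fattoriniCriterion (hL : 0 < L) {T : ℝ} (hT : L < T)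
    (h : FattoriniCriterion (generator ℂ k hk) (controlAdjoint ℂ k hk)) :
    reach (integralOperator ℝ k hk) T = ⊤ := by
  set K := integralOperator ℝ k hk
  have hcl (t : ℝ) (ht : L ≤ t) := reach_isClosed_and_finiteDimensional K
    (isCompactOperator_integralOperator hk) hL ht
  -- The codimension is a natural number and attains its minimum on `[L, T)`. The half-open interval
  -- leaves room between `t` and `T` for the semigroup to act; this is where `T > L` enters.
  obtain ⟨t, ⟨ht, htT⟩, hmin⟩ := exists_minimalFor_of_wellFoundedLT (fun t => t ∈ Ico L T)
    (fun t => Module.finrank ℝ (reach K t)ᗮ) ⟨L, le_rfl, hT⟩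
  have ht0 : 0 < t := hL.trans_le ht
  have hle (t' : ℝ) (h1 : t ≤ t') (h2 : t' < T) : (reach K t)ᗮ ≤ (reach K t')ᗮ := by
    have := (hcl t ht).2
    have h3 : (reach K t')ᗮ ≤ (reach K t)ᗮ := Submodule.orthogonal_le (reach_mono K ht0.le h1)
    have h4 : Module.finrank ℝ (reach K t)ᗮ ≤ Module.finrank ℝ (reach K t')ᗮ :=
      hmin (j := t') ⟨ht.trans h1, h2⟩ (Submodule.finrank_mono h3)
    exact (Submodule.eq_of_le_of_finrank_le h3 h4).ge
  have hbot : (reach K t)ᗮ = ⊥ := by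
    by_contra hne
    have := (hcl t ht).2
    obtain ⟨z, lam, hz0, hz, h1, h2⟩ := exists_eigenvector_of_invariant hk hL hne
      (orthogonal_reach_le_map hk hL ht0.le htT this hle)
    exact hz0 (h lam z hz (controlAdjoint_eq_zero_of_mem_orthogonal hk hL hz ht0 h1 h2))
  have htop : reach K t = ⊤ := by
    have h1 := Submodule.topologicalClosure_eq_top_iff.2 hbot
    rwa [(hcl t ht).1.submodule_topologicalClosure_eq] at h1
  exact eq_top_iff.2 (htop ▸ reach_mono K ht0.le htT.le)

end Invariant

end

end IntegralTransport

theorem mainTheorem6 (L : ℝ) (hL : 0 < L) (k : ℝ × ℝ → ℝ)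
    (hk : MeasureTheory.MemLp k 2 ((IntegralTransport.μI L).prod (IntegralTransport.μI L))) :
    (ExactlyControllable
        (IntegralTransport.generator ℝ k hk) (IntegralTransport.controlAdjoint ℝ k hk) L ↔
      ApproximatelyControllable
        (IntegralTransport.generator ℝ k hk) (IntegralTransport.controlAdjoint ℝ k hk) L) ∧
    ∀ T : ℝ, L < T →
      (ExactlyControllable
          (IntegralTransport.generator ℝ k hk) (IntegralTransport.controlAdjoint ℝ k hk) T ↔
        FattoriniCriterion
          (IntegralTransport.generator ℂ k hk) (IntegralTransport.controlAdjoint ℂ k hk)) := by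
  refine ⟨⟨fun h => IntegralTransport.ExactlyControllable.approximatelyControllable hk h,
    fun h => ?_⟩, fun T hT => ?_⟩
  · rw [IntegralTransport.exactlyControllable_iff hk hL hL.le]
    have h1 := IntegralTransport.dense_reach_of_approximatelyControllable hk hL hL.le h
    have h2 := (IntegralTransport.reach_isClosed_and_finiteDimensional _
      (IntegralTransport.isCompactOperator_integralOperator hk) hL le_rfl).1
    -- The reachable space at time `L` is closed and dense.
    exact SetLike.coe_injective (h2.closure_eq.symm.trans h1.closure_eq)
  · rw [IntegralTransport.exactlyControllable_iff hk hL (hL.trans hT).le]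
    exact ⟨IntegralTransport.fattoriniCriterion_of_reach_eq_top hk hL (hL.trans hT).le,
      IntegralTransport.reach_eq_top_of_fattoriniCriterion hk hL hT⟩
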